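/- Graphs are finite, simple and undirected, with vertex set $\{0,\dots,n-1\}$, and every vertex $v$ of a graph $G$ carries a feature $Z(G,v)\in\{0,1\}^*$; $|G|=n$ is the order of $G$. A feature transformation $F$ assigns to every such $G$ and $v\in V(G)$ a bit string $F(G,v)$. Put $\mathrm{mpc}^{(0)}_G(v)=Z(G,v)$, $\mathrm{mpc}^{(t+1)}_G(v)=\bigl(\mathrm{mpc}^{(t)}_G(v),\{\!\{\mathrm{mpc}^{(t)}_G(w): w\in N_G(v)\}\!\}\bigr)$, and $\mathrm{mpc}_G(v)=\mathrm{mpc}^{(2|G|)}_G(v)$. $F$ is mp-invariant if $F(G,v)=F(H,w)$ whenever $|G|=|H|$ and $\mathrm{mpc}^{(t)}_G(v)=\mathrm{mpc}^{(t)}_H(w)$ for all $t\ge 1$. For a colour $c$ after $t$ rounds, $D(c)$ is the following levelled dag. Its level $t$ has one node, representing $c$; level $i-1$ has one node for each colour that is an element of a colour represented on level $i$, where the elements of $(d_0,\{\!\{d_1,\dots,d_m\}\!\})$ are $d_0,\dots,d_m$. From the node for $(d_0,M)$ there is an edge labelled $0$ to the node for $d_0$, and for each $d\in M$ an edge to the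 node for $d$ labelled by the multiplicity of $d$ in $M$. Each node on level $0$ is labelled by the bit string that it represents. Algorithms are multi-stack Turing machines; rooted graphs $(G,v)$ (by adjacency matrix, feature list and root) and dags (by leaf labels and, level by level, matrices of edge labels, with respect to an arbitrary numbering of the nodes of each level) are given as strings over a fixed finite alphabet, and an algorithm that is given a dag has to be correct for every numbering. For $T:\mathbb N^2\to\mathbb N$, "in time $T$" means in at most $T(n,k)$ steps for all $n,k$, all $G$ of order $n$ with all features of length at most $k$, and all $v\in V(G)$. **Lemma.** There is a polynomial $p$ such that the following holds. For every $G$ of order $n$ with features of length at most $k$ and every $v\in V(G)$, every string describing $D(\mathrm{mpc}_G(v))$ has length at most $p(n+k)$. Moreover, for every computable feature transformation $F$ (that is, some algorithm computes $F(G,v)$ from $(G,v)$): 1. $F$ is mp-invariant if and only if there is an algorithm that, given $D(\mathrm{mpc}_G(v))$, computes $F(G,v)$, for all $G$ and $v\in V(G)$. 2. If $F$ is mp-invariant and computable from $(G,v)$ in time $T(n,k)$, then there is an algorithm that, given $D(\mathrm{mpc}_G(v))$, computes $F(G,v)$ in time $T(n,k)+p(n+k)$. 3. Conversely, if some algorithm,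 given $D(\mathrm{mpc}_G(v))$, computes $F(G,v)$ in time $T(n,k)$, then $F$ is computable from $(G,v)$ in time $T(n,k)+p(n+k)$. -/

import Mathlib

namespace MsgPass

/-! ### Featured graphs and message-passing colours -/

/-- A finite simple undirected graph with vertex set `{0, …, order - 1}`, each vertex carrying a
finite bit string as its feature. -/
structure FeaturedGraph where
  order : ℕ
  graph : SimpleGraph (Fin order)
  feature : Fin order → List Bool

/-- A feature transformation maps a featured graph `G` to a new feature map on the vertices
of `G`. -/
abbrev FeatureTransformation : Type :=
  (G : FeaturedGraph) → Fin G.order → List Bool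

/-- The type of colours after `t` rounds: bit strings for `t = 0`, and pairs of a colour after
`t` rounds and a finite multiset of such colours for `t + 1`. -/
def Color : ℕ → Type
  | 0 => List Bool
  | t + 1 => Color t × Multiset (Color t)

/-- The first component `d₀` of a colour `(d₀, {{d₁, …, dₖ}})`. -/
def Color.prev {t : ℕ} (c : Color (t + 1)) : Color t := Prod.fst c

/-- The multiset `{{d₁, …, dₖ}}` of a colour `(d₀, {{d₁, …, dₖ}})`. -/
def Color.nbrs {t : ℕ} (c : Color (t + 1)) : Multiset (Color t) := Prod.snd c

open Classical in
/-- The message-passing colour of a vertex after `t` rounds. -/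
noncomputable def mpc (G : FeaturedGraph) : (t : ℕ) → Fin G.order → Color t
  | 0, v => G.feature v
  | t + 1, v => (mpc G t v, (Finset.univ.filter (G.graph.Adj v)).val.map (mpc G t))

/-- The final colour: the colour after `2|G|` rounds. -/
noncomputable def finalColor (G : FeaturedGraph) (v : Fin G.order) : Color (2 * G.order) :=
  mpc G (2 * G.order) v

/-- Message-passing invariance of a feature transformation. -/
def MPInvariant (F : FeatureTransformation) : Prop :=
  ∀ (G H : FeaturedGraph) (v : Fin G.order) (w : Fin H.order), G.order = H.order →
    (∀ t : ℕ, 1 ≤ t → mpc G t v = mpc H t w) → F G v = F H w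

/-! ### The dag of a colour -/

/-- A directed acyclic graph with levels `0, …, height`, whose edges go from some level `i + 1` to
level `i` and are labelled by natural numbers, and whose nodes on level `0` are labelled by bit
strings. Parallel edges with distinct labels are allowed: `edgeLabels i x y` is the set of the
labels of all edges from `x` to `y`. -/
structure LevelDag where
  height : ℕ
  /-- `Node i` is the set of nodes on level `i`. -/
  Node : ℕ → Type
  isEmpty_above : ∀ i, height < i → IsEmpty (Node i)
  edgeLabels : (i : ℕ) → Node (i + 1) → Node i → Finset ℕ
  leafLabel : Node 0 → List Bool

/-- `Occurs c i d`: the colour `d` belongs to the set `C_i` of colours represented on level `i` of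
the dag of `c`. The only colour on the top level `t` is `c`, and `C_i` consists of all elements of
colours in `C_{i+1}`, where the elements of `(d₀, {{d₁, …, dₖ}})` are `d₀, d₁, …, dₖ`. -/
inductive Occurs {t : ℕ} (c : Color t) : (i : ℕ) → Color i → Prop
  | top : Occurs c t c
  | prev {i : ℕ} {d : Color (i + 1)} : Occurs c (i + 1) d → Occurs c i d.prev
  | nbr {i : ℕ} {d : Color (i + 1)} {e : Color i} :
      Occurs c (i + 1) d → e ∈ d.nbrs → Occurs c i e

theorem Occurs.le {t : ℕ} {c : Color t} {i : ℕ} {d : Color i} (h : Occurs c i d) : i ≤ t := by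
  induction h with
  | top => exact le_rfl
  | prev _ ih => exact (Nat.le_succ _).trans ih
  | nbr _ _ ih => exact (Nat.le_succ _).trans ih

open Classical in
/-- The dag `D(c)` of a colour `c`. From a node representing `(d₀, M)` there is an edge labelled
`0` to the node representing `d₀`, and for every `e ∈ M` an edge to the node representing `e` that
is labelled by the multiplicity of `e` in `M`. -/
noncomputable def colorDag {t : ℕ} (c : Color t) : LevelDag where
  height := t
  Node i := {d : Color i // Occurs c i d}
  isEmpty_above _ hi := ⟨fun d => absurd d.2.le (Nat.not_le.mpr hi)⟩
  edgeLabels _ x y :=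
    (if y.1 = x.1.prev then {0} else ∅) ∪
      (if y.1 ∈ x.1.nbrs then {x.1.nbrs.count y.1} else ∅)
  leafLabel x := x.1

/-! ### Encoding graphs and dags as strings -/

/-- The input alphabet: two bits and two parentheses. -/
inductive Sym : Type
  | zero
  | one
  | lpar
  | rpar
  deriving DecidableEq

instance : Fintype Sym where
  elems := {Sym.zero, Sym.one, Sym.lpar, Sym.rpar}
  complete x := by cases x <;> simp

def paren (s : List Sym) : List Sym := Sym.lpar :: (s ++ [Sym.rpar])

def encodeBits (b : List Bool) : List Sym := paren (b.map fun x => cond x Sym.one Sym.zero)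

/-- Numbers are written in unary. -/
def encodeNat (n : ℕ) : List Sym := paren (List.replicate n Sym.one)

def encodeList (l : List (List Sym)) : List Sym := paren l.flatten

open Classical in
/-- The string for a rooted featured graph: the root (as the bit string of its indicator function),
the list of features, and the rows of the adjacency matrix. -/
noncomputable def encodeRooted (G : FeaturedGraph) (v : Fin G.order) : List Sym :=
  encodeList
    [ encodeBits (List.ofFn fun u => decide (u = v)),
      encodeList (List.ofFn fun u => encodeBits (G.feature u)),
      encodeList (List.ofFn fun u =>
        encodeBits (List.ofFn fun w => decide (G.graph.Adj u w))) ]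

/-- A numbering of the nodes of a dag, level by level. To hand a dag to a machine its nodes have to
be numbered, in an arbitrary way. -/
structure Numbering (D : LevelDag) where
  width : ℕ → ℕ
  num : (i : ℕ) → D.Node i ≃ Fin (width i)

/-- The string for a dag with numbered nodes: the list of the leaf labels, and the list that
contains, for `i = 0, …, height - 1`, the matrix of the (sorted) label lists of the edges from the
nodes on level `i + 1` (rows) to the nodes on level `i` (columns). -/
def encodeDag (D : LevelDag) (N : Numbering D) : List Sym :=
  encodeList
    [ encodeList (List.ofFn fun q => encodeBits (D.leafLabel ((N.num 0).symm q))),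
      encodeList ((List.range D.height).map fun i =>
        encodeList (List.ofFn fun p => encodeList (List.ofFn fun q =>
          encodeList (((D.edgeLabels i ((N.num (i + 1)).symm p) ((N.num i).symm q)).sort
            (· ≤ ·)).map encodeNat)))) ]

/-! ### Computation by Turing machines

Algorithms are (multi-stack) Turing machines in the sense of `Turing.FinTM2`, with input alphabet
`Sym` and output alphabet `Bool`. -/

/-- On input `s` the machine `M` halts with output `y`. -/
def Outputs (M : Turing.TM2ComputableAux Sym Bool) (s : List Sym) (y : List Bool) : Prop :=
  Nonempty (Turing.TM2Outputs M.tm (s.map M.inputAlphabet.symm)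
    (some (y.map M.outputAlphabet.symm)))

/-- On input `s` the machine `M` halts with output `y` after at most `m` steps. -/
def OutputsInTime (M : Turing.TM2ComputableAux Sym Bool) (s : List Sym) (y : List Bool) (m : ℕ) :
    Prop :=
  Nonempty (Turing.TM2OutputsInTime M.tm (s.map M.inputAlphabet.symm)
    (some (y.map M.outputAlphabet.symm)) m)

/-- All features of `G` have length at most `k`. -/
def FeatureBound (G : FeaturedGraph) (k : ℕ) : Prop :=
  ∀ u, (G.feature u).length ≤ k

/-- `F` is computable: some machine computes `F(G, v)` from `(G, v)`. -/
def IsComputable (F : FeatureTransformation) : Prop :=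
  ∃ M : Turing.TM2ComputableAux Sym Bool, ∀ (G : FeaturedGraph) (v : Fin G.order),
    Outputs M (encodeRooted G v) (F G v)

/-- `F` is computable in time `T`: some machine computes `F(G, v)` from `(G, v)` in at most
`T n k` steps, for all `G` of order `n` with features of length at most `k`. -/
def ComputableInTime (F : FeatureTransformation) (T : ℕ → ℕ → ℕ) : Prop :=
  ∃ M : Turing.TM2ComputableAux Sym Bool, ∀ (G : FeaturedGraph) (v : Fin G.order) (k : ℕ),
    FeatureBound G k → OutputsInTime M (encodeRooted G v) (F G v) (T G.order k)

/-- Some machine computes `F(G, v)` from the dag of the final colour of `v`, however the nodes of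
the dag are numbered. -/
def ComputableFromDag (F : FeatureTransformation) : Prop :=
  ∃ M : Turing.TM2ComputableAux Sym Bool, ∀ (G : FeaturedGraph) (v : Fin G.order)
    (N : Numbering (colorDag (finalColor G v))),
    Outputs M (encodeDag (colorDag (finalColor G v)) N) (F G v)

/-- Some machine computes `F(G, v)` from the dag of the final colour of `v` in at most `T n k`
steps, for all `G` of order `n` with features of length at most `k`. -/
def ComputableFromDagInTime (F : FeatureTransformation) (T : ℕ → ℕ → ℕ) : Prop :=
  ∃ M : Turing.TM2ComputableAux Sym Bool, ∀ (G : FeaturedGraph) (v : Fin G.order)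
    (N : Numbering (colorDag (finalColor G v))) (k : ℕ),
    FeatureBound G k →
      OutputsInTime M (encodeDag (colorDag (finalColor G v)) N) (F G v) (T G.order k)

end MsgPass

/-! A rooted graph and the dag of its final colour can be translated into one another in polynomial
time, up to message-passing equivalence. An algorithm for one kind of input, preceded by the
translation, is then an algorithm for the other.

From graph to dag. The nodes on level `i` are the colours after `i` rounds of the vertices at
distance at most `2n - i` from the root (`occurs_of_near`, `exists_near_of_occurs`). So every level
has at most `n` nodes, and the dag is of polynomial size even where the colour, written out as a
term, is exponentially long. Colour refinement on a Boolean matrix, together with balls around the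
root, produces its string for one particular numbering (`dagString_eq`).

From dag to graph. The graph `G` itself cannot be recovered, but by invariance any graph `H` of the
same order with a vertex of the same colours will do (`exists_graphString_eq`). Colours are stable
from round `n - 1` on (`stable_of_le`), and balls are closed under adjacency from radius `n - 1` on
(`near_closed`). Hence the nodes on level `n + 1` are the stable colour classes of the component of
the root, and the edges down to level `n` give the number `d c c'` of neighbours in class `c'` of a
vertex in class `c`. A graph with these numbers and the same features has the same colours
(`EquitablePartition.mpc_eq_mpc`).

It remains to find class sizes. The conditions in `Admissible` are necessary by double counting
(`EquitablePartition.admissible`). They are sufficient because biregular bipartite graphs and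
circulant graphs fill in the edges between and within the classes (`Admissible.card_cellAdj`).
Starting from sizes `1` and increasing whatever is too small never overtakes an admissible solution
(`Admissible.lt_of_tooSmall`), so `n` rounds lead to admissible sizes of total at most `n`
(`Admissible.classSizes`). Isolated vertices bring the order up to `n`.

Conversely, a function computed from dags is invariant: equal colours have equal dags, hence equal
strings for suitable numberings, and outputs are unique (`ComputableFromDag.mpInvariant`).

The translations are programs of a small stack language. `PolyTime` collects the functions on
tree-encoded data that such programs compute in polynomial time, and `preprocess` compiles a program
followed by a machine into one machine. The given machine is simulated step for step, which is why
the overhead is additive. -/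

namespace MsgPass

/-! ### A small structured language for stack machines -/

/-- Programs that work on stacks of symbols. -/
inductive Cmd (K : Type) : Type
  | skip : Cmd K
  | push (k : K) (a : Sym) : Cmd K
  | seq (c d : Cmd K) : Cmd K
  /-- Pop the stack `k` and continue according to the symbol obtained. -/
  | case (k : K) (f : Option Sym → Cmd K) : Cmd K
  /-- Pop the stack `k`; leave the loop if it was empty or the symbol satisfies `leave`, else run
  the body for this symbol and repeat. -/
  | loop (k : K) (leave : Sym → Bool) (f : Sym → Cmd K) : Cmd K

namespace Cmd

variable {K : Type}

section

variable [DecidableEq K]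

/-- One step of computation: a list of pending programs acts on the stacks. -/
def step : List (Cmd K) × (K → List Sym) → List (Cmd K) × (K → List Sym)
  | ([], s) => ([], s)
  | (skip :: r, s) => (r, s)
  | (push k a :: r, s) => (r, Function.update s k (a :: s k))
  | (seq c d :: r, s) => (c :: d :: r, s)
  | (case k f :: r, s) => (f (s k).head? :: r, Function.update s k (s k).tail)
  | (loop k leave f :: r, s) =>
      (match (s k).head? with
        | none => r
        | some a => if leave a then r else f a :: loop k leave f :: r,
        Function.update s k (s k).tail)

/-- The program `c` transforms the stacks `s` into `s'` in at most `T` steps. -/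
def Runs (c : Cmd K) (s s' : K → List Sym) (T : ℕ) : Prop :=
  ∃ t ≤ T, ∀ r, step^[t] (c :: r, s) = (r, s')

theorem Runs.mono {c : Cmd K} {s s' : K → List Sym} {T T' : ℕ} (h : Runs c s s' T)
    (hT : T ≤ T') : Runs c s s' T' :=
  let ⟨t, ht, h⟩ := h
  ⟨t, ht.trans hT, h⟩

theorem runs_skip (s : K → List Sym) : Runs skip s s 1 :=
  ⟨1, le_rfl, fun _ => rfl⟩

theorem runs_push (k : K) (a : Sym) (s : K → List Sym) :
    Runs (push k a) s (Function.update s k (a :: s k)) 1 :=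
  ⟨1, le_rfl, fun _ => rfl⟩

/-- The number of steps in `Runs` is the same for every pending rest, so `c` may be run with `d` in
front of that rest. The additional step unfolds the `seq`. -/
theorem Runs.seq {c d : Cmd K} {s s' s'' : K → List Sym} {T U : ℕ} (hc : Runs c s s' T)
    (hd : Runs d s' s'' U) : Runs (seq c d) s s'' (T + U + 1) := by
  obtain ⟨t, ht, hc⟩ := hc
  obtain ⟨u, hu, hd⟩ := hd
  refine ⟨u + t + 1, by omega, fun r => ?_⟩
  rw [Function.iterate_add_apply, Function.iterate_one, step, Function.iterate_add_apply, hc, hd]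

theorem Runs.case {k : K} {f : Option Sym → Cmd K} {s s' : K → List Sym} {T : ℕ}
    (h : Runs (f (s k).head?) (Function.update s k (s k).tail) s' T) :
    Runs (case k f) s s' (T + 1) := by
  obtain ⟨t, ht, h⟩ := h
  refine ⟨t + 1, by omega, fun r => ?_⟩
  rw [Function.iterate_add_apply, Function.iterate_one, step, h]

theorem runs_loop_nil {k : K} {leave : Sym → Bool} {f : Sym → Cmd K} {s : K → List Sym}
    (h : s k = []) : Runs (loop k leave f) s s 1 := by
  refine ⟨1, le_rfl, fun r => ?_⟩
  simp [step, h]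

theorem runs_loop_leave {k : K} {leave : Sym → Bool} {f : Sym → Cmd K} {s : K → List Sym} {a : Sym}
    {l : List Sym} (h : s k = a :: l) (ha : leave a = true) :
    Runs (loop k leave f) s (Function.update s k l) 1 := by
  refine ⟨1, le_rfl, fun r => ?_⟩
  simp [step, h, ha]

theorem Runs.loop {k : K} {leave : Sym → Bool} {f : Sym → Cmd K} {s s' s'' : K → List Sym}
    {a : Sym} {l : List Sym} {T U : ℕ} (h : s k = a :: l) (ha : leave a = false)
    (hf : Runs (f a) (Function.update s k l) s' T) (hl : Runs (loop k leave f) s' s'' U) :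
    Runs (loop k leave f) s s'' (T + U + 1) := by
  obtain ⟨t, ht, hf⟩ := hf
  obtain ⟨u, hu, hl⟩ := hl
  refine ⟨u + t + 1, by omega, fun r => ?_⟩
  rw [Function.iterate_add_apply, Function.iterate_one, step, Function.iterate_add_apply]
  simp [h, ha, hf, hl]

end

/-! ### Finiteness of the set of pending programs -/

/-- All lists of pending programs that can arise while `c` is run with `r` pending. -/
def pending : Cmd K → List (Cmd K) → Set (List (Cmd K))
  | skip, r => {skip :: r, r}
  | push k a, r => {push k a :: r, r}
  | seq c d, r => {seq c d :: r} ∪ pending c (d :: r) ∪ pending d r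
  | case k f, r => {case k f :: r} ∪ ⋃ o, pending (f o) r
  | loop k leave f, r => {loop k leave f :: r, r} ∪ ⋃ a, pending (f a) (loop k leave f :: r)

theorem self_mem_pending (c : Cmd K) (r : List (Cmd K)) : c :: r ∈ pending c r := by
  cases c <;> simp [pending]

theorem rest_mem_pending (c : Cmd K) (r : List (Cmd K)) : r ∈ pending c r := by
  induction c generalizing r with
  | seq c d _ ihd => simp [pending, ihd]
  | case k f ih => simp only [pending]; exact Or.inr (Set.mem_iUnion.2 ⟨none, ih _ _⟩)
  | _ => simp [pending]

/-- Branching is over the finite types `Option Sym` and `Sym`, and a loop body always runs with the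
same loop pending behind it, so repetition creates no new lists. Finiteness matters because these
lists become machine labels. -/
theorem finite_pending (c : Cmd K) (r : List (Cmd K)) : (pending c r).Finite := by
  induction c generalizing r with
  | seq c d ihc ihd => exact ((Set.finite_singleton _).union (ihc _)).union (ihd _)
  | case k f ih => exact (Set.finite_singleton _).union (Set.finite_iUnion fun o => ih o _)
  | loop k leave f ih => exact (Set.toFinite _).union (Set.finite_iUnion fun o => ih o _)
  | _ => simp [pending]

theorem step_mem_pending [DecidableEq K] (c : Cmd K) (r l : List (Cmd K)) (s : K → List Sym)
    (hl : l ∈ pending c r) (hr : l ≠ r) : (step (l, s)).1 ∈ pending c r := by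
  induction c generalizing r with
  | skip =>
    rcases hl with rfl | rfl
    · simp [step, pending]
    · exact absurd rfl hr
  | push k a =>
    rcases hl with rfl | rfl
    · simp [step, pending]
    · exact absurd rfl hr
  | seq c d ihc ihd =>
    have key : l ∈ pending d r → (step (l, s)).1 ∈ pending (seq c d) r :=
      fun h => Or.inr (ihd r h hr)
    rcases hl with (rfl | h) | h
    · exact Or.inl (Or.inr (self_mem_pending _ _))
    -- The list `d :: r` is both the exit of `c` and the entry of `d`; the induction hypothesis for
    -- `c` does not apply there.
    · by_cases h' : l = d :: r
      · exact key (h' ▸ self_mem_pending d r)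
      · exact Or.inl (Or.inr (ihc _ h h'))
    · exact key h
  | case k f ih =>
    rcases hl with rfl | h
    · exact Or.inr (Set.mem_iUnion.2 ⟨(s k).head?, self_mem_pending _ _⟩)
    · obtain ⟨o, h⟩ := Set.mem_iUnion.1 h
      exact Or.inr (Set.mem_iUnion.2 ⟨o, ih o r h hr⟩)
  | loop k leave f ih =>
    have key : l = loop k leave f :: r → (step (l, s)).1 ∈ pending (loop k leave f) r := by
      rintro rfl
      rw [step]
      cases h : (s k).head? with
      | none => exact Or.inl (Or.inr rfl)
      | some a =>
        by_cases ha : leave a = true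
        · simp only [ha]; exact Or.inl (Or.inr rfl)
        · simp only [ha]; exact Or.inr (Set.mem_iUnion.2 ⟨a, self_mem_pending _ _⟩)
    rcases hl with (h | h) | h
    · exact key h
    · exact absurd h hr
    · obtain ⟨a, h⟩ := Set.mem_iUnion.1 h
      by_cases h' : l = loop k leave f :: r
      · exact key h'
      · exact Or.inr (Set.mem_iUnion.2 ⟨a, ih a _ h h'⟩)

end Cmd

/-! ### Preprocessing the input of a machine -/

section Preprocess

open Turing TM2.Stmt

variable (c : Cmd (Fin 4)) (M : TM2ComputableAux Sym Bool)

/-- The labels of the machine that first runs `c` and then `M`. -/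
abbrev PreLabel : Type := Cmd.pending c [] ⊕ M.tm.Λ

/-- The stack alphabets of the machine that first runs `c` and then `M`. -/
abbrev PreAlphabet : Fin 4 ⊕ M.tm.K → Type
  | .inl _ => Sym
  | .inr k => M.tm.Γ k

abbrev PreStmt : Type := TM2.Stmt (PreAlphabet M) (PreLabel c M) (Option Sym × M.tm.σ)

open Classical in
/-- The label for a list of pending programs. -/
noncomputable def preLabel (l : List (Cmd (Fin 4))) : PreLabel c M :=
  -- The second value is junk: by `step_mem_pending` no run started at `[c]` leaves the set.
  if h : l ∈ Cmd.pending c [] then .inl ⟨l, h⟩ else .inr M.tm.main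

/-- The statements of `M`, as statements of the combined machine. -/
def liftStmt : TM2.Stmt M.tm.Γ M.tm.Λ M.tm.σ → PreStmt c M
  | push k f q => push (.inr k) (fun v => f v.2) (liftStmt q)
  | peek k f q => peek (.inr k) (fun v o => (none, f v.2 o)) (liftStmt q)
  | pop k f q => pop (.inr k) (fun v o => (none, f v.2 o)) (liftStmt q)
  | load f q => load (fun v => (none, f v.2)) (liftStmt q)
  | branch f q₁ q₂ => branch (fun v => f v.2) (liftStmt q₁) (liftStmt q₂)
  | goto f => goto fun v => .inr (f v.2)
  | halt => halt

/-- The statement that performs the next step of a list of pending programs. When no program is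
left, the stack `1` is moved to the input stack of `M`. -/
noncomputable def pendingStmt : List (Cmd (Fin 4)) → PreStmt c M
  | [] => pop (.inl 1) (fun v o => (o, v.2)) <|
      branch (fun v => v.1.isSome)
        (push (.inr M.tm.k₀) (fun v => M.inputAlphabet.symm (v.1.getD Sym.zero)) <|
          load (fun v => (none, v.2)) <| goto fun _ => preLabel c M [])
        (goto fun _ => .inr M.tm.main)
  | .skip :: r => goto fun _ => preLabel c M r
  | .push k a :: r => push (.inl k) (fun _ => a) <| goto fun _ => preLabel c M r
  | .seq d e :: r => goto fun _ => preLabel c M (d :: e :: r)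
  | .case k f :: r =>
      pop (.inl k) (fun v o => (o, v.2)) <| goto fun v => preLabel c M (f v.1 :: r)
  | .loop k leave f :: r =>
      pop (.inl k) (fun v o => (o, v.2)) <| goto fun v => preLabel c M <|
        match v.1 with
        | none => r
        | some a => if leave a then r else f a :: .loop k leave f :: r

/-- The program of the machine that first runs `c` and then `M`. -/
noncomputable def preProg : PreLabel c M → PreStmt c M
  | .inl l => pendingStmt c M l.1
  | .inr l => liftStmt c M (M.tm.m l)

/-- The configurations of the machine that first runs `c` and then `M`. -/
abbrev PreCfg : Type := TM2.Cfg (PreAlphabet M) (PreLabel c M) (Option Sym × M.tm.σ)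

/-- Stack contents of the combined machine. -/
def preStk (s : Fin 4 → List Sym) (S : ∀ k, List (M.tm.Γ k)) : ∀ k, List (PreAlphabet M k)
  | .inl k => s k
  | .inr k => S k

@[simp] theorem preStk_inl (s : Fin 4 → List Sym) (S : ∀ k, List (M.tm.Γ k)) (k : Fin 4) :
    preStk M s S (.inl k) = s k := rfl

@[simp] theorem preStk_inr (s : Fin 4 → List Sym) (S : ∀ k, List (M.tm.Γ k)) (k : M.tm.K) :
    preStk M s S (.inr k) = S k := rfl

@[simp] theorem update_preStk_inl (s : Fin 4 → List Sym) (S : ∀ k, List (M.tm.Γ k)) (k : Fin 4)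
    (a : List Sym) :
    Function.update (preStk M s S) (.inl k) a = preStk M (Function.update s k a) S := by
  funext k'
  rcases k' with k' | k'
  · by_cases h : k' = k
    · subst h; simp
    · simp [h]
  · simp

@[simp] theorem update_preStk_inr (s : Fin 4 → List Sym) (S : ∀ k, List (M.tm.Γ k)) (k : M.tm.K)
    (a : List (M.tm.Γ k)) :
    Function.update (preStk M s S) (.inr k) a = preStk M s (Function.update S k a) := by
  funext k'
  rcases k' with k' | k'
  · simp
  · by_cases h : k' = k
    · subst h; simp
    · simp [h]

/-- The machine that first runs `c` and then `M`. -/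
noncomputable def preprocess : TM2ComputableAux Sym Bool where
  tm :=
    { K := Fin 4 ⊕ M.tm.K
      kDecidableEq := inferInstance
      kFin := @instFintypeSum _ _ _ M.tm.kFin
      k₀ := .inl 0
      k₁ := .inr M.tm.k₁
      Γ := PreAlphabet M
      Λ := PreLabel c M
      main := .inl ⟨[c], Cmd.self_mem_pending c []⟩
      ΛFin := @instFintypeSum _ _ (Cmd.finite_pending c []).fintype M.tm.ΛFin
      σ := Option Sym × M.tm.σ
      initialState := (none, M.tm.initialState)
      σFin := @instFintypeProd _ _ inferInstance M.tm.σFin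
      Γk₀Fin := inferInstanceAs (Fintype Sym)
      m := preProg c M }
  inputAlphabet := Equiv.refl Sym
  outputAlphabet := M.outputAlphabet

theorem preLabel_of_mem {l : List (Cmd (Fin 4))} (h : l ∈ Cmd.pending c []) :
    preLabel c M l = .inl ⟨l, h⟩ := by
  simp [preLabel, h]

theorem update_vec_zero (a b c d e : List Sym) :
    Function.update ![a, b, c, d] 0 e = ![e, b, c, d] := by
  funext i; fin_cases i <;> rfl

theorem update_vec_one (a b c d e : List Sym) :
    Function.update ![a, b, c, d] 1 e = ![a, e, c, d] := by
  funext i; fin_cases i <;> rfl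

theorem update_vec_two (a b c d e : List Sym) :
    Function.update ![a, b, c, d] 2 e = ![a, b, e, d] := by
  funext i; fin_cases i <;> rfl

theorem update_vec_three (a b c d e : List Sym) :
    Function.update ![a, b, c, d] 3 e = ![a, b, c, e] := by
  funext i; fin_cases i <;> rfl

theorem vec_nil : (![[], [], [], []] : Fin 4 → List Sym) = fun _ => [] := by
  funext i; fin_cases i <;> rfl

/-- The configuration of the combined machine while programs are pending. -/
noncomputable def pendingCfg (l : List (Cmd (Fin 4))) (o : Option Sym) (s : Fin 4 → List Sym)
    (S : ∀ k, List (M.tm.Γ k)) : PreCfg c M where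
  l := some (preLabel c M l)
  var := (o, M.tm.initialState)
  stk := preStk M s S

/-- The configuration of the combined machine while `M` is running. -/
def liftCfg (C : TM2.Cfg M.tm.Γ M.tm.Λ M.tm.σ) : PreCfg c M where
  l := C.l.map .inr
  var := (none, C.var)
  stk := preStk M (fun _ => []) C.stk

theorem stepAux_liftStmt (q : TM2.Stmt M.tm.Γ M.tm.Λ M.tm.σ) (v : M.tm.σ)
    (S : ∀ k, List (M.tm.Γ k)) :
    TM2.stepAux (liftStmt c M q) (none, v) (preStk M (fun _ => []) S) =
      liftCfg c M (TM2.stepAux q v S) := by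
  induction q generalizing v S with
  | branch f q₁ q₂ ih₁ ih₂ =>
    simp only [liftStmt, TM2.stepAux]
    cases f v
    · exact ih₂ _ _
    · exact ih₁ _ _
  | goto f => rfl
  | halt => rfl
  | _ => simp [liftStmt, TM2.stepAux, *]

theorem step_liftCfg (C : TM2.Cfg M.tm.Γ M.tm.Λ M.tm.σ) :
    TM2.step (preProg c M) (liftCfg c M C) = (TM2.step M.tm.m C).map (liftCfg c M) := by
  obtain ⟨_ | l, v, S⟩ := C
  · rfl
  · exact congrArg some (stepAux_liftStmt c M _ _ _)

theorem iterate_liftCfg (n : ℕ) (C : Option (TM2.Cfg M.tm.Γ M.tm.Λ M.tm.σ)) :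
    (flip bind (TM2.step (preProg c M)))^[n] (C.map (liftCfg c M)) =
      ((flip bind (TM2.step M.tm.m))^[n] C).map (liftCfg c M) := by
  induction n generalizing C with
  | zero => rfl
  | succ n ih =>
    rw [Function.iterate_succ_apply, Function.iterate_succ_apply, ← ih]
    congr 1
    cases C with
    | none => rfl
    | some C => exact step_liftCfg c M C

theorem step_pendingCfg {l : List (Cmd (Fin 4))} (hl : l ∈ Cmd.pending c []) (hne : l ≠ [])
    (o : Option Sym) (s : Fin 4 → List Sym) (S : ∀ k, List (M.tm.Γ k)) :
    ∃ o', TM2.step (preProg c M) (pendingCfg c M l o s S) =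
      some (pendingCfg c M (Cmd.step (l, s)).1 o' (Cmd.step (l, s)).2 S) := by
  simp only [pendingCfg, preLabel_of_mem c M hl, TM2.step, preProg]
  match l, hne with
  | .skip :: r, _ => exact ⟨o, rfl⟩
  | .push k a :: r, _ => exact ⟨o, by simp [pendingStmt, TM2.stepAux, Cmd.step]⟩
  | .seq d e :: r, _ => exact ⟨o, rfl⟩
  | .case k f :: r, _ => exact ⟨(s k).head?, by simp [pendingStmt, TM2.stepAux, Cmd.step]⟩
  | .loop k leave f :: r, _ =>
    exact ⟨(s k).head?, by simp only [pendingStmt, TM2.stepAux, Cmd.step, update_preStk_inl]; rfl⟩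

/-- `Cmd.step` idles on the empty list, whereas the machine at the label of `[]` already begins to
move stack `1`. The simulation therefore stops as soon as nothing is pending, possibly before `t`
steps. -/
theorem exists_iterate_pendingCfg (t : ℕ) (l : List (Cmd (Fin 4))) (hl : l ∈ Cmd.pending c [])
    (o : Option Sym) (s : Fin 4 → List Sym) (S : ∀ k, List (M.tm.Γ k)) :
    ∃ t' ≤ t, ∃ o', (flip bind (TM2.step (preProg c M)))^[t'] (some (pendingCfg c M l o s S)) =
      some (pendingCfg c M (Cmd.step^[t] (l, s)).1 o' (Cmd.step^[t] (l, s)).2 S) := by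
  induction t generalizing l o s with
  | zero => exact ⟨0, le_rfl, o, rfl⟩
  | succ t ih =>
    by_cases hne : l = []
    · subst hne
      obtain ⟨t', ht', o', h⟩ := ih [] hl o s
      exact ⟨t', by omega, o', by rw [h, Function.iterate_succ_apply]; rfl⟩
    · obtain ⟨o₁, h₁⟩ := step_pendingCfg c M hl hne o s S
      obtain ⟨t', ht', o', h⟩ := ih _ (Cmd.step_mem_pending c [] l s hl hne) o₁ (Cmd.step (l, s)).2
      refine ⟨t' + 1, by omega, o', ?_⟩
      rw [Function.iterate_succ_apply, Function.iterate_succ_apply]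
      exact (congrArg _ h₁).trans h

/-- Moving symbols from one stack to another reverses them, so programs have to deliver their output
reversed. The last of the `w.length + 1` steps finds stack `1` empty and jumps to the start of `M`.
-/
theorem iterate_pendingCfg_nil (w : List Sym) (o : Option Sym) (S : ∀ k, List (M.tm.Γ k)) :
    (flip bind (TM2.step (preProg c M)))^[w.length + 1]
        (some (pendingCfg c M [] o ![[], w, [], []] S)) =
      some (liftCfg c M ⟨some M.tm.main, M.tm.initialState, Function.update S M.tm.k₀
        (w.reverse.map M.inputAlphabet.symm ++ S M.tm.k₀)⟩) := by
  have hmem := Cmd.rest_mem_pending c []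
  induction w generalizing o S with
  | nil =>
    simp only [List.length_nil, zero_add, Function.iterate_one]
    simp only [flip, Option.bind_eq_bind, Option.bind_some, TM2.step, pendingCfg,
      preLabel_of_mem c M hmem, preProg, pendingStmt, TM2.stepAux, liftCfg]
    simp [vec_nil]
  | cons a w ih =>
    rw [List.length_cons, Function.iterate_succ_apply]
    have h : flip bind (TM2.step (preProg c M)) (some (pendingCfg c M [] o ![[], a :: w, [], []] S))
        = some (pendingCfg c M [] none ![[], w, [], []] (Function.update S M.tm.k₀
          (M.inputAlphabet.symm a :: S M.tm.k₀))) := by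
      simp only [flip, Option.bind_eq_bind, Option.bind_some, TM2.step, pendingCfg,
        preLabel_of_mem c M hmem, preProg, pendingStmt, TM2.stepAux]
      simp [update_vec_one]
    rw [h, ih]
    simp

theorem initList_preprocess (s : List Sym) :
    initList (preprocess c M).tm (s.map (preprocess c M).inputAlphabet.symm) =
      pendingCfg c M [c] none ![s, [], [], []] (fun _ => []) := by
  simp only [initList, pendingCfg, preLabel_of_mem c M (Cmd.self_mem_pending c [])]
  refine congrArg (TM2.Cfg.mk _ _) (funext fun k => ?_)
  rcases k with k | k
  · fin_cases k
    · exact List.map_id s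
    all_goals rfl
  · rfl

theorem liftCfg_initList (w : List (M.tm.Γ M.tm.k₀)) :
    liftCfg c M ⟨some M.tm.main, M.tm.initialState, Function.update (fun _ => []) M.tm.k₀ w⟩ =
      liftCfg c M (initList M.tm w) := by
  congr 1
  refine congrArg (TM2.Cfg.mk _ _) (funext fun k => ?_)
  by_cases hk : k = M.tm.k₀
  · subst hk; simp
  · simp [hk]

/-- If `c` transforms the input `s` into the reversal of `s'` on stack `1`, then the combined
machine reaches, on input `s`, the initial configuration of `M` on input `s'`. -/
theorem exists_iterate_preprocess {s s' : List Sym} {T : ℕ}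
    (h : Cmd.Runs c ![s, [], [], []] ![[], s'.reverse, [], []] T) :
    ∃ t ≤ T + s'.length + 1, (flip bind (TM2.step (preProg c M)))^[t]
        (some (pendingCfg c M [c] none ![s, [], [], []] (fun _ => []))) =
      some (liftCfg c M (initList M.tm (s'.map M.inputAlphabet.symm))) := by
  obtain ⟨t, ht, h⟩ := h
  obtain ⟨t', ht', o, h'⟩ := exists_iterate_pendingCfg c M t [c] (Cmd.self_mem_pending c []) none
    ![s, [], [], []] (fun _ => [])
  rw [h] at h'
  refine ⟨s'.reverse.length + 1 + t', by simp; omega, ?_⟩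
  rw [Function.iterate_add_apply, h', iterate_pendingCfg_nil, ← liftCfg_initList]
  simp

theorem liftCfg_haltList (y : List Bool) :
    liftCfg c M (haltList M.tm (y.map M.outputAlphabet.symm)) =
      haltList (preprocess c M).tm (y.map (preprocess c M).outputAlphabet.symm) := by
  refine congrArg (TM2.Cfg.mk _ _) (funext fun k => ?_)
  rcases k with k | k
  · rfl
  · by_cases hk : k = M.tm.k₁
    · subst hk
      simp only [haltList, preStk_inr, dite_true]
      split
      · rfl
      · rename_i h; exact absurd rfl h
    · simp only [haltList, preStk_inr, hk, dite_false]
      split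
      · rename_i h; exact absurd (Sum.inr_injective h) hk
      · rfl

/-- One step of `M` is one step of the combined machine, so `m` enters with factor one. The rest
pays for the program and for moving its output. -/
theorem outputsInTime_preprocess {s s' : List Sym} {T m : ℕ} {y : List Bool}
    (h : Cmd.Runs c ![s, [], [], []] ![[], s'.reverse, [], []] T) (hM : OutputsInTime M s' y m) :
    OutputsInTime (preprocess c M) s y (m + (T + s'.length + 1)) := by
  obtain ⟨⟨⟨n, hn⟩, hnm⟩⟩ := hM
  obtain ⟨t, ht, h⟩ := exists_iterate_preprocess c M h
  refine ⟨⟨⟨n + t, ?_⟩, by simp only at hnm ⊢; omega⟩⟩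
  rw [Function.iterate_add_apply, initList_preprocess]
  refine (congrArg _ h).trans ((iterate_liftCfg c M n (some _)).trans ?_)
  refine (congrArg _ hn).trans ?_
  exact congrArg some (liftCfg_haltList c M y)

theorem outputs_iff_exists_outputsInTime (M : TM2ComputableAux Sym Bool) (s : List Sym)
    (y : List Bool) : Outputs M s y ↔ ∃ m, OutputsInTime M s y m :=
  ⟨fun ⟨h⟩ => ⟨h.steps, ⟨⟨h, le_rfl⟩⟩⟩, fun ⟨_, ⟨h⟩⟩ => ⟨h.toEvalsTo⟩⟩

theorem iterate_bind_none {σ : Type*} (f : σ → Option σ) (n : ℕ) :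
    (flip bind f)^[n] none = none := by
  induction n with
  | zero => rfl
  | succ n ih => rw [Function.iterate_succ_apply]; exact ih

/-- The output of a machine is unique. -/
theorem Outputs.unique {M : TM2ComputableAux Sym Bool} {s : List Sym} {y y' : List Bool}
    (h : Outputs M s y) (h' : Outputs M s y') : y = y' := by
  have key : ∀ (n n' : ℕ) (C D D' : M.tm.Cfg), D.l = none → D'.l = none → n ≤ n' →
      (flip bind M.tm.step)^[n] (some C) = some D →
      (flip bind M.tm.step)^[n'] (some C) = some D' → D = D' := by
    intro n n' C D D' hD hD' hn e e'
    obtain ⟨m, rfl⟩ := Nat.exists_eq_add_of_le' hn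
    rw [Function.iterate_add_apply, e] at e'
    cases m with
    | zero => simpa using e'
    | succ m =>
      rw [Function.iterate_succ_apply] at e'
      have : flip bind M.tm.step (some D) = none := by
        obtain ⟨l, v, S⟩ := D
        simp only at hD
        subst hD
        rfl
      rw [this, iterate_bind_none] at e'
      cases e'
  obtain ⟨⟨n, e⟩⟩ := h
  obtain ⟨⟨n', e'⟩⟩ := h'
  have : haltList M.tm (y.map M.outputAlphabet.symm) =
      haltList M.tm (y'.map M.outputAlphabet.symm) := by
    rcases le_total n n' with hn | hn
    · exact key n n' _ _ _ rfl rfl hn e e'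
    · exact (key n' n _ _ _ rfl rfl hn e' e).symm
  have := congrFun (congrArg TM2.Cfg.stk this) M.tm.k₁
  simp only [haltList, dif_pos] at this
  exact List.map_injective_iff.2 M.outputAlphabet.symm.injective this

end Preprocess

end MsgPass

namespace MsgPass

/-! ### Binary trees on a stack -/

/-- Binary trees, the universal data type of the programs below. -/
inductive Tree : Type
  | nil : Tree
  | cons (a b : Tree) : Tree

namespace Tree

/-- The Polish form of a tree. -/
def code : Tree → List Sym
  | nil => [Sym.rpar]
  | cons a b => Sym.lpar :: (a.code ++ b.code)

/-- The length of the Polish form. -/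
def size : Tree → ℕ
  | nil => 1
  | cons a b => a.size + b.size + 1

@[simp] theorem length_code (a : Tree) : a.code.length = a.size := by
  induction a with
  | nil => rfl
  | cons a b iha ihb => simp [code, size, iha, ihb]

theorem size_pos (a : Tree) : 0 < a.size := by
  cases a <;> simp [size]

/-- Codes consist of parentheses only, which leaves `zero` free as a separator on the work stacks.
-/
theorem zero_notMem_code (a : Tree) : Sym.zero ∉ a.code := by
  induction a with
  | nil => simp [code]
  | cons a b iha ihb => simp [code, iha, ihb]

end Tree

/-! ### Moving, copying and exchanging trees on the stacks -/

namespace Cmd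

theorem length_step_le {K : Type} [DecidableEq K] (q : List (Cmd K) × (K → List Sym)) (k : K) :
    ((step q).2 k).length ≤ (q.2 k).length + 1 := by
  have tail_le : ∀ (s : K → List Sym) (j : K),
      (Function.update s j (s j).tail k).length ≤ (s k).length + 1 := by
    intro s j
    by_cases h : k = j
    · subst h; simp; omega
    · simp [h]
  obtain ⟨l, s⟩ := q
  match l with
  | [] => simp [step]
  | skip :: r => simp [step]
  | push j a :: r =>
    by_cases h : k = j
    · subst h; simp [step]
    · simp [step, h]
  | seq c d :: r => simp [step]
  | case j f :: r => simpa [step] using tail_le s j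
  | loop j leave f :: r => simpa [step] using tail_le s j

/-- A step pushes at most one symbol. Time bounds thus yield size bounds, which composition of
polynomial-time functions needs. -/
theorem Runs.length_le {K : Type} [DecidableEq K] {c : Cmd K} {s s' : K → List Sym} {T : ℕ}
    (h : Runs c s s' T) (k : K) : (s' k).length ≤ (s k).length + T := by
  obtain ⟨t, ht, h⟩ := h
  have key : ∀ (t : ℕ) (q : List (Cmd K) × (K → List Sym)),
      ((step^[t] q).2 k).length ≤ (q.2 k).length + t := by
    intro t
    induction t with
    | zero => simp
    | succ t ih =>
      intro q
      rw [Function.iterate_succ_apply]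
      have := ih (step q)
      have := length_step_le q k
      omega
  have := key t ([c], s)
  rw [h] at this
  simp only at this
  omega

section Vec

variable {m x y z : List Sym} {s' : Fin 4 → List Sym} {T : ℕ} (a : Sym)

theorem runs_push_zero : Runs (push 0 a) ![m, x, y, z] ![a :: m, x, y, z] 1 := by
  simpa [update_vec_zero] using runs_push 0 a ![m, x, y, z]

theorem runs_push_one : Runs (push 1 a) ![m, x, y, z] ![m, a :: x, y, z] 1 := by
  simpa [update_vec_one] using runs_push 1 a ![m, x, y, z]

theorem runs_push_two : Runs (push 2 a) ![m, x, y, z] ![m, x, a :: y, z] 1 := by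
  simpa [update_vec_two] using runs_push 2 a ![m, x, y, z]

theorem runs_push_three : Runs (push 3 a) ![m, x, y, z] ![m, x, y, a :: z] 1 := by
  simpa [update_vec_three] using runs_push 3 a ![m, x, y, z]

variable {a}

theorem Runs.case_zero {f : Option Sym → Cmd (Fin 4)} (h : Runs (f (some a)) ![m, x, y, z] s' T) :
    Runs (Cmd.case 0 f) ![a :: m, x, y, z] s' (T + 1) :=
  Runs.case (s := ![a :: m, x, y, z]) (k := 0) (by simpa [update_vec_zero] using h)

variable {leave : Sym → Bool} {f : Sym → Cmd (Fin 4)}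

theorem runs_loop_leave_zero (ha : leave a = true) :
    Runs (loop 0 leave f) ![a :: m, x, y, z] ![m, x, y, z] 1 := by
  simpa [update_vec_zero] using runs_loop_leave (k := 0) (s := ![a :: m, x, y, z]) (f := f) rfl ha

theorem runs_loop_leave_one (ha : leave a = true) :
    Runs (loop 1 leave f) ![m, a :: x, y, z] ![m, x, y, z] 1 := by
  simpa [update_vec_one] using runs_loop_leave (k := 1) (s := ![m, a :: x, y, z]) (f := f) rfl ha

theorem runs_loop_leave_three (ha : leave a = true) :
    Runs (loop 3 leave f) ![m, x, y, a :: z] ![m, x, y, z] 1 := by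
  simpa [update_vec_three] using runs_loop_leave (k := 3) (s := ![m, x, y, a :: z]) (f := f) rfl ha

theorem Runs.loop_zero {s'' : Fin 4 → List Sym} {U : ℕ} (ha : leave a = false)
    (hf : Runs (f a) ![m, x, y, z] s' T) (hl : Runs (Cmd.loop 0 leave f) s' s'' U) :
    Runs (Cmd.loop 0 leave f) ![a :: m, x, y, z] s'' (T + U + 1) :=
  Runs.loop (k := 0) (s := ![a :: m, x, y, z]) rfl ha (by simpa [update_vec_zero] using hf) hl

theorem Runs.loop_one {s'' : Fin 4 → List Sym} {U : ℕ} (ha : leave a = false)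
    (hf : Runs (f a) ![m, x, y, z] s' T) (hl : Runs (Cmd.loop 1 leave f) s' s'' U) :
    Runs (Cmd.loop 1 leave f) ![m, a :: x, y, z] s'' (T + U + 1) :=
  Runs.loop (k := 1) (s := ![m, a :: x, y, z]) rfl ha (by simpa [update_vec_one] using hf) hl

theorem Runs.loop_three {s'' : Fin 4 → List Sym} {U : ℕ} (ha : leave a = false)
    (hf : Runs (f a) ![m, x, y, z] s' T) (hl : Runs (Cmd.loop 3 leave f) s' s'' U) :
    Runs (Cmd.loop 3 leave f) ![m, x, y, a :: z] s'' (T + U + 1) :=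
  Runs.loop (k := 3) (s := ![m, x, y, a :: z]) rfl ha (by simpa [update_vec_three] using hf) hl

end Vec

/-- Pop the symbols above the topmost `zero` of stack `i`, and this `zero`, running `f` for each
of the former. -/
abbrev transfer (i : Fin 4) (f : Sym → Cmd (Fin 4)) : Cmd (Fin 4) :=
  loop i (fun a => decide (a = Sym.zero)) f

theorem runs_transfer {i j : Fin 4} (hij : i ≠ j) {w r : List Sym} (hw : Sym.zero ∉ w)
    (s : Fin 4 → List Sym) (hs : s i = w ++ Sym.zero :: r) :
    Runs (transfer i (push j)) s
      (Function.update (Function.update s i r) j (w.reverse ++ s j)) (2 * w.length + 1) := by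
  induction w generalizing s with
  | nil =>
    have := runs_loop_leave (f := push j) (leave := fun a => decide (a = Sym.zero)) hs (by simp)
    convert this using 1
    swap; · simp
    funext k
    by_cases hk : k = j
    · subst hk; simp [hij.symm]
    · simp [hk]
  | cons a w ih =>
    simp only [List.mem_cons, not_or] at hw
    have h1 := runs_push j a (Function.update s i (w ++ Sym.zero :: r))
    have h2 := ih hw.2 _ (show (Function.update (Function.update s i (w ++ Sym.zero :: r)) j
      (a :: (Function.update s i (w ++ Sym.zero :: r)) j)) i = _ by simp [hij])
    have := Runs.loop (leave := fun a => decide (a = Sym.zero)) hs (by simp [Ne.symm hw.1]) h1 h2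
    convert this.mono (T' := 2 * (a :: w).length + 1) (by simp; omega) using 1
    funext k
    by_cases hk : k = j
    · subst hk; simp [hij.symm]
    · by_cases hk' : k = i
      · subst hk'; simp [hij]
      · simp [hk, hk']

section Vec

variable {w m x y z : List Sym} 

theorem runs_transfer_one_two (hw : Sym.zero ∉ w) :
    Runs (transfer 1 (push 2)) ![m, w ++ Sym.zero :: x, y, z]
      ![m, x, w.reverse ++ y, z] (2 * w.length + 1) := by
  simpa [update_vec_one, update_vec_two] using
    runs_transfer (i := 1) (j := 2) (r := x) (by decide) hw ![m, w ++ Sym.zero :: x, y, z] rfl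

theorem runs_transfer_two_one (hw : Sym.zero ∉ w) :
    Runs (transfer 2 (push 1)) ![m, x, w ++ Sym.zero :: y, z]
    ![m, w.reverse ++ x, y, z] (2 * w.length + 1) := by
  simpa [update_vec_one, update_vec_two] using
    runs_transfer (i := 2) (j := 1) (r := y) (by decide) hw ![m, x, w ++ Sym.zero :: y, z] rfl

theorem runs_transfer_one_zero (hw : Sym.zero ∉ w) :
    Runs (transfer 1 (push 0)) ![m, w ++ Sym.zero :: x, y, z]
    ![w.reverse ++ m, x, y, z] (2 * w.length + 1) := by
  simpa [update_vec_one, update_vec_zero] using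
    runs_transfer (i := 1) (j := 0) (r := x) (by decide) hw ![m, w ++ Sym.zero :: x, y, z] rfl

theorem runs_discard (hw : Sym.zero ∉ w) :
    Runs (transfer 1 fun _ => skip) ![m, w ++ Sym.zero :: x, y, z]
    ![m, x, y, z] (2 * w.length + 1) := by
  induction w with
  | nil => exact runs_loop_leave_one rfl
  | cons a w ih =>
    simp only [List.mem_cons, not_or] at hw
    have : Runs (transfer 1 fun _ => skip) ![m, a :: w ++ Sym.zero :: x, y, z] _ _ :=
      Runs.loop_one (by simp [Ne.symm hw.1]) (runs_skip _) (ih hw.2)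
    exact this.mono (by simp; omega)

theorem runs_transfer_one_zero_two (hw : Sym.zero ∉ w) :
    Runs (transfer 1 fun a => seq (push 0 a) (push 2 a)) ![m, w ++ Sym.zero :: x, y, z]
      ![w.reverse ++ m, x, w.reverse ++ y, z] (4 * w.length + 1) := by
  induction w generalizing m y with
  | nil => exact runs_loop_leave_one rfl
  | cons a w ih =>
    simp only [List.mem_cons, not_or] at hw
    have : Runs (transfer 1 fun a => seq (push 0 a) (push 2 a))
        ![m, a :: w ++ Sym.zero :: x, y, z] _ _ :=
      Runs.loop_one (by simp [Ne.symm hw.1]) ((runs_push_zero a).seq (runs_push_two a)) (ih hw.2)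
    simpa using this.mono (T' := 4 * (a :: w).length + 1) (by simp; omega)

end Vec

/-- Move the topmost tree of stack `0`, reversed and with a separator below it, to stack `1`. -/
def moveTree : Cmd (Fin 4) :=
  seq (push 1 Sym.zero) <| seq (push 3 Sym.zero) <| seq (push 3 Sym.one) <|
    loop 3 (fun a => decide (a ≠ Sym.one)) fun _ => case 0 fun
      | some Sym.lpar => seq (push 1 Sym.lpar) (seq (push 3 Sym.one) (push 3 Sym.one))
      | some Sym.rpar => push 1 Sym.rpar
      | _ => skip

variable {m x y z : List Sym}

/-- The `one`s on stack `3` count the trees still to be read: an `lpar` replaces one by two, an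
`rpar` uses one up. Since the loop goes on after `v` if further trees are due, the induction carries
the remaining run `h` along. -/
theorem runs_moveTree_loop {s' : Fin 4 → List Sym} {T : ℕ} {f : Sym → Cmd (Fin 4)}
    (hf : ∀ a, f a = Cmd.case (0 : Fin 4) fun
      | some Sym.lpar => seq (push 1 Sym.lpar) (seq (push 3 Sym.one) (push 3 Sym.one))
      | some Sym.rpar => push 1 Sym.rpar
      | _ => skip) (v : Tree)
    (h : Runs (loop 3 (fun a => decide (a ≠ Sym.one)) f) ![m, v.code.reverse ++ x, y, z] s' T) :
    Runs (loop 3 (fun a => decide (a ≠ Sym.one)) f) ![v.code ++ m, x, y, Sym.one :: z] s'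
      (T + 7 * v.size) := by
  induction v generalizing m x z T with
  | nil =>
    refine (Runs.loop (k := 3) (a := Sym.one) (l := z) rfl (by simp) ?_ h).mono (T := 2 + T + 1) ?_
    · rw [hf, update_vec_three]
      exact Runs.case_zero (a := Sym.rpar) (runs_push_one _)
    · simp [Tree.size]; omega
  | cons a b iha ihb =>
    refine (Runs.loop (k := 3) (a := Sym.one) (l := z) rfl (by simp)
      (s' := ![a.code ++ (b.code ++ m), Sym.lpar :: x, y, Sym.one :: Sym.one :: z]) ?_
      (iha (ihb (T := T) ?_))).mono (T := 6 + (T + 7 * b.size + 7 * a.size) + 1) ?_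
    · rw [hf, update_vec_three, Tree.code, List.cons_append, List.append_assoc]
      exact Runs.case_zero (a := Sym.lpar)
        ((runs_push_one _).seq ((runs_push_three _).seq (runs_push_three _)))
    · simpa [Tree.code] using h
    · simp [Tree.size]; omega

theorem runs_moveTree (v : Tree) : Runs moveTree ![v.code ++ m, x, y, z]
    ![m, v.code.reverse ++ Sym.zero :: x, y, z] (7 * v.size + 7) := by
  refine ((runs_push_one _).seq ((runs_push_three _).seq ((runs_push_three _).seq
    (runs_moveTree_loop (fun _ => rfl) v (T := 1) ?_)))).mono (by omega)
  exact runs_loop_leave_three rfl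

theorem zero_notMem_reverse_code (v : Tree) : Sym.zero ∉ v.code.reverse := by
  simpa using v.zero_notMem_code

/-- Delete the topmost tree of stack `0`. -/
def dropTree : Cmd (Fin 4) := seq moveTree (transfer 1 fun _ => skip)

theorem runs_dropTree (v : Tree) :
    Runs dropTree ![v.code ++ m, x, y, z] ![m, x, y, z] (9 * v.size + 9) :=
  ((runs_moveTree v).seq (runs_discard (zero_notMem_reverse_code v))).mono (by simp; omega)

/-- Duplicate the topmost tree of stack `0`. -/
def dupTree : Cmd (Fin 4) :=
  seq moveTree <| seq (push 2 Sym.zero) <| seq (transfer 1 fun a => seq (push 0 a) (push 2 a)) <|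
    seq (push 1 Sym.zero) <| seq (transfer 2 (push 1)) (transfer 1 (push 0))

theorem runs_dupTree (v : Tree) : Runs dupTree ![v.code ++ m, x, y, z]
    ![v.code ++ (v.code ++ m), x, y, z] (15 * v.size + 17) := by
  have h : Runs dupTree _ _ _ :=
    (runs_moveTree (m := m) (x := x) (y := y) (z := z) v).seq <| (runs_push_two _).seq <|
    (runs_transfer_one_zero_two (zero_notMem_reverse_code v)).seq <| (runs_push_one Sym.zero).seq <|
    (runs_transfer_two_one (by simpa using v.zero_notMem_code)).seq
    (runs_transfer_one_zero (by simpa using v.zero_notMem_code))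
  simpa using h.mono (T' := 15 * v.size + 17) (by simp; omega)

/-- Exchange the two topmost trees of stack `0`. -/
def swapTree : Cmd (Fin 4) :=
  seq moveTree <| seq moveTree <| seq (push 2 Sym.zero) <| seq (transfer 1 (push 2)) <|
    seq (transfer 1 (push 0)) <| seq (push 1 Sym.zero) <| seq (transfer 2 (push 1))
      (transfer 1 (push 0))

theorem runs_swapTree (v w : Tree) : Runs swapTree ![v.code ++ (w.code ++ m), x, y, z]
    ![w.code ++ (v.code ++ m), x, y, z] (9 * v.size + 13 * w.size + 27) := by
  have h : Runs swapTree _ _ _ :=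
    (runs_moveTree (m := w.code ++ m) (x := x) (y := y) (z := z) v).seq <|
    (runs_moveTree w).seq <| (runs_push_two Sym.zero).seq <|
    (runs_transfer_one_two (zero_notMem_reverse_code w)).seq <|
    (runs_transfer_one_zero (zero_notMem_reverse_code v)).seq <| (runs_push_one Sym.zero).seq <|
    (runs_transfer_two_one (by simpa using w.zero_notMem_code)).seq
    (runs_transfer_one_zero (by simpa using w.zero_notMem_code))
  simpa using h.mono (T' := 9 * v.size + 13 * w.size + 27) (by simp; omega)

/-- Push the tree `v` to stack `0`. -/
def pushTree : Tree → Cmd (Fin 4)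
  | .nil => push 0 Sym.rpar
  | .cons a b => seq (pushTree b) (seq (pushTree a) (push 0 Sym.lpar))

theorem runs_pushTree (v : Tree) :
    Runs (pushTree v) ![m, x, y, z] ![v.code ++ m, x, y, z] (3 * v.size) := by
  induction v generalizing m with
  | nil => exact (runs_push_zero _).mono (by simp [Tree.size])
  | cons a b iha ihb =>
    have : Runs (pushTree (.cons a b)) _ _ _ :=
      (ihb (m := m)).seq (iha.seq (runs_push_zero Sym.lpar))
    simpa [Tree.code] using this.mono (T' := 3 * (Tree.cons a b).size) (by simp [Tree.size]; omega)

end Cmd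

end MsgPass

namespace MsgPass

/-! ### Functions computable in polynomial time -/

theorem eval_mono (p : Polynomial ℕ) {x y : ℕ} (h : x ≤ y) : p.eval x ≤ p.eval y := by
  rw [Polynomial.eval_eq_sum, Polynomial.eval_eq_sum]
  exact Finset.sum_le_sum fun i _ => Nat.mul_le_mul_left _ (Nat.pow_le_pow_left h i)

/-- Types whose elements are represented by trees. -/
class TreeRep (α : Type) where
  enc : α → Tree

open TreeRep

/-- The size of the representation of an element. -/
def rsize {α : Type} [TreeRep α] (a : α) : ℕ := (enc a).size

theorem rsize_pos {α : Type} [TreeRep α] (a : α) : 0 < rsize a := Tree.size_pos _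

/-- `f` is computed in polynomial time by a program that replaces the tree on top of stack `0` and
leaves everything else as it was. -/
@[fun_prop]
def PolyTime {α β : Type} [TreeRep α] [TreeRep β] (f : α → β) : Prop :=
  ∃ (c : Cmd (Fin 4)) (p : Polynomial ℕ), ∀ (a : α) (m x y z : List Sym),
    c.Runs ![(enc a).code ++ m, x, y, z] ![(enc (f a)).code ++ m, x, y, z] (p.eval (rsize a))

variable {α β γ δ σ : Type} [TreeRep α] [TreeRep β] [TreeRep γ] [TreeRep δ] [TreeRep σ]

instance : TreeRep (α × β) := ⟨fun p => .cons (enc p.1) (enc p.2)⟩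

instance : TreeRep Unit := ⟨fun _ => .nil⟩

instance : TreeRep Bool := ⟨fun b => cond b (.cons .nil .nil) .nil⟩

/-- Numbers are represented in unary. -/
def encNat : ℕ → Tree
  | 0 => .nil
  | n + 1 => .cons .nil (encNat n)

instance : TreeRep ℕ := ⟨encNat⟩

def encList : List α → Tree
  | [] => .nil
  | a :: l => .cons (enc a) (encList l)

instance : TreeRep (List α) := ⟨encList⟩

theorem enc_pair (a : α) (b : β) : enc (a, b) = .cons (enc a) (enc b) := rfl
theorem enc_cons (a : α) (l : List α) : enc (a :: l) = .cons (enc a) (enc l) := rfl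

@[simp] theorem rsize_pair (a : α) (b : β) : rsize (a, b) = rsize a + rsize b + 1 := rfl
@[simp] theorem rsize_nil : rsize ([] : List α) = 1 := rfl
@[simp] theorem rsize_cons (a : α) (l : List α) : rsize (a :: l) = rsize a + rsize l + 1 := rfl

@[simp] theorem rsize_nat (n : ℕ) : rsize n = 2 * n + 1 := by
  induction n with
  | zero => rfl
  | succ n ih =>
    have : rsize (n + 1) = 1 + rsize n + 1 := rfl
    omega

theorem rsize_bool_le (b : Bool) : rsize b ≤ 3 := by
  cases b <;> simp [rsize, enc, Tree.size]

theorem length_le_rsize (l : List α) : 2 * l.length + 1 ≤ rsize l := by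
  induction l with
  | nil => simp
  | cons a l ih =>
    have := rsize_pos a
    simp only [rsize_cons, List.length_cons]; omega

theorem rsize_le_of_mem {a : α} {l : List α} (h : a ∈ l) : rsize a ≤ rsize l := by
  induction l with
  | nil => simp at h
  | cons b l ih =>
    rcases List.mem_cons.1 h with rfl | h
    · simp only [rsize_cons]; omega
    · have := ih h
      simp only [rsize_cons]; omega

theorem rsize_list_le {l : List α} {B : ℕ} (h : ∀ a ∈ l, rsize a ≤ B) :
    rsize l ≤ l.length * (B + 1) + 1 := by
  induction l with
  | nil => simp
  | cons a l ih =>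
    have h1 := h a (by simp)
    have h2 := ih fun b hb => h b (by simp [hb])
    simp only [rsize_cons, List.length_cons, Nat.succ_mul]; omega

namespace PolyTime

open Cmd

/-- The size of the result of a polynomial-time function is polynomially bounded. -/
theorem exists_rsize_le {f : α → β} (hf : PolyTime f) :
    ∃ p : Polynomial ℕ, ∀ a, rsize (f a) ≤ p.eval (rsize a) := by
  obtain ⟨c, p, h⟩ := hf
  refine ⟨.X + p, fun a => ?_⟩
  have := (h a [] [] [] []).length_le 0
  simpa [rsize] using this

/-- Changing the type without changing the tree is free. In this way a nonempty list is a pair, and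
a number is a list of units. -/
theorem of_enc_eq (f : α → β) (h : ∀ a, enc (f a) = enc a) : PolyTime f :=
  ⟨skip, 1, fun a m x y z => by rw [h]; simpa using runs_skip _⟩

@[fun_prop]
protected theorem id : PolyTime (fun a : α => a) := of_enc_eq _ fun _ => rfl

@[fun_prop]
theorem comp {g : β → γ} {f : α → β} (hg : PolyTime g) (hf : PolyTime f) :
    PolyTime (fun a => g (f a)) := by
  obtain ⟨q, hq⟩ := hf.exists_rsize_le
  obtain ⟨c, p, hf⟩ := hf
  obtain ⟨d, r, hg⟩ := hg
  refine ⟨seq c d, p + r.comp q + 1, fun a m x y z => ?_⟩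
  refine ((hf a m x y z).seq (hg (f a) m x y z)).mono ?_
  have := eval_mono r (hq a)
  simp only [Polynomial.eval_add, Polynomial.eval_comp, Polynomial.eval_one]
  omega

@[fun_prop]
protected theorem const (b : β) : PolyTime (fun _ : α => b) := by
  refine ⟨seq dropTree (pushTree (enc b)), 9 * .X + .C (3 * rsize b + 10), fun a m x y z => ?_⟩
  refine ((runs_dropTree _).seq (runs_pushTree _)).mono ?_
  simp [rsize]; omega

-- A second copy of the input waits below while `f` is computed; the swaps bring it up for `g` and
-- restore the order of the results.
@[fun_prop]
theorem prodMk {f : α → β} {g : α → γ} (hf : PolyTime f) (hg : PolyTime g) :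
    PolyTime (fun a => (f a, g a)) := by
  obtain ⟨pf, hpf⟩ := hf.exists_rsize_le
  obtain ⟨pg, hpg⟩ := hg.exists_rsize_le
  obtain ⟨c, p, hf⟩ := hf
  obtain ⟨d, q, hg⟩ := hg
  refine ⟨seq dupTree <| seq c <| seq swapTree <| seq d <| seq swapTree (push 0 Sym.lpar),
    28 * .X + p + 22 * pf + q + 9 * pg + 77, fun a m x y z => ?_⟩
  have h := (runs_dupTree (m := m) (x := x) (y := y) (z := z) (enc a)).seq <|
    (hf a _ x y z).seq <| (runs_swapTree _ _).seq <| (hg a _ x y z).seq <|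
    (runs_swapTree _ _).seq (runs_push_zero Sym.lpar)
  simp only [enc_pair, Tree.code, List.cons_append, List.append_assoc]
  refine h.mono ?_
  have h1 := hpf a
  have h2 := hpg a
  simp only [rsize] at h1 h2 ⊢
  simp only [Polynomial.eval_add, Polynomial.eval_mul, Polynomial.eval_ofNat, Polynomial.eval_X]
  omega

@[fun_prop]
protected theorem fst : PolyTime (fun p : α × β => p.1) := by
  refine ⟨case 0 fun _ => seq swapTree dropTree, 22 * .X + 60, fun ⟨a, b⟩ m x y z => ?_⟩
  simp only [enc_pair, Tree.code, List.cons_append, List.append_assoc]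
  refine (Runs.case_zero ((runs_swapTree _ _).seq (runs_dropTree _))).mono ?_
  simp [rsize, enc, Tree.size]; omega

@[fun_prop]
protected theorem snd : PolyTime (fun p : α × β => p.2) := by
  refine ⟨case 0 fun _ => dropTree, 9 * .X + 60, fun ⟨a, b⟩ m x y z => ?_⟩
  simp only [enc_pair, Tree.code, List.cons_append, List.append_assoc]
  refine (Runs.case_zero (runs_dropTree _)).mono ?_
  simp [rsize, enc, Tree.size]; omega

/-- Case distinction on the representation of `l a`. -/
theorem casesOn {l : α → σ} {n : α → δ} {c : α × β × γ → δ} {f : α → δ} (hl : PolyTime l)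
    (hn : PolyTime n) (hc : PolyTime c)
    (h : ∀ a, (enc (l a) = .nil ∧ f a = n a) ∨
      ∃ b t, enc (l a) = .cons (enc b) (enc t) ∧ f a = c (a, b, t)) : PolyTime f := by
  obtain ⟨pl, hpl⟩ := hl.exists_rsize_le
  obtain ⟨cl, p, hl⟩ := hl
  obtain ⟨cn, q, hn⟩ := hn
  obtain ⟨cc, r, hc⟩ := hc
  refine ⟨seq dupTree <| seq cl <| case 0 fun
    | some Sym.lpar => seq (push 0 Sym.lpar) <| seq swapTree <| seq (push 0 Sym.lpar) cc
    | _ => cn, 28 * .X + p + q + 9 * pl + r.comp (.X + pl + 1) + 60, fun a m x y z => ?_⟩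
  simp only [Polynomial.eval_add, Polynomial.eval_mul, Polynomial.eval_ofNat, Polynomial.eval_X,
    Polynomial.eval_comp, Polynomial.eval_one]
  have hd := (runs_dupTree (m := m) (x := x) (y := y) (z := z) (enc a))
  rcases h a with ⟨hnil, hfa⟩ | ⟨b, t, hcons, hfa⟩
  · have h2 := hl a ((enc a).code ++ m) x y z
    rw [hnil] at h2
    rw [hfa]
    refine (hd.seq (h2.seq (Runs.case_zero (hn a m x y z)))).mono ?_
    simp only [rsize]; omega
  · have h2 := hl a ((enc a).code ++ m) x y z
    rw [hcons] at h2
    have h3 := hc (a, b, t) m x y z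
    have h4 := runs_swapTree (m := m) (x := x) (y := y) (z := z) (.cons (enc b) (enc t)) (enc a)
    simp only [enc_pair, Tree.code, List.cons_append, List.append_assoc] at h2 h3 h4
    have h5 : rsize (a, b, t) ≤ rsize a + pl.eval (rsize a) + 1 := by
      have := hpl a
      simp only [rsize, hcons, enc_pair, Tree.size] at this ⊢
      omega
    have h6 := eval_mono r h5
    have h7 := hpl a
    rw [hfa]
    refine (hd.seq (h2.seq (Runs.case_zero ((runs_push_zero _).seq (h4.seq
      ((runs_push_zero _).seq h3)))))).mono ?_
    simp only [rsize, hcons, Tree.size] at h5 h6 h7 ⊢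
    omega

/-- In the Polish form of a list every cell begins with `lpar` and the end is `rpar`, so the loop
runs once per element. It turns a list into a unary counter on stack `3`. -/
theorem runs_countLoop {f : Sym → Cmd (Fin 4)}
    (hf : ∀ a, f a = seq dropTree (push 3 Sym.one)) (l : List β) (m x y z : List Sym) :
    Runs (loop 0 (fun a => decide (a ≠ Sym.lpar)) f) ![(enc l).code ++ m, x, y, z]
      ![m, x, y, List.replicate l.length Sym.one ++ z] (21 * rsize l) := by
  induction l generalizing z with
  | nil =>
    exact (runs_loop_leave_zero (a := Sym.rpar) rfl).mono (by simp)
  | cons a l ih =>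
    have h := Runs.loop_zero (leave := fun a => decide (a ≠ Sym.lpar)) (a := Sym.lpar) rfl
      (hf _ ▸ (runs_dropTree (enc a)).seq (runs_push_three _)) (ih (Sym.one :: z))
    rw [enc_cons, Tree.code, List.cons_append, List.append_assoc]
    have e : List.replicate (a :: l).length Sym.one ++ z =
        List.replicate l.length Sym.one ++ Sym.one :: z := by
      rw [List.length_cons, List.replicate_succ', List.append_assoc]; rfl
    rw [e]
    refine h.mono ?_
    have := rsize_pos a
    simp only [rsize_cons]
    simp only [rsize] at this ⊢
    omega

theorem runs_iterateLoop {g : σ → σ} {c : Cmd (Fin 4)} {B : ℕ} (n : ℕ) (s : σ)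
    (hc : ∀ i < n, ∀ m x y z, Runs c ![(enc (g^[i] s)).code ++ m, x, y, z]
      ![(enc (g^[i + 1] s)).code ++ m, x, y, z] B) (m x y z : List Sym) :
    Runs (loop 3 (fun a => decide (a ≠ Sym.one)) fun _ => c)
      ![(enc s).code ++ m, x, y, List.replicate n Sym.one ++ Sym.zero :: z]
      ![(enc (g^[n] s)).code ++ m, x, y, z] (n * (B + 1) + 1) := by
  induction n generalizing s with
  | zero =>
    exact (runs_loop_leave_three rfl).mono (by simp)
  | succ n ih =>
    refine (Runs.loop_three (leave := fun a => decide (a ≠ Sym.one)) (a := Sym.one) rfl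
      (hc 0 (by omega) _ _ _ _) (ih (g s) fun i hi => hc (i + 1) (by omega))).mono ?_
    simp only [Nat.succ_mul]; omega

/-- Iteration of a polynomial-time function, with polynomially bounded intermediate results. -/
theorem iterate {l : α → List β} {s : α → σ} {g : σ → σ} (hl : PolyTime l) (hs : PolyTime s)
    (hg : PolyTime g) (hb : ∃ p : Polynomial ℕ, ∀ a, ∀ i ≤ (l a).length,
      rsize (g^[i] (s a)) ≤ p.eval (rsize a)) : PolyTime (fun a => g^[(l a).length] (s a)) := by
  obtain ⟨B, hB⟩ := hb
  obtain ⟨pl, hpl⟩ := hl.exists_rsize_le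
  obtain ⟨c, p, hc⟩ := hl.prodMk hs
  obtain ⟨d, r, hd⟩ := hg
  -- The `zero` below the counter keeps it apart from whatever already lies on stack `3`, such as
  -- the counter of an enclosing iteration.
  refine ⟨seq c <| case 0 fun _ => seq (push 3 Sym.zero) <|
    seq (loop 0 (fun a => decide (a ≠ Sym.lpar)) fun _ => seq dropTree (push 3 Sym.one)) <|
    loop 3 (fun a => decide (a ≠ Sym.one)) fun _ => d,
    p + 21 * pl + pl * (r.comp B + 1) + 60, fun a m x y z => ?_⟩
  have h1 := hc a m x y z
  simp only [enc_pair, Tree.code, List.cons_append, List.append_assoc] at h1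
  have h2 := runs_iterateLoop (g := g) (c := d) (B := r.eval (B.eval (rsize a))) (l a).length (s a)
    (fun i hi m x y z => by
      rw [Function.iterate_succ_apply']
      exact (hd _ m x y z).mono (eval_mono r (hB a i hi.le))) m x y z
  refine (h1.seq (Runs.case_zero ((runs_push_three _).seq
    ((runs_countLoop (fun _ => rfl) _ _ _ _ _).seq h2)))).mono ?_
  have h3 := hpl a
  have h4 := length_le_rsize (l a)
  have h5 : (l a).length * (r.eval (B.eval (rsize a)) + 1) ≤
      pl.eval (rsize a) * (r.eval (B.eval (rsize a)) + 1) := Nat.mul_le_mul_right _ (by omega)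
  simp only [Polynomial.eval_add, Polynomial.eval_mul, Polynomial.eval_ofNat, Polynomial.eval_comp,
    Polynomial.eval_one]
  omega

end PolyTime

end MsgPass

/-! ### Closure properties of polynomial-time functions -/

namespace MsgPass

open TreeRep

variable {α β γ δ σ : Type} [TreeRep α] [TreeRep β] [TreeRep γ] [TreeRep δ] [TreeRep σ]

namespace PolyTime

/-! ### Booleans and case distinctions -/

theorem cond {b : α → Bool} {f g : α → β} (hb : PolyTime b) (hf : PolyTime f) (hg : PolyTime g) :
    PolyTime (fun a => bif b a then f a else g a) := by
  refine casesOn (β := Unit) (γ := Unit) (c := fun q => f q.1) hb hg (by fun_prop) fun a => ?_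
  cases h : b a
  · exact Or.inl ⟨rfl, rfl⟩
  · exact Or.inr ⟨(), (), rfl, rfl⟩

theorem ite {p : α → Prop} [DecidablePred p] {f g : α → β} (hp : PolyTime (fun a => decide (p a)))
    (hf : PolyTime f) (hg : PolyTime g) : PolyTime (fun a => if p a then f a else g a) := by
  convert cond hp hf hg using 2 with a
  by_cases h : p a <;> simp [h]

@[fun_prop]
theorem and {f g : α → Bool} (hf : PolyTime f) (hg : PolyTime g) :
    PolyTime (fun a => f a && g a) := by
  convert cond hf hg (PolyTime.const false) using 2 with a
  cases f a <;> rfl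

@[fun_prop]
theorem or {f g : α → Bool} (hf : PolyTime f) (hg : PolyTime g) :
    PolyTime (fun a => f a || g a) := by
  convert cond hf (PolyTime.const true) hg using 2 with a
  cases f a <;> rfl

@[fun_prop]
theorem not {f : α → Bool} (hf : PolyTime f) : PolyTime (fun a => !f a) := by
  convert cond hf (PolyTime.const false) (PolyTime.const true) using 2 with a
  cases f a <;> rfl

theorem decide_and {p q : α → Prop} [DecidablePred p] [DecidablePred q]
    (hp : PolyTime (fun a => decide (p a))) (hq : PolyTime (fun a => decide (q a))) :
    PolyTime (fun a => decide (p a ∧ q a)) := by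
  simpa using hp.and hq

/-! ### Folding -/

@[fun_prop]
theorem cons {f : α → β} {g : α → List β} (hf : PolyTime f) (hg : PolyTime g) :
    PolyTime (fun a => f a :: g a) :=
  comp (of_enc_eq (fun q : β × List β => q.1 :: q.2) fun _ => rfl) (hf.prodMk hg)

@[fun_prop]
theorem tail {f : α → List β} (hf : PolyTime f) : PolyTime (fun a => (f a).tail) := by
  refine casesOn (β := β) (γ := List β) (c := fun q => q.2.2) hf (PolyTime.const []) (by fun_prop)
    fun a => ?_
  cases h : f a with
  | nil => exact Or.inl ⟨rfl, rfl⟩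
  | cons b t => exact Or.inr ⟨b, t, rfl, rfl⟩

@[fun_prop]
theorem headD {f : α → List β} {d : α → β} (hf : PolyTime f) (hd : PolyTime d) :
    PolyTime (fun a => (f a).headD (d a)) := by
  refine casesOn (β := β) (γ := List β) (c := fun q => q.2.1) hf hd (by fun_prop) fun a => ?_
  cases h : f a with
  | nil => exact Or.inl ⟨rfl, rfl⟩
  | cons b t => exact Or.inr ⟨b, t, rfl, rfl⟩

/-- One step of a fold: the state consists of the parameter, the rest of the list, and the
accumulator. -/
def foldStep {α β σ : Type} (f : α → σ → β → σ) : α × List β × σ → α × List β × σ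
  | (a, [], s) => (a, [], s)
  | (a, b :: t, s) => (a, t, f a s b)

theorem iterate_foldStep {α β σ : Type} (f : α → σ → β → σ) (a : α) (l : List β) (s : σ) (i : ℕ) :
    (foldStep f)^[i] (a, l, s) = (a, l.drop i, (l.take i).foldl (f a) s) := by
  induction i generalizing l s with
  | zero => simp
  | succ i ih =>
    rw [Function.iterate_succ_apply]
    cases l with
    | nil => simp [foldStep, ih]
    | cons b t => simp [foldStep, ih]

theorem rsize_drop_le (l : List β) (i : ℕ) : rsize (l.drop i) ≤ rsize l := by
  induction l generalizing i with
  | nil => simp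
  | cons b l ih =>
    cases i with
    | zero => simp
    | succ i =>
      have := ih i
      simp only [List.drop_succ_cons, rsize_cons]
      omega

/-- Folds with polynomially bounded accumulators. -/
theorem foldl {l : α → List β} {s : α → σ} {f : α → σ → β → σ} (hl : PolyTime l) (hs : PolyTime s)
    (hf : PolyTime (fun q : α × σ × β => f q.1 q.2.1 q.2.2))
    (hb : ∃ p : Polynomial ℕ, ∀ a, ∀ i ≤ (l a).length,
      rsize (((l a).take i).foldl (f a) (s a)) ≤ p.eval (rsize a)) :
    PolyTime (fun a => (l a).foldl (f a) (s a)) := by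
  have hstep : PolyTime (foldStep f) := by
    refine casesOn (l := fun q : α × List β × σ => q.2.1) (β := β) (γ := List β)
      (c := fun q => (q.1.1, q.2.2, f q.1.1 q.1.2.2 q.2.1)) (by fun_prop) PolyTime.id
      (prodMk (by fun_prop) (prodMk (by fun_prop)
        (comp hf (f := fun q : (α × List β × σ) × β × List β => (q.1.1, q.1.2.2, q.2.1))
          (by fun_prop)))) ?_
    rintro ⟨a, _ | ⟨b, t⟩, s⟩
    · exact Or.inl ⟨rfl, rfl⟩
    · exact Or.inr ⟨b, t, rfl, rfl⟩
  obtain ⟨p, hp⟩ := hb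
  obtain ⟨pl, hpl⟩ := hl.exists_rsize_le
  have h : PolyTime (fun a => (foldStep f)^[(l a).length] (a, l a, s a)) := by
    refine iterate hl (by fun_prop) hstep ⟨.X + pl + p + 2, fun a i hi => ?_⟩
    rw [iterate_foldStep]
    have h1 := hp a i hi
    have h2 := hpl a
    have h3 := rsize_drop_le (l a) i
    simp only [rsize_pair, Polynomial.eval_add, Polynomial.eval_X, Polynomial.eval_ofNat]
    omega
  have hsnd : PolyTime (fun a => ((foldStep f)^[(l a).length] (a, l a, s a)).2.2) := by fun_prop
  simpa [iterate_foldStep] using hsnd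

/-- Folds whose accumulators grow by a polynomially bounded amount in each step. -/
theorem foldl_of_add_le {l : α → List β} {s : α → σ} {f : α → σ → β → σ} (hl : PolyTime l)
    (hs : PolyTime s) (hf : PolyTime (fun q : α × σ × β => f q.1 q.2.1 q.2.2))
    (hb : ∃ p : Polynomial ℕ, ∀ a, ∀ b ∈ l a, ∀ t,
      rsize (f a t b) ≤ rsize t + p.eval (rsize a)) :
    PolyTime (fun a => (l a).foldl (f a) (s a)) := by
  obtain ⟨p, hp⟩ := hb
  obtain ⟨pl, hpl⟩ := hl.exists_rsize_le
  obtain ⟨ps, hps⟩ := hs.exists_rsize_le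
  refine foldl hl hs hf ⟨ps + pl * p, fun a i _ => ?_⟩
  have key : ∀ (l' : List β) (t : σ), (∀ b ∈ l', b ∈ l a) →
      rsize (l'.foldl (f a) t) ≤ rsize t + l'.length * p.eval (rsize a) := by
    intro l'
    induction l' with
    | nil => simp
    | cons b l' ih =>
      intro t h
      have h1 := ih (f a t b) fun c hc => h c (by simp [hc])
      have h2 := hp a b (h b (by simp)) t
      simp only [List.foldl_cons, List.length_cons, Nat.succ_mul]
      omega
  have h1 := key ((l a).take i) (s a) fun b hb => List.mem_of_mem_take hb
  have h2 := hps a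
  have h3 := hpl a
  have h4 := length_le_rsize (l a)
  have h5 : ((l a).take i).length * p.eval (rsize a) ≤ pl.eval (rsize a) * p.eval (rsize a) :=
    Nat.mul_le_mul_right _ (by simp; omega)
  simp only [Polynomial.eval_add, Polynomial.eval_mul]
  omega

/-! ### Lists -/

@[fun_prop]
theorem reverse {f : α → List β} (hf : PolyTime f) : PolyTime (fun a => (f a).reverse) := by
  have : PolyTime (fun a => (f a).foldl (fun t b => b :: t) []) := by
    obtain ⟨p, hp⟩ := hf.exists_rsize_le
    refine foldl_of_add_le hf (PolyTime.const []) (by fun_prop) ⟨p + 1, fun a b hb t => ?_⟩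
    have h1 := rsize_le_of_mem hb
    have h2 := hp a
    simp only [rsize_cons, Polynomial.eval_add, Polynomial.eval_one]
    omega
  simpa using this

@[fun_prop]
theorem append {f g : α → List β} (hf : PolyTime f) (hg : PolyTime g) :
    PolyTime (fun a => f a ++ g a) := by
  have : PolyTime (fun a => (f a).reverse.foldl (fun t b => b :: t) (g a)) := by
    obtain ⟨p, hp⟩ := hf.exists_rsize_le
    refine foldl_of_add_le hf.reverse hg (by fun_prop) ⟨p + 1, fun a b hb t => ?_⟩
    have h1 := rsize_le_of_mem (List.mem_reverse.1 hb)
    have h2 := hp a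
    simp only [rsize_cons, Polynomial.eval_add, Polynomial.eval_one]
    omega
  simpa using this

/-- The bound for the size of `f a b` when `b` belongs to a list computed from `a`. -/
theorem exists_rsize_le_of_mem {l : α → List β} {f : α → β → γ} (hl : PolyTime l)
    (hf : PolyTime (fun q : α × β => f q.1 q.2)) :
    ∃ p : Polynomial ℕ, ∀ a, ∀ b ∈ l a, rsize (f a b) ≤ p.eval (rsize a) := by
  obtain ⟨pl, hpl⟩ := hl.exists_rsize_le
  obtain ⟨p, hp⟩ := hf.exists_rsize_le
  refine ⟨p.comp (.X + pl + 1), fun a b hb => (hp (a, b)).trans ?_⟩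
  rw [Polynomial.eval_comp]
  apply eval_mono
  have h1 := rsize_le_of_mem hb
  have h2 := hpl a
  simp only [rsize_pair, Polynomial.eval_add, Polynomial.eval_X, Polynomial.eval_one]
  omega

@[fun_prop]
theorem map {l : α → List β} {f : α → β → γ} (hl : PolyTime l)
    (hf : PolyTime (fun q : α × β => f q.1 q.2)) : PolyTime (fun a => (l a).map (f a)) := by
  have : PolyTime (fun a => ((l a).foldl (fun t b => f a b :: t) []).reverse) := by
    obtain ⟨p, hp⟩ := exists_rsize_le_of_mem hl hf
    refine reverse (foldl_of_add_le hl (PolyTime.const []) (cons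
      (comp hf (f := fun q : α × List γ × β => (q.1, q.2.2)) (by fun_prop)) (by fun_prop))
      ⟨p + 1, fun a b hb t => ?_⟩)
    have h1 := hp a b hb
    simp only [rsize_cons, Polynomial.eval_add, Polynomial.eval_one]
    omega
  convert this using 2 with a
  simp

@[fun_prop]
theorem filter {l : α → List β} {f : α → β → Bool} (hl : PolyTime l)
    (hf : PolyTime (fun q : α × β => f q.1 q.2)) : PolyTime (fun a => (l a).filter (f a)) := by
  have : PolyTime (fun a => ((l a).foldl (fun t b => bif f a b then b :: t else t) []).reverse) := by
    obtain ⟨p, hp⟩ := hl.exists_rsize_le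
    refine reverse (foldl_of_add_le hl (PolyTime.const []) (cond
      (comp hf (f := fun q : α × List β × β => (q.1, q.2.2)) (by fun_prop)) (by fun_prop)
      (by fun_prop)) ⟨p + 1, fun a b hb t => ?_⟩)
    have h1 := rsize_le_of_mem hb
    have h2 := hp a
    simp only [Polynomial.eval_add, Polynomial.eval_one]
    cases f a b
    · simp
    · simp only [cond_true, rsize_cons]; omega
  convert this using 2 with a
  have key : ∀ (l' : List β) (t : List β),
      (l'.foldl (fun t b => bif f a b then b :: t else t) t).reverse =
        t.reverse ++ l'.filter (f a) := by
    intro l'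
    induction l' with
    | nil => simp
    | cons b l' ih =>
      intro t
      cases h : f a b <;> simp [ih, h]
  simp [key]

theorem rsize_append (l l' : List β) : rsize (l ++ l') + 1 = rsize l + rsize l' := by
  induction l with
  | nil => simp; omega
  | cons b l ih => simp only [List.cons_append, rsize_cons]; omega

@[fun_prop]
theorem flatten {l : α → List (List β)} (hl : PolyTime l) : PolyTime (fun a => (l a).flatten) := by
  have : PolyTime (fun a => (l a).foldl (fun t b => t ++ b) []) := by
    obtain ⟨p, hp⟩ := hl.exists_rsize_le
    refine foldl_of_add_le hl (PolyTime.const []) (by fun_prop) ⟨p, fun a b hb t => ?_⟩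
    have h1 := rsize_le_of_mem hb
    have h2 := hp a
    have h3 := rsize_append t b
    omega
  convert this using 2 with a
  have key : ∀ (l' : List (List β)) (t : List β),
      l'.foldl (fun t b => t ++ b) t = t ++ l'.flatten := by
    intro l'
    induction l' with
    | nil => simp
    | cons b l' ih => intro t; rw [List.foldl_cons, ih]; simp
  simp [key]

@[fun_prop]
theorem flatMap {l : α → List β} {f : α → β → List γ} (hl : PolyTime l)
    (hf : PolyTime (fun q : α × β => f q.1 q.2)) : PolyTime (fun a => (l a).flatMap (f a)) := by
  simp only [List.flatMap_def]
  exact flatten (map hl hf)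

@[fun_prop]
theorem all {l : α → List β} {f : α → β → Bool} (hl : PolyTime l)
    (hf : PolyTime (fun q : α × β => f q.1 q.2)) : PolyTime (fun a => (l a).all (f a)) := by
  have : PolyTime (fun a => (l a).foldl (fun t b => t && f a b) true) := by
    refine foldl_of_add_le hl (PolyTime.const true) (and (by fun_prop)
      (comp hf (f := fun q : α × Bool × β => (q.1, q.2.2)) (by fun_prop)))
      ⟨3, fun a b _ t => ?_⟩
    have := rsize_bool_le (t && f a b)
    simp only [Polynomial.eval_ofNat]
    omega
  convert this using 2 with a
  have key : ∀ (l' : List β) (t : Bool),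
      l'.foldl (fun t b => t && f a b) t = (t && l'.all (f a)) := by
    intro l'
    induction l' with
    | nil => simp
    | cons b l' ih => simp [ih, Bool.and_assoc]
  simp [key]

@[fun_prop]
theorem any {l : α → List β} {f : α → β → Bool} (hl : PolyTime l)
    (hf : PolyTime (fun q : α × β => f q.1 q.2)) : PolyTime (fun a => (l a).any (f a)) := by
  have := (hl.all (f := fun a b => !f a b) hf.not).not
  convert this using 2 with a
  simp [List.not_all_eq_any_not]

/-! ### Numbers -/

@[fun_prop]
theorem succ {f : α → ℕ} (hf : PolyTime f) : PolyTime (fun a => f a + 1) :=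
  comp (g := fun q : Unit × ℕ => q.2 + 1) (of_enc_eq _ fun _ => rfl)
    ((PolyTime.const ()).prodMk hf)

@[fun_prop]
theorem length {f : α → List β} (hf : PolyTime f) : PolyTime (fun a => (f a).length) := by
  have : PolyTime (fun a => (f a).foldl (fun t _ => t + 1) 0) :=
    foldl_of_add_le hf (PolyTime.const 0) (by fun_prop) ⟨2, fun a b hb t => by simp; omega⟩
  simpa using this

/-- Unary numbers and lists of units are the same trees, so folding over a list also gives bounded
recursion on numbers. -/
theorem enc_replicate_unit (n : ℕ) : enc (List.replicate n ()) = enc n := by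
  induction n with
  | zero => rfl
  | succ n ih => rw [List.replicate_succ, enc_cons, ih]; rfl

theorem replicate_unit {f : α → ℕ} (hf : PolyTime f) :
    PolyTime (fun a => List.replicate (f a) ()) :=
  comp (of_enc_eq _ enc_replicate_unit) hf

@[fun_prop]
theorem range {f : α → ℕ} (hf : PolyTime f) : PolyTime (fun a => List.range (f a)) := by
  have key : ∀ n : ℕ, (List.replicate n ()).foldl (fun t _ => t ++ [t.length]) [] =
      List.range n := by
    intro n
    induction n with
    | zero => rfl
    | succ n ih => rw [List.replicate_succ', List.foldl_append, ih, List.range_succ]; simp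
  have : PolyTime (fun a => (List.replicate (f a) ()).foldl (fun t _ => t ++ [t.length]) []) := by
    obtain ⟨p, hp⟩ := hf.exists_rsize_le
    -- The number appended is the length of the accumulator, so the increments are not bounded by
    -- the input for arbitrary accumulators. The actual intermediate results `List.range i` are
    -- bounded instead.
    refine foldl (replicate_unit hf) (PolyTime.const []) (by fun_prop)
      ⟨p * (2 * p + 2) + 1, fun a i hi => ?_⟩
    rw [List.length_replicate] at hi
    rw [List.take_replicate, Nat.min_eq_left hi, key]
    have h1 : rsize (List.range i) ≤ i * (2 * i + 1 + 1) + 1 := by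
      have := rsize_list_le (l := List.range i) (B := 2 * i + 1) fun a ha => by
        have := List.mem_range.1 ha
        simp; omega
      simpa using this
    have h2 := hp a
    rw [rsize_nat] at h2
    have h3 : i * (2 * i + 1 + 1) ≤ p.eval (rsize a) * (2 * p.eval (rsize a) + 2) :=
      Nat.mul_le_mul (by omega) (by omega)
    simp only [Polynomial.eval_add, Polynomial.eval_mul, Polynomial.eval_ofNat, Polynomial.eval_one]
    omega
  simpa only [key] using this

@[fun_prop]
theorem add {f g : α → ℕ} (hf : PolyTime f) (hg : PolyTime g) : PolyTime (fun a => f a + g a) := by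
  have : PolyTime (fun a => (List.range (f a) ++ List.range (g a)).length) := by fun_prop
  simpa using this

@[fun_prop]
theorem mul {f g : α → ℕ} (hf : PolyTime f) (hg : PolyTime g) : PolyTime (fun a => f a * g a) := by
  have : PolyTime (fun a => ((List.range (f a)).flatMap fun _ => List.range (g a)).length) := by
    fun_prop
  simpa using this

@[fun_prop]
theorem drop {f : α → ℕ} {l : α → List β} (hf : PolyTime f) (hl : PolyTime l) :
    PolyTime (fun a => (l a).drop (f a)) := by
  have key : ∀ (n : ℕ) (t : List β),
      (List.replicate n ()).foldl (fun t _ => t.tail) t = t.drop n := by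
    intro n
    induction n with
    | zero => simp
    | succ n ih => intro t; simp [List.replicate_succ, ih]
  have : PolyTime (fun a => (List.replicate (f a) ()).foldl (fun t _ => t.tail) (l a)) := by
    refine foldl_of_add_le (replicate_unit hf) hl (by fun_prop) ⟨0, fun a b hb t => ?_⟩
    simpa using rsize_drop_le t 1
  simpa only [key] using this

@[fun_prop]
theorem sub {f g : α → ℕ} (hf : PolyTime f) (hg : PolyTime g) : PolyTime (fun a => f a - g a) := by
  have : PolyTime (fun a => ((List.range (f a)).drop (g a)).length) := by fun_prop
  simpa using this

@[fun_prop]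
theorem decide_eq_zero {f : α → ℕ} (hf : PolyTime f) : PolyTime (fun a => decide (f a = 0)) := by
  refine casesOn (β := Unit) (γ := ℕ) (c := fun _ => false) hf (PolyTime.const true)
    (by fun_prop) fun a => ?_
  cases h : f a with
  | zero => exact Or.inl ⟨rfl, rfl⟩
  | succ n => exact Or.inr ⟨(), n, rfl, rfl⟩

@[fun_prop]
theorem decide_le {f g : α → ℕ} (hf : PolyTime f) (hg : PolyTime g) :
    PolyTime (fun a => decide (f a ≤ g a)) := by
  have : PolyTime (fun a => decide (f a - g a = 0)) := by fun_prop
  simpa only [Nat.sub_eq_zero_iff_le] using this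

@[fun_prop]
theorem decide_lt {f g : α → ℕ} (hf : PolyTime f) (hg : PolyTime g) :
    PolyTime (fun a => decide (f a < g a)) :=
  decide_le (f := fun a => f a + 1) (by fun_prop) hg

@[fun_prop]
theorem decide_eq {f g : α → ℕ} (hf : PolyTime f) (hg : PolyTime g) :
    PolyTime (fun a => decide (f a = g a)) := by
  simpa only [← Nat.le_antisymm_iff] using decide_and (decide_le hf hg) (decide_le hg hf)

@[fun_prop]
theorem getD {l : α → List β} {i : α → ℕ} {d : α → β} (hl : PolyTime l) (hi : PolyTime i)
    (hd : PolyTime d) : PolyTime (fun a => (l a).getD (i a) (d a)) := by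
  have : PolyTime (fun a => ((l a).drop (i a)).headD (d a)) := by fun_prop
  convert this using 2 with a
  simp [List.getD_eq_getElem?_getD, List.headD_eq_head?_getD]

theorem decide_eq_bits {f g : α → List Bool} (hf : PolyTime f) (hg : PolyTime g) :
    PolyTime (fun a => decide (f a = g a)) := by
  have : PolyTime (fun a => decide ((f a).length = (g a).length) &&
      (List.range (f a).length).all fun i =>
        bif (f a).getD i false then (g a).getD i false else !(g a).getD i false) :=
    and (by fun_prop) (all (by fun_prop) (cond (by fun_prop) (by fun_prop) (by fun_prop)))
  convert this using 2 with a
  rw [Bool.eq_iff_iff]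
  simp only [decide_eq_true_eq, Bool.and_eq_true, List.all_eq_true, List.mem_range]
  constructor
  · intro h
    simp only [h, true_and]
    intro i _
    cases (g a).getD i false <;> rfl
  · rintro ⟨h1, h2⟩
    refine List.ext_getElem h1 fun i hi hi' => ?_
    have := h2 i hi
    rw [List.getD_eq_getElem _ _ hi, List.getD_eq_getElem _ _ hi'] at this
    cases h : (f a)[i] <;> simp_all

end PolyTime

end MsgPass

namespace MsgPass

open TreeRep

/-! ### Reading and writing strings -/

namespace Tree

/-- A tree as a balanced string of parentheses. -/
def flat : Tree → List Sym
  | nil => []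
  | cons a b => paren a.flat ++ b.flat

/-- Consequently `paren a.flat` is `lpar` followed by the Polish form of `a`: once the bits are
expanded, deleting a single symbol finishes the parsing. -/
theorem code_eq_flat (a : Tree) : a.code = a.flat ++ [Sym.rpar] := by
  induction a with
  | nil => rfl
  | cons a b iha ihb => simp [code, flat, paren, iha, ihb]

end Tree

/-- The string of parentheses that represents a symbol. -/
def Sym.flat : Sym → List Sym
  | .zero => [.lpar, .rpar]
  | .one => [.lpar, .lpar, .rpar, .rpar]
  | .lpar => [.lpar]
  | .rpar => [.rpar]

theorem length_flatMap_flat_le (s : List Sym) : (s.flatMap Sym.flat).length ≤ 4 * s.length := by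
  induction s with
  | nil => simp
  | cons b s ih =>
    have : b.flat.length ≤ 4 := by cases b <;> simp [Sym.flat]
    simp only [List.flatMap_cons, List.length_append, List.length_cons]
    omega

/-- The string `s` represents `a`, provided that bits are replaced by groups of parentheses. -/
def Represents {α : Type} [TreeRep α] (s : List Sym) (a : α) : Prop :=
  s.flatMap Sym.flat = paren (enc a).flat

section

variable {α β : Type} [TreeRep α] [TreeRep β]

theorem represents_paren {s : List Sym} {a : α} (h : s.flatMap Sym.flat = (enc a).flat) :
    Represents (paren s) a := by
  simp [Represents, paren, Sym.flat, h]

/-- As an element of a list, `false` contributes `()` and `true` contributes `(())`, exactly the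
expansions of the two bit symbols. -/
theorem represents_encodeBits (b : List Bool) : Represents (encodeBits b) b := by
  refine represents_paren ?_
  induction b with
  | nil => rfl
  | cons x b ih =>
    rw [List.map_cons, List.flatMap_cons, ih, enc_cons, Tree.flat]
    cases x <;> rfl

theorem represents_encodeNat (n : ℕ) : Represents (encodeNat n) (List.replicate n true) := by
  have : encodeNat n = encodeBits (List.replicate n true) := by simp [encodeNat, encodeBits]
  rw [this]
  exact represents_encodeBits _

theorem represents_encodeList {ι : Type} {f : ι → List Sym} {g : ι → β} {l : List ι}
    (h : ∀ a ∈ l, Represents (f a) (g a)) : Represents (encodeList (l.map f)) (l.map g) := by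
  refine represents_paren ?_
  induction l with
  | nil => rfl
  | cons a l ih =>
    have h1 : Represents (f a) (g a) := h a (by simp)
    have h2 := ih fun b hb => h b (by simp [hb])
    simp only [List.map_cons, List.flatten_cons, List.flatMap_append, enc_cons, Tree.flat, h2]
    rw [h1]

theorem represents_encodeList_pair {s t : List Sym} {a : α} {b : List β} (hs : Represents s a)
    (ht : Represents t b) : Represents (encodeList [s, t]) (a, b, ()) := by
  refine represents_paren ?_
  simp only [Represents] at hs ht
  simp [hs, ht, enc, Tree.flat]

theorem represents_encodeList_triple {γ : Type} [TreeRep γ] {s t u : List Sym} {a : α} {b : β}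
    {c : γ} (hs : Represents s a) (ht : Represents t b) (hu : Represents u c) :
    Represents (encodeList [s, t, u]) (a, b, c, ()) := by
  refine represents_paren ?_
  simp only [Represents] at hs ht hu
  simp [hs, ht, hu, enc, Tree.flat]

end

namespace Cmd

/-- Replace every symbol on stack `0` by its group of parentheses, and delete the first one. -/
def readCmd : Cmd (Fin 4) :=
  seq (loop 0 (fun _ => false) fun
    | .zero => seq (push 1 .lpar) (push 1 .rpar)
    | .one => seq (push 1 .lpar) (seq (push 1 .lpar) (seq (push 1 .rpar) (push 1 .rpar)))
    | .lpar => push 1 .lpar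
    | .rpar => push 1 .rpar) <|
  seq (loop 1 (fun _ => false) fun a => push 0 a) (case 0 fun _ => skip)

theorem runs_readCmd {α : Type} [TreeRep α] {s : List Sym} {a : α} (h : Represents s a) :
    Runs readCmd ![s, [], [], []] ![(enc a).code, [], [], []] (20 * s.length + 20) := by
  have loop1 : ∀ (f : Sym → Cmd (Fin 4)) (_ : ∀ b m x, Runs (f b) ![m, x, [], []]
      ![m, b.flat.reverse ++ x, [], []] 7) (s x : List Sym),
      Runs (loop 0 (fun _ => false) f) ![s, x, [], []]
        ![[], (s.flatMap Sym.flat).reverse ++ x, [], []] (8 * s.length + 1) := by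
    intro f hf s
    induction s with
    | nil => intro x; exact runs_loop_nil rfl
    | cons b s ih =>
      intro x
      have := Runs.loop_zero (leave := fun _ => false) rfl (hf b s x) (ih (b.flat.reverse ++ x))
      simpa using this.mono (T' := 8 * (b :: s).length + 1) (by simp; omega)
  have loop2 : ∀ (x m : List Sym), Runs (loop 1 (fun _ => false) fun a => push 0 a)
      ![m, x, [], []] ![x.reverse ++ m, [], [], []] (2 * x.length + 1) := by
    intro x
    induction x with
    | nil => intro m; exact runs_loop_nil rfl
    | cons b x ih =>
      intro m
      have := Runs.loop_one (leave := fun _ => false) rfl (runs_push_zero b) (ih (b :: m))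
      simpa using this.mono (T' := 2 * (b :: x).length + 1) (by simp; omega)
  have h2 := loop2 (s.flatMap Sym.flat).reverse []
  rw [List.reverse_reverse, List.append_nil, h] at h2
  have h3 : Runs (case 0 fun _ => skip) ![paren (enc a).flat, [], [], []]
      ![(enc a).code, [], [], []] 2 := by
    rw [Tree.code_eq_flat]
    exact Runs.case_zero (runs_skip _)
  have h4 := loop1 (fun
    | .zero => seq (push 1 .lpar) (push 1 .rpar)
    | .one => seq (push 1 .lpar) (seq (push 1 .lpar) (seq (push 1 .rpar) (push 1 .rpar)))
    | .lpar => push 1 .lpar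
    | .rpar => push 1 .rpar) (fun b m x => by
      cases b
      · exact ((runs_push_one _).seq (runs_push_one _)).mono (by omega)
      · exact ((runs_push_one _).seq ((runs_push_one _).seq ((runs_push_one _).seq
          (runs_push_one _)))).mono (by omega)
      · exact (runs_push_one _).mono (by omega)
      · exact (runs_push_one _).mono (by omega)) s []
  rw [h, List.append_nil] at h4
  rw [← h] at h2 h3 h4
  refine (h4.seq (h2.seq h3)).mono ?_
  have := length_flatMap_flat_le s
  simp only [List.length_reverse]
  omega

end Cmd

/-- Symbols are represented like the numbers `0, 1, 2, 3`. -/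
def Sym.toNat : Sym → ℕ
  | .zero => 0
  | .one => 1
  | .lpar => 2
  | .rpar => 3

instance : TreeRep Sym := ⟨fun a => enc a.toNat⟩

namespace Cmd

/-- Move the list of symbols represented on stack `0` to stack `1`. -/
def writeCmd : Cmd (Fin 4) :=
  loop 0 (fun a => decide (a ≠ Sym.lpar)) fun _ => case 0 fun
    | some .lpar => case 0 fun _ => case 0 fun
      | some .lpar => case 0 fun _ => case 0 fun
        | some .lpar => case 0 fun _ => case 0 fun _ => push 1 .rpar
        | _ => push 1 .lpar
      | _ => push 1 .one
    | _ => push 1 .zero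

/-- The nested cases count up to three in unary to identify a symbol. The output is reversed, as
`preprocess` requires. -/
theorem runs_writeCmd (w x : List Sym) :
    Runs writeCmd ![(enc w).code, x, [], []] ![[], w.reverse ++ x, [], []] (9 * w.length + 1) := by
  induction w generalizing x with
  | nil => exact (runs_loop_leave_zero (a := Sym.rpar) rfl).mono (by simp)
  | cons b w ih =>
    have h : (enc (b :: w)).code = Sym.lpar :: ((enc b).code ++ (enc w).code) := rfl
    rw [h]
    have := Runs.loop_zero (leave := fun a => decide (a ≠ Sym.lpar)) (a := Sym.lpar)
      (m := (enc b).code ++ (enc w).code) (x := x) (y := []) (z := [])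
      (s' := ![(enc w).code, b :: x, [], []]) (T := 8) rfl (by
        cases b
        · exact (Runs.case_zero (a := .rpar) (runs_push_one _)).mono (by omega)
        · exact (Runs.case_zero (a := .lpar) (Runs.case_zero (a := .rpar) (Runs.case_zero
            (a := .rpar) (runs_push_one _)))).mono (by omega)
        · exact (Runs.case_zero (a := .lpar) (Runs.case_zero (a := .rpar) (Runs.case_zero
            (a := .lpar) (Runs.case_zero (a := .rpar) (Runs.case_zero (a := .rpar)
            (runs_push_one _)))))).mono (by omega)
        · exact (Runs.case_zero (a := .lpar) (Runs.case_zero (a := .rpar) (Runs.case_zero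
            (a := .lpar) (Runs.case_zero (a := .rpar) (Runs.case_zero (a := .lpar)
            (Runs.case_zero (a := .rpar) (Runs.case_zero (a := .rpar)
            (runs_push_one _)))))))).mono (by omega)) (ih (b :: x))
    rw [List.reverse_cons, List.append_assoc]
    exact this.mono (by simp; omega)

end Cmd

theorem PolyTime.encodeBits {α : Type} [TreeRep α] {f : α → List Bool} (hf : PolyTime f) :
    PolyTime (fun a => encodeBits (f a)) := by
  unfold MsgPass.encodeBits paren
  exact cons (by fun_prop) (append (map hf (cond (by fun_prop) (by fun_prop) (by fun_prop)))
    (by fun_prop))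

theorem PolyTime.encodeList {α : Type} [TreeRep α] {f : α → List (List Sym)} (hf : PolyTime f) :
    PolyTime (fun a => encodeList (f a)) := by
  unfold MsgPass.encodeList paren
  fun_prop

theorem PolyTime.encodeNat {α : Type} [TreeRep α] {f : α → ℕ} (hf : PolyTime f) :
    PolyTime (fun a => encodeNat (f a)) := by
  have : PolyTime (fun a => MsgPass.encodeBits ((List.range (f a)).map fun _ => true)) :=
    encodeBits (by fun_prop)
  convert this using 2 with a
  simp [MsgPass.encodeNat, MsgPass.encodeBits, List.map_const']

/-- The representing string determines the size. -/
theorem Represents.rsize_le {α : Type} [TreeRep α] {s : List Sym} {a : α} (h : Represents s a) :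
    rsize a ≤ 4 * s.length := by
  have h2 := length_flatMap_flat_le s
  rw [h] at h2
  have h3 := (enc a).length_code
  rw [Tree.code_eq_flat] at h3
  simp only [paren, List.length_cons, List.length_append, List.length_nil] at h2 h3
  simp only [rsize]
  omega

/-- A polynomial-time function on representations yields a program on strings. -/
theorem PolyTime.exists_runs {α : Type} [TreeRep α] {f : α → List Sym} (hf : PolyTime f) :
    ∃ (c : Cmd (Fin 4)) (p : Polynomial ℕ), ∀ (s : List Sym) (a : α), Represents s a →
      c.Runs ![s, [], [], []] ![[], (f a).reverse, [], []] (p.eval s.length) ∧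
        (f a).length ≤ p.eval s.length := by
  obtain ⟨q, hq⟩ := hf.exists_rsize_le
  obtain ⟨c, p, h⟩ := hf
  refine ⟨.seq Cmd.readCmd (.seq c Cmd.writeCmd),
    20 * .X + p.comp (4 * .X) + 9 * q.comp (4 * .X) + 30, fun s a hs => ?_⟩
  have h1 := h a [] [] [] []
  simp only [List.append_nil] at h1
  have h2 := Cmd.runs_writeCmd (f a) []
  rw [List.append_nil] at h2
  have h3 := length_le_rsize (f a)
  have h4 := (hq a).trans (eval_mono q hs.rsize_le)
  have h5 := eval_mono p hs.rsize_le
  simp only [Polynomial.eval_add, Polynomial.eval_mul, Polynomial.eval_ofNat, Polynomial.eval_comp,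
    Polynomial.eval_X]
  refine ⟨((Cmd.runs_readCmd hs).seq (h1.seq h2)).mono ?_, ?_⟩ <;> omega

end MsgPass

/-! ### Colour refinement and the shape of the dag -/

namespace MsgPass

/-! ### Stability of the message-passing colours -/

/-- A quantity that is at least `1`, at most `n`, and increases as long as a persistent property
does not hold, forces this property to hold from `n - 1` on. -/
theorem persistent_of_bounded {n : ℕ} {P : ℕ → Prop} {g : ℕ → ℕ} (h0 : 1 ≤ g 0) (hn : ∀ t, g t ≤ n)
    (hg : ∀ t, ¬P t → g t < g (t + 1)) (hP : ∀ t, P t → P (t + 1)) {t : ℕ} (ht : n - 1 ≤ t) :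
    P t := by
  by_contra h
  have hnot : ∀ s, ∀ r, r + s = t → ¬P r := by
    intro s
    induction s with
    | zero => rintro r rfl; exact h
    | succ s ih => intro r hr hPr; exact ih (r + 1) (by omega) (hP r hPr)
  have hgrow : ∀ r ≤ t + 1, r + 1 ≤ g r := by
    intro r
    induction r with
    | zero => intro _; exact h0
    | succ r ih =>
      intro hr
      have h1 := ih (by omega)
      have h2 := hg r (hnot (t - r) r (by omega))
      omega
  have h1 := hgrow (t + 1) le_rfl
  have h2 := hn (t + 1)
  omega

variable {G : FeaturedGraph}

open Classical in
theorem mpc_succ (t : ℕ) (v : Fin G.order) : mpc G (t + 1) v =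
    (mpc G t v, (Finset.univ.filter (G.graph.Adj v)).val.map (mpc G t)) := rfl

theorem mpc_prev (t : ℕ) (v : Fin G.order) : (mpc G (t + 1) v).prev = mpc G t v := rfl

open Classical in
theorem mpc_nbrs (t : ℕ) (v : Fin G.order) : (mpc G (t + 1) v).nbrs =
    (Finset.univ.filter (G.graph.Adj v)).val.map (mpc G t) := rfl

theorem mem_mpc_nbrs {t : ℕ} {v : Fin G.order} {e : Color t} :
    e ∈ (mpc G (t + 1) v).nbrs ↔ ∃ w, G.graph.Adj v w ∧ mpc G t w = e := by
  simp [mpc_nbrs]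

open Classical in
theorem count_mpc_nbrs (t : ℕ) (v w : Fin G.order) :
    (mpc G (t + 1) v).nbrs.count (mpc G t w) =
      (Finset.univ.filter fun y => G.graph.Adj v y ∧ mpc G t y = mpc G t w).card := by
  rw [mpc_nbrs, Multiset.count_map, ← Finset.filter_filter]
  simp only [Finset.filter_val, Finset.card_def]
  simp only [eq_comm]

theorem mpc_succ_eq_iff {t : ℕ} {u w : Fin G.order} : mpc G (t + 1) u = mpc G (t + 1) w ↔
    mpc G t u = mpc G t w ∧ (mpc G (t + 1) u).nbrs = (mpc G (t + 1) w).nbrs :=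
  Prod.ext_iff

theorem mpc_eq_of_le {s t : ℕ} (h : s ≤ t) {u w : Fin G.order} (e : mpc G t u = mpc G t w) :
    mpc G s u = mpc G s w := by
  induction t, h using Nat.le_induction with
  | base => exact e
  | succ t _ ih => exact ih (mpc_succ_eq_iff.1 e).1

/-- If a round splits no class, the new colour is a function of the old one. The next neighbour
multisets are then images of the present ones under this function. -/
theorem stable_succ {t : ℕ} (h : ∀ u w, mpc G t u = mpc G t w → mpc G (t + 1) u = mpc G (t + 1) w)
    (u w : Fin G.order) (e : mpc G (t + 1) u = mpc G (t + 1) w) :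
    mpc G (t + 2) u = mpc G (t + 2) w := by
  classical
  have hf : Function.FactorsThrough (mpc G (t + 1)) (mpc G t) := fun u w => h u w
  have key : ∀ u, (mpc G (t + 2) u).nbrs = (mpc G (t + 1) u).nbrs.map
      (Function.extend (mpc G t) (mpc G (t + 1)) fun _ => mpc G (t + 1) w) := by
    intro u
    rw [mpc_nbrs, mpc_nbrs, Multiset.map_map]
    congr 1
    funext y
    exact (hf.extend_apply _ _).symm
  exact mpc_succ_eq_iff.2 ⟨e, by rw [key, key, e]⟩

/-- After `n - 1` rounds the partition of the vertices is stable. -/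
theorem stable_of_le {t : ℕ} (ht : G.order - 1 ≤ t) (u w : Fin G.order)
    (e : mpc G t u = mpc G t w) : mpc G (t + 1) u = mpc G (t + 1) w := by
  classical
  refine persistent_of_bounded (n := G.order)
    (P := fun t => ∀ u w, mpc G t u = mpc G t w → mpc G (t + 1) u = mpc G (t + 1) w)
    (g := fun t => (Finset.univ.image (mpc G t)).card) ?_ ?_ ?_ (fun t h => stable_succ h) ht u w e
  · exact Finset.card_pos.2 ⟨_, Finset.mem_image_of_mem _ (Finset.mem_univ u)⟩
  · intro t
    exact Finset.card_image_le.trans (by simp)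
  · intro t h
    by_contra hlt
    refine h fun u w e => ?_
    -- `Color.prev` maps the new colours onto the old ones. If their number has not grown, this map
    -- is injective on them, so nothing was split.
    have himg : (Finset.univ.image (mpc G (t + 1))).image Color.prev =
        Finset.univ.image (mpc G t) := by
      rw [Finset.image_image]; rfl
    have hinj := Finset.card_image_iff.1
      (le_antisymm (Finset.card_image_le (s := Finset.univ.image (mpc G (t + 1))) (f := Color.prev))
        (by rw [himg]; exact not_lt.1 hlt))
    exact hinj (by simp) (by simp) e

theorem mpc_eq_of_stable {t : ℕ} (ht : G.order - 1 ≤ t) {u w : Fin G.order}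
    (e : mpc G t u = mpc G t w) (s : ℕ) : mpc G s u = mpc G s w := by
  rcases le_total s t with h | h
  · exact mpc_eq_of_le h e
  · induction s, h using Nat.le_induction with
    | base => exact e
    | succ s hs ih => exact stable_of_le (ht.trans hs) u w ih

/-! ### Balls around a vertex -/

/-- `Near v r u`: the vertex `u` has distance at most `r` from `v`. -/
def Near (v : Fin G.order) : ℕ → Fin G.order → Prop
  | 0, u => u = v
  | r + 1, u => Near v r u ∨ ∃ w, Near v r w ∧ G.graph.Adj w u

theorem near_self (v : Fin G.order) (r : ℕ) : Near v r v := by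
  induction r with
  | zero => rfl
  | succ r ih => exact Or.inl ih

/-- A ball that is not closed under adjacency gains a vertex when the radius grows, and it starts
with one vertex out of `n`. -/
theorem near_closed {v : Fin G.order} {r : ℕ} (hr : G.order - 1 ≤ r) (u w : Fin G.order)
    (hu : Near v r u) (h : G.graph.Adj u w) : Near v r w := by
  classical
  refine persistent_of_bounded (n := G.order)
    (P := fun r => ∀ u w, Near v r u → G.graph.Adj u w → Near v r w)
    (g := fun r => (Finset.univ.filter (Near v r)).card) ?_ ?_ ?_ ?_ hr u w hu h
  · exact Finset.card_pos.2 ⟨v, by simp [near_self]⟩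
  · intro r
    exact (Finset.card_le_univ _).trans (by simp)
  · intro r h
    push Not at h
    obtain ⟨u, w, hu, huw, hw⟩ := h
    refine Finset.card_lt_card ⟨fun x hx => ?_, fun hsub => hw ?_⟩
    · simp only [Finset.mem_filter, Finset.mem_univ, true_and] at hx ⊢
      exact Or.inl hx
    · have : w ∈ Finset.univ.filter (Near v (r + 1)) := by
        simp only [Finset.mem_filter, Finset.mem_univ, true_and]
        exact Or.inr ⟨u, hu, huw⟩
      simpa using hsub this
  · rintro r h u w (hu | ⟨x, hx, hxu⟩) huw
    · exact Or.inl (h u w hu huw)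
    · exact Or.inl (h u w (h x u hx hxu) huw)

theorem near_of_near {v : Fin G.order} {r : ℕ} (hr : G.order - 1 ≤ r) {s : ℕ} {u : Fin G.order}
    (hu : Near v s u) : Near v r u := by
  induction s generalizing u with
  | zero => rw [show u = v from hu]; exact near_self v r
  | succ s ih =>
    rcases hu with hu | ⟨w, hw, hwu⟩
    · exact ih hu
    · exact near_closed hr w u (ih hw) hwu

/-! ### The nodes of the dag of a colour -/

/-- Going down one level means staying at the vertex (`prev`) or moving to a neighbour (`nbr`), so
`r` levels down a ball of radius `r` is reached. `exists_near_of_occurs` is the converse. -/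
theorem occurs_of_near {v u : Fin G.order} {r i t : ℕ} (h : Near v r u) (ht : t = i + r) :
    Occurs (mpc G t v) i (mpc G i u) := by
  subst ht
  induction r generalizing u i with
  | zero => rw [show u = v from h]; exact Occurs.top
  | succ r ih =>
    have e : i + 1 + r = i + (r + 1) := by omega
    rcases h with h | ⟨w, hw, hwu⟩
    · have := ih h (i := i + 1)
      rw [e] at this
      exact this.prev
    · have := ih hw (i := i + 1)
      rw [e] at this
      exact this.nbr (mem_mpc_nbrs.2 ⟨u, hwu, rfl⟩)

theorem exists_near_of_occurs {v : Fin G.order} {t i : ℕ} {d : Color i}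
    (h : Occurs (mpc G t v) i d) : ∃ u, Near v (t - i) u ∧ mpc G i u = d := by
  induction h with
  | top => exact ⟨v, near_self _ _, rfl⟩
  | @prev i d h ih =>
    obtain ⟨u, hu, rfl⟩ := ih
    have e : t - i = t - (i + 1) + 1 := by have := h.le; omega
    exact ⟨u, by rw [e]; exact Or.inl hu, rfl⟩
  | @nbr i d e' h he ih =>
    obtain ⟨u, hu, rfl⟩ := ih
    obtain ⟨w, hw, rfl⟩ := mem_mpc_nbrs.1 he
    have e : t - i = t - (i + 1) + 1 := by have := h.le; omega
    exact ⟨w, by rw [e]; exact Or.inr ⟨u, hu, hw⟩, rfl⟩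

/-- A vertex whose colour is represented by a node. -/
noncomputable def nodeVertex {v : Fin G.order} {t i : ℕ} (x : (colorDag (mpc G t v)).Node i) :
    Fin G.order :=
  (exists_near_of_occurs x.2).choose

theorem near_nodeVertex {v : Fin G.order} {t i : ℕ} (x : (colorDag (mpc G t v)).Node i) :
    Near v (t - i) (nodeVertex x) :=
  (exists_near_of_occurs x.2).choose_spec.1

theorem mpc_nodeVertex {v : Fin G.order} {t i : ℕ} (x : (colorDag (mpc G t v)).Node i) :
    mpc G i (nodeVertex x) = x.1 :=
  (exists_near_of_occurs x.2).choose_spec.2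

theorem nodeVertex_injective {v : Fin G.order} {t i : ℕ} :
    Function.Injective (nodeVertex (G := G) (v := v) (t := t) (i := i)) := by
  intro x y h
  apply Subtype.ext
  rw [← mpc_nodeVertex x, ← mpc_nodeVertex y, h]

/-- Different nodes on a level are colours of different vertices. This sharing is what keeps the dag
polynomial. -/
theorem width_le {v : Fin G.order} {t : ℕ} (N : Numbering (colorDag (mpc G t v))) (i : ℕ) :
    N.width i ≤ G.order := by
  simpa using Fintype.card_le_of_injective (fun q => nodeVertex ((N.num i).symm q))
    (nodeVertex_injective.comp (N.num i).symm.injective)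

instance {v : Fin G.order} {t i : ℕ} : Finite ((colorDag (mpc G t v)).Node i) :=
  Finite.of_injective _ (nodeVertex_injective (G := G))

theorem nonempty_numbering {t : ℕ} (v : Fin G.order) :
    Nonempty (Numbering (colorDag (mpc G t v))) :=
  ⟨⟨fun _ => _, fun i => Finite.equivFin ((colorDag (mpc G t v)).Node i)⟩⟩

open Classical in
theorem edgeLabels_colorDag {t : ℕ} (c : Color t) (i : ℕ) (x : (colorDag c).Node (i + 1))
    (y : (colorDag c).Node i) : (colorDag c).edgeLabels i x y =
      (if y.1 = x.1.prev then {0} else ∅) ∪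
      (if y.1 ∈ x.1.nbrs then {x.1.nbrs.count y.1} else ∅) := by
  unfold colorDag
  congr!

/-! ### Bounds for the lengths of the encodings -/

theorem length_encodeList_le {l : List (List Sym)} {n B : ℕ} (hn : l.length ≤ n)
    (h : ∀ s ∈ l, s.length ≤ B) : (encodeList l).length ≤ n * B + 2 := by
  have h1 : l.flatten.length ≤ l.length * B := by
    rw [List.length_flatten]
    have := List.sum_le_card_nsmul (l.map List.length) B (by simpa using h)
    simpa using this
  have h2 := Nat.mul_le_mul_right B hn
  simp only [encodeList, paren, List.length_cons, List.length_append, List.length_nil]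
  omega

theorem length_encodeBits (b : List Bool) : (encodeBits b).length = b.length + 2 := by
  simp [encodeBits, paren]

theorem length_encodeNat (n : ℕ) : (encodeNat n).length = n + 2 := by
  simp [encodeNat, paren]

/-- From the inside out: at most two labels, each at most `n` as a multiplicity among neighbours;
`n` columns, `n` rows, `2n` matrices; and at most `n` leaf labels of length at most `k`. -/
theorem length_encodeDag_le (v : Fin G.order) (N : Numbering (colorDag (finalColor G v))) {k : ℕ}
    (hk : FeatureBound G k) : (encodeDag (colorDag (finalColor G v)) N).length ≤
      2 * ((G.order * (k + 2) + 2) + (2 * G.order *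
        (G.order * (G.order * (2 * (G.order + 2) + 2) + 2) + 2) + 2)) + 2 := by
  classical
  set n := G.order
  have hw : ∀ i, N.width i ≤ n := width_le N
  refine length_encodeList_le (by simp) ?_
  simp only [List.mem_cons, List.not_mem_nil, or_false]
  rintro s (rfl | rfl)
  · refine le_add_right (length_encodeList_le (by simpa using hw 0) ?_)
    simp only [List.mem_ofFn]
    rintro s ⟨q, rfl⟩
    rw [length_encodeBits]
    have h1 := mpc_nodeVertex ((N.num 0).symm q)
    have h2 := hk (nodeVertex ((N.num 0).symm q))
    change (mpc G 0 _ : List Bool).length ≤ k at h2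
    rw [h1] at h2
    exact Nat.add_le_add_right h2 2
  · refine le_add_left (length_encodeList_le (n := 2 * n) (by simp [colorDag, n]) ?_)
    simp only [List.mem_map, List.mem_range]
    rintro s ⟨i, hi, rfl⟩
    refine length_encodeList_le (by simpa using hw (i + 1)) ?_
    simp only [List.mem_ofFn]
    rintro s ⟨p, rfl⟩
    refine length_encodeList_le (by simpa using hw i) ?_
    simp only [List.mem_ofFn]
    rintro s ⟨q, rfl⟩
    rw [edgeLabels_colorDag]
    set x := (N.num (i + 1)).symm p
    set y := (N.num i).symm q
    refine length_encodeList_le ?_ ?_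
    · rw [List.length_map, Finset.length_sort]
      refine (Finset.card_union_le _ _).trans ?_
      split_ifs <;> simp
    · simp only [List.mem_map, Finset.mem_sort]
      rintro s ⟨m, hm, rfl⟩
      rw [length_encodeNat]
      have hc : x.1.nbrs.count y.1 ≤ n := by
        refine (Multiset.count_le_card _ _).trans ?_
        rw [← mpc_nodeVertex x, mpc_nbrs, Multiset.card_map]
        exact (Finset.card_le_univ _).trans (by simp [n])
      have : m ≤ n := by
        rcases Finset.mem_union.1 hm with hm | hm
        · split_ifs at hm
          · simp at hm; omega
          · simp at hm
        · split_ifs at hm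
          · simp at hm; omega
          · simp at hm
      omega

theorem length_encodeRooted_le (v : Fin G.order) {k : ℕ} (hk : FeatureBound G k) :
    (encodeRooted G v).length ≤ 3 * ((G.order + 2) + (G.order * (k + 2) + 2) +
      (G.order * (G.order + 2) + 2)) + 2 := by
  refine length_encodeList_le (by simp) ?_
  simp only [List.mem_cons, List.not_mem_nil, or_false]
  rintro s (rfl | rfl | rfl)
  · rw [length_encodeBits, List.length_ofFn]; omega
  · refine (length_encodeList_le (n := G.order) (B := k + 2) (by simp) ?_).trans (by omega)
    simp only [List.mem_ofFn]
    rintro s ⟨u, rfl⟩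
    rw [length_encodeBits]
    exact Nat.add_le_add_right (hk u) 2
  · refine (length_encodeList_le (n := G.order) (B := G.order + 2) (by simp) ?_).trans (by omega)
    simp only [List.mem_ofFn]
    rintro s ⟨u, rfl⟩
    rw [length_encodeBits, List.length_ofFn]

end MsgPass

namespace MsgPass

open TreeRep

/-! ### Computing the dag from the graph -/

/-- The entry of a Boolean matrix. -/
def entry (E : List (List Bool)) (u w : ℕ) : Bool := (E.getD u []).getD w false

/-- The Boolean matrix with given entries. -/
def matrix (n : ℕ) (f : ℕ → ℕ → Bool) : List (List Bool) :=
  (List.range n).map fun u => (List.range n).map (f u)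

/-- The number of neighbours of `u` that are equivalent to `x`. -/
def classDegree (A E : List (List Bool)) (n u x : ℕ) : ℕ :=
  ((List.range n).filter fun y => entry A u y && entry E y x).length

/-- One round of colour refinement; `E` is the matrix of the equivalence of vertices. -/
def refineStep (A : List (List Bool)) (n : ℕ) (E : List (List Bool)) : List (List Bool) :=
  matrix n fun u w => entry E u w &&
    (List.range n).all fun x => decide (classDegree A E n u x = classDegree A E n w x)

/-- The equivalence of vertices after `i` rounds. -/
def refined (B A : List (List Bool)) (n i : ℕ) : List (List Bool) :=
  (List.range i).foldl (fun E _ => refineStep A n E)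
    (matrix n fun u w => decide (B.getD u [] = B.getD w []))

/-- Adding all neighbours to a set of vertices. -/
def ballStep (A : List (List Bool)) (n : ℕ) (R : List Bool) : List Bool :=
  (List.range n).map fun u => R.getD u false ||
    (List.range n).any fun w => R.getD w false && entry A w u

/-- The ball of radius `r`. -/
def ballList (R : List Bool) (A : List (List Bool)) (n r : ℕ) : List Bool :=
  (List.range r).foldl (fun R _ => ballStep A n R) R

/-- The first vertices of the equivalence classes in a set of vertices. -/
def representatives (R : List Bool) (E : List (List Bool)) (n : ℕ) : List ℕ :=
  (List.range n).filter fun u => R.getD u false &&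
    (List.range u).all fun w => !(R.getD w false && entry E w u)

/-- The vertices that represent the nodes on level `i` of the dag. -/
def levelVertices (R : List Bool) (B A : List (List Bool)) (n i : ℕ) : List ℕ :=
  representatives (ballList R A n (2 * n - i)) (refined B A n i) n

/-- The labels of the edges between two nodes of the dag. -/
def edgeList (A E : List (List Bool)) (n p q : ℕ) : List ℕ :=
  (bif entry E p q then [0] else []) ++
    (if classDegree A E n p q = 0 then [] else [classDegree A E n p q])

/-- The string for the dag, computed from the root, the features and the adjacency matrix. -/
def dagString (I : List Bool × List (List Bool) × List (List Bool) × Unit) : List Sym :=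
  encodeList
    [ encodeList ((levelVertices I.1 I.2.1 I.2.2.1 I.2.1.length 0).map fun u =>
        encodeBits (I.2.1.getD u [])),
      encodeList ((List.range (2 * I.2.1.length)).map fun i =>
        encodeList ((levelVertices I.1 I.2.1 I.2.2.1 I.2.1.length (i + 1)).map fun p =>
          encodeList ((levelVertices I.1 I.2.1 I.2.2.1 I.2.1.length i).map fun q =>
            encodeList ((edgeList I.2.2.1 (refined I.2.1 I.2.2.1 I.2.1.length i)
              I.2.1.length p q).map encodeNat)))) ]

section PolyTime

variable {α : Type} [TreeRep α]

@[fun_prop]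
theorem polyTime_entry {E : α → List (List Bool)} {u w : α → ℕ} (hE : PolyTime E)
    (hu : PolyTime u) (hw : PolyTime w) : PolyTime (fun a => entry (E a) (u a) (w a)) := by
  unfold entry; fun_prop

theorem polyTime_matrix {n : α → ℕ} {f : α → ℕ → ℕ → Bool} (hn : PolyTime n)
    (hf : PolyTime (fun q : (α × ℕ) × ℕ => f q.1.1 q.1.2 q.2)) :
    PolyTime (fun a => matrix (n a) (f a)) := by
  unfold matrix
  exact .map (by fun_prop) (.map (by fun_prop) hf)

theorem rsize_bits_le (l : List Bool) : rsize l ≤ 4 * l.length + 1 := by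
  have := rsize_list_le (l := l) (B := 3) fun a _ => rsize_bool_le a
  omega

theorem rsize_matrix_le (n : ℕ) (f : ℕ → ℕ → Bool) :
    rsize (matrix n f) ≤ n * (4 * n + 2) + 1 := by
  have := rsize_list_le (l := matrix n f) (B := 4 * n + 1) fun a ha => by
    obtain ⟨u, _, rfl⟩ := List.mem_map.1 ha
    simpa using rsize_bits_le ((List.range n).map (f u))
  simpa [matrix] using this

@[fun_prop]
theorem polyTime_classDegree {A E : α → List (List Bool)} {n u x : α → ℕ} (hA : PolyTime A)
    (hE : PolyTime E) (hn : PolyTime n) (hu : PolyTime u) (hx : PolyTime x) :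
    PolyTime (fun a => classDegree (A a) (E a) (n a) (u a) (x a)) := by
  unfold classDegree; fun_prop

@[fun_prop]
theorem polyTime_refineStep {A E : α → List (List Bool)} {n : α → ℕ} (hA : PolyTime A)
    (hE : PolyTime E) (hn : PolyTime n) : PolyTime (fun a => refineStep (A a) (n a) (E a)) := by
  unfold refineStep
  exact polyTime_matrix hn (by fun_prop)

@[fun_prop]
theorem polyTime_refined {A B : α → List (List Bool)} {n i : α → ℕ} (hB : PolyTime B)
    (hA : PolyTime A) (hn : PolyTime n) (hi : PolyTime i) :
    PolyTime (fun a => refined (B a) (A a) (n a) (i a)) := by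
  obtain ⟨p, hp⟩ := hn.exists_rsize_le
  refine PolyTime.foldl_of_add_le (by fun_prop)
    (polyTime_matrix hn (PolyTime.decide_eq_bits (by fun_prop) (by fun_prop))) (by fun_prop)
    ⟨p * (4 * p + 2) + 1, fun a b _ t => ?_⟩
  have h1 : n a ≤ p.eval (rsize a) := by
    have := hp a
    rw [rsize_nat] at this
    omega
  -- The refined matrix is bounded in terms of `n` alone, whatever the previous accumulator was.
  refine (rsize_matrix_le _ _).trans (le_add_left ?_)
  simp only [Polynomial.eval_add, Polynomial.eval_mul, Polynomial.eval_ofNat, Polynomial.eval_one]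
  gcongr

@[fun_prop]
theorem polyTime_ballList {R : α → List Bool} {A : α → List (List Bool)} {n r : α → ℕ}
    (hR : PolyTime R) (hA : PolyTime A) (hn : PolyTime n) (hr : PolyTime r) :
    PolyTime (fun a => ballList (R a) (A a) (n a) (r a)) := by
  obtain ⟨p, hp⟩ := hn.exists_rsize_le
  refine PolyTime.foldl_of_add_le (by fun_prop) hR (by unfold ballStep; fun_prop)
    ⟨4 * p + 1, fun a b _ t => ?_⟩
  have h1 : n a ≤ p.eval (rsize a) := by
    have := hp a
    rw [rsize_nat] at this
    omega
  refine (rsize_bits_le _).trans (le_add_left ?_)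
  simp only [ballStep, List.length_map, List.length_range, Polynomial.eval_add,
    Polynomial.eval_mul, Polynomial.eval_ofNat, Polynomial.eval_one]
  omega

@[fun_prop]
theorem polyTime_levelVertices {R : α → List Bool} {B A : α → List (List Bool)} {n i : α → ℕ}
    (hR : PolyTime R) (hB : PolyTime B) (hA : PolyTime A) (hn : PolyTime n) (hi : PolyTime i) :
    PolyTime (fun a => levelVertices (R a) (B a) (A a) (n a) (i a)) := by
  unfold levelVertices representatives
  fun_prop

theorem polyTime_edgeList {A E : α → List (List Bool)} {n p q : α → ℕ} (hA : PolyTime A)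
    (hE : PolyTime E) (hn : PolyTime n) (hp : PolyTime p) (hq : PolyTime q) :
    PolyTime (fun a => edgeList (A a) (E a) (n a) (p a) (q a)) := by
  unfold edgeList
  exact .append (.cond (by fun_prop) (by fun_prop) (by fun_prop))
    (.ite (by fun_prop) (by fun_prop) (by fun_prop))

theorem polyTime_dagString : PolyTime dagString := by
  unfold dagString
  refine .encodeList (.cons (.encodeList (.map (by fun_prop) (.encodeBits (by fun_prop))))
    (.cons (.encodeList (.map (by fun_prop) (.encodeList (.map (by fun_prop) (.encodeList
      (.map (by fun_prop) (.encodeList (.map (polyTime_edgeList ?_ ?_ ?_ ?_ ?_)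
        (.encodeNat (by fun_prop)))))))))) (by fun_prop))) <;> fun_prop

end PolyTime

/-! ### Correctness -/

theorem entry_matrix {n u w : ℕ} (f : ℕ → ℕ → Bool) (hu : u < n) (hw : w < n) :
    entry (matrix n f) u w = f u w := by
  simp [entry, matrix, hu, hw]

theorem entry_ofFn {n : ℕ} (f : Fin n → Fin n → Bool) (u w : Fin n) :
    entry (List.ofFn fun u => List.ofFn (f u)) u w = f u w := by
  simp [entry]

theorem length_filter_range (n : ℕ) (f : ℕ → Bool) :
    ((List.range n).filter f).length = (Finset.univ.filter fun y : Fin n => f y = true).card := by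
  rw [← List.map_coe_finRange_eq_range, List.filter_map, List.length_map,
    ← List.toFinset_card_of_nodup ((List.nodup_finRange n).filter _)]
  congr 1
  ext y
  simp

section Correct

open Classical

variable (G : FeaturedGraph) (v : Fin G.order)

/-- The data represented by the string for a rooted graph. -/
noncomputable def rootedData : List Bool × List (List Bool) × List (List Bool) × Unit :=
  (List.ofFn fun u => decide (u = v), List.ofFn G.feature,
    (List.ofFn fun u => List.ofFn fun w => decide (G.graph.Adj u w)), ())

theorem represents_encodeRooted : Represents (encodeRooted G v) (rootedData G v) := by
  refine represents_encodeList_triple ?_ ?_ ?_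
  · convert represents_encodeBits _
  · simp only [List.ofFn_eq_map]
    exact represents_encodeList fun u _ => represents_encodeBits _
  · simp only [List.ofFn_eq_map (f := fun u => encodeBits _),
      List.ofFn_eq_map (f := fun u => List.ofFn _)]
    refine represents_encodeList fun u _ => ?_
    convert represents_encodeBits _

/-- The adjacency matrix. -/
noncomputable def adjList : List (List Bool) :=
  List.ofFn fun u => List.ofFn fun w => decide (G.graph.Adj u w)

theorem entry_adjList (u w : Fin G.order) : entry (adjList G) u w = decide (G.graph.Adj u w) :=
  entry_ofFn _ u w

variable {G v}

theorem classDegree_eq {E : List (List Bool)} {i : ℕ}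
    (hE : ∀ u w : Fin G.order, entry E u w = decide (mpc G i u = mpc G i w)) (u x : Fin G.order) :
    classDegree (adjList G) E G.order u x = (mpc G (i + 1) u).nbrs.count (mpc G i x) := by
  rw [classDegree, length_filter_range, count_mpc_nbrs]
  simp [entry_adjList, hE]

/-- Colours that no vertex has occur in neither multiset. This is why `refineStep` only compares
degrees into classes of actual vertices. -/
theorem mpc_nbrs_eq_iff {i : ℕ} {u w : Fin G.order} :
    (mpc G (i + 1) u).nbrs = (mpc G (i + 1) w).nbrs ↔ ∀ x, (mpc G (i + 1) u).nbrs.count (mpc G i x) =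
      (mpc G (i + 1) w).nbrs.count (mpc G i x) := by
  refine ⟨fun h x => by rw [h], fun h => Multiset.ext.2 fun c => ?_⟩
  by_cases hc : ∃ x, mpc G i x = c
  · obtain ⟨x, rfl⟩ := hc
    exact h x
  · rw [Multiset.count_eq_zero.2, Multiset.count_eq_zero.2]
    · exact fun hm => hc (let ⟨x, _, hx⟩ := mem_mpc_nbrs.1 hm; ⟨x, hx⟩)
    · exact fun hm => hc (let ⟨x, _, hx⟩ := mem_mpc_nbrs.1 hm; ⟨x, hx⟩)

theorem entry_refined (i : ℕ) (u w : Fin G.order) :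
    entry (refined (List.ofFn G.feature) (adjList G) G.order i) u w =
      decide (mpc G i u = mpc G i w) := by
  induction i generalizing u w with
  | zero =>
    rw [refined, List.range_zero, List.foldl_nil, entry_matrix _ u.2 w.2]
    simp only [List.getD_eq_getElem?_getD, List.getElem?_ofFn, Fin.is_lt, dite_true, Fin.eta,
      Option.getD_some]
    congr!
  | succ i ih =>
    rw [refined, List.range_succ, List.foldl_append]
    change entry (refineStep (adjList G) G.order
      (refined (List.ofFn G.feature) (adjList G) G.order i)) u w = _
    rw [refineStep, entry_matrix _ u.2 w.2, ih, Bool.eq_iff_iff]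
    simp only [Bool.and_eq_true, decide_eq_true_eq, List.all_eq_true, List.mem_range]
    rw [mpc_succ_eq_iff, mpc_nbrs_eq_iff]
    refine and_congr Iff.rfl ⟨fun h x => ?_, fun h x hx => ?_⟩
    · have := h x x.2
      rwa [classDegree_eq ih, classDegree_eq ih] at this
    · have := h ⟨x, hx⟩
      rwa [← classDegree_eq ih, ← classDegree_eq ih] at this

theorem getD_ballList (r : ℕ) (u : Fin G.order) :
    (ballList (List.ofFn fun u => decide (u = v)) (adjList G) G.order r).getD u false =
      decide (Near v r u) := by
  induction r generalizing u with
  | zero =>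
    rw [Bool.eq_iff_iff, decide_eq_true_iff]
    simp [ballList, Near]
  | succ r ih =>
    rw [ballList, List.range_succ, List.foldl_append]
    change (ballStep (adjList G) G.order
      (ballList (List.ofFn fun u => decide (u = v)) (adjList G) G.order r)).getD u false = _
    rw [ballStep, List.getD_eq_getElem _ _ (by simp), List.getElem_map, List.getElem_range, ih,
      Bool.eq_iff_iff]
    simp only [Bool.or_eq_true, decide_eq_true_eq, List.any_eq_true, List.mem_range,
      Bool.and_eq_true]
    refine or_congr Iff.rfl ⟨?_, ?_⟩
    · rintro ⟨w, hw, h1, h2⟩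
      have h1' := ih ⟨w, hw⟩
      have h2' := entry_adjList G ⟨w, hw⟩ u
      simp only [h1] at h1'
      simp only [h2] at h2'
      exact ⟨⟨w, hw⟩, by simpa using h1'.symm, by simpa using h2'.symm⟩
    · rintro ⟨w, h1, h2⟩
      exact ⟨w, w.2, by rw [ih]; simpa using h1, by rw [entry_adjList]; simpa using h2⟩

/-- The first vertices with the colours that occur on level `i` of the dag. -/
noncomputable def nodeList (v : Fin G.order) (t i : ℕ) : List (Fin G.order) :=
  (List.finRange G.order).filter fun u => decide (i ≤ t ∧ Near v (t - i) u ∧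
    ∀ w < u, ¬(Near v (t - i) w ∧ mpc G i w = mpc G i u))

theorem levelVertices_eq {i : ℕ} (hi : i ≤ 2 * G.order) :
    levelVertices (List.ofFn fun u => decide (u = v)) (List.ofFn G.feature) (adjList G) G.order i =
      (nodeList v (2 * G.order) i).map Fin.val := by
  rw [levelVertices, representatives, nodeList, ← List.map_coe_finRange_eq_range, List.filter_map]
  congr 1
  refine List.filter_congr fun u _ => ?_
  simp only [Function.comp_apply, getD_ballList]
  rw [Bool.eq_iff_iff]
  simp only [hi, true_and, Bool.and_eq_true, decide_eq_true_eq, List.all_eq_true, List.mem_range]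
  refine and_congr Iff.rfl ⟨fun h w hw => ?_, fun h w hw => ?_⟩
  · have := h w hw
    rw [getD_ballList, entry_refined] at this
    simpa [imp_iff_not_or] using this
  · have := h ⟨w, hw.trans u.2⟩ hw
    have h1 := getD_ballList (v := v) (2 * G.order - i) ⟨w, hw.trans u.2⟩
    have h2 := entry_refined i ⟨w, hw.trans u.2⟩ u
    simp only at h1 h2
    rw [h1, h2]
    simpa [imp_iff_not_or] using this

theorem mem_nodeList {t i : ℕ} {u : Fin G.order} : u ∈ nodeList v t i ↔ i ≤ t ∧ Near v (t - i) u ∧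
    ∀ w < u, ¬(Near v (t - i) w ∧ mpc G i w = mpc G i u) := by
  simp [nodeList]

theorem occurs_of_mem_nodeList {t i : ℕ} {u : Fin G.order} (h : u ∈ nodeList v t i) :
    Occurs (mpc G t v) i (mpc G i u) :=
  occurs_of_near (mem_nodeList.1 h).2.1 (by have := (mem_nodeList.1 h).1; omega)

/-- The node with a given number. -/
noncomputable def nodeOf (v : Fin G.order) (t i : ℕ) (q : Fin (nodeList v t i).length) :
    (colorDag (mpc G t v)).Node i :=
  ⟨mpc G i (nodeList v t i)[q], occurs_of_mem_nodeList (List.getElem_mem _)⟩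

/-- Each colour on the level has exactly one least vertex in the ball: minimality gives injectivity,
well-foundedness gives surjectivity. -/
theorem nodeOf_bijective (v : Fin G.order) (t i : ℕ) : Function.Bijective (nodeOf v t i) := by
  constructor
  · intro p q h
    have h1 : mpc G i (nodeList v t i)[p] = mpc G i (nodeList v t i)[q] := congrArg Subtype.val h
    have hp := mem_nodeList.1 (List.getElem_mem (l := nodeList v t i) p.2)
    have hq := mem_nodeList.1 (List.getElem_mem (l := nodeList v t i) q.2)
    have hnd : (nodeList v t i).Nodup := (List.nodup_finRange _).filter _
    apply Fin.ext
    refine (hnd.getElem_inj_iff (hi := p.2) (hj := q.2)).1 ?_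
    rcases lt_trichotomy (nodeList v t i)[p] (nodeList v t i)[q] with hlt | heq | hlt
    · exact absurd ⟨hp.2.1, h1⟩ (hq.2.2 _ hlt)
    · exact heq
    · exact absurd ⟨hq.2.1, h1.symm⟩ (hp.2.2 _ hlt)
  · rintro ⟨d, hd⟩
    obtain ⟨u₀, hu₀, hd₀⟩ := exists_near_of_occurs hd
    obtain ⟨u, ⟨hu, hdu⟩, hmin⟩ := WellFounded.has_min (wellFounded_lt (α := Fin G.order))
      {u | Near v (t - i) u ∧ mpc G i u = d} ⟨u₀, hu₀, hd₀⟩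
    have hmem : u ∈ nodeList v t i :=
      mem_nodeList.2 ⟨hd.le, hu, fun w hw h => hmin w ⟨h.1, h.2.trans hdu⟩ hw⟩
    obtain ⟨q, hq, e⟩ := List.getElem_of_mem hmem
    exact ⟨⟨q, hq⟩, Subtype.ext (by simp only [nodeOf, Fin.getElem_fin, e, hdu])⟩

/-- The numbering of the nodes by the first vertices with their colours. -/
noncomputable def nodeNumbering (v : Fin G.order) (t : ℕ) : Numbering (colorDag (mpc G t v)) where
  width i := (nodeList v t i).length
  num i := (Equiv.ofBijective _ (nodeOf_bijective v t i)).symm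

theorem ofFn_getElem_eq_map {α β : Type*} (l : List α) (f : Fin l.length → β) (g : α → β)
    (h : ∀ q, f q = g l[q]) : List.ofFn f = l.map g := by
  refine List.ext_getElem (by simp) fun q h1 h2 => ?_
  simp [h]

/-- A multiplicity that labels an edge is positive. It never merges with the label `0`, and it comes
after it in sorted order. -/
theorem sort_edgeLabels {i : ℕ} {t : ℕ} (x : (colorDag (mpc G t v)).Node (i + 1))
    (y : (colorDag (mpc G t v)).Node i) (p q : Fin G.order) (hx : x.1 = mpc G (i + 1) p)
    (hy : y.1 = mpc G i q) : ((colorDag (mpc G t v)).edgeLabels i x y).sort (· ≤ ·) =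
      edgeList (adjList G) (refined (List.ofFn G.feature) (adjList G) G.order i) G.order p q := by
  rw [edgeLabels_colorDag, edgeList, classDegree_eq (entry_refined i), entry_refined, hx, hy,
    mpc_prev]
  set c := (mpc G (i + 1) p).nbrs.count (mpc G i q) with hc
  have hmem : mpc G i q ∈ (mpc G (i + 1) p).nbrs ↔ c ≠ 0 := by
    rw [hc, Ne, Multiset.count_eq_zero, not_not]
  rw [eq_comm (a := mpc G i q)]
  by_cases h1 : mpc G i p = mpc G i q <;> by_cases h2 : c = 0
  · simp [h1, h2, hmem]
  · simp only [h1, hmem, h2, if_true, ne_eq, not_false_eq_true, decide_true, cond_true, if_false]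
    have : ({0} ∪ {c} : Finset ℕ) = [0, c].toFinset := by ext; simp
    rw [this]
    exact (List.toFinset_sort (r := (· ≤ ·)) (by simp; omega)).2 (by simp)
  · simp [h1, h2, hmem]
  · simp [h1, h2, hmem]

/-- One numbering is enough, because an algorithm on dags has to be correct for all of them. -/
theorem dagString_eq (G : FeaturedGraph) (v : Fin G.order) :
    dagString (rootedData G v) =
      encodeDag (colorDag (finalColor G v)) (nodeNumbering v (2 * G.order)) := by
  have hlen : (List.ofFn G.feature).length = G.order := by simp
  simp only [dagString, rootedData, encodeDag, hlen]
  change encodeList [encodeList (List.map _ (levelVertices _ _ (adjList G) _ _)), encodeList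
    (List.map (fun i => encodeList (List.map (fun p => encodeList (List.map (fun q => encodeList
      (List.map _ (edgeList (adjList G) (refined _ (adjList G) _ _) _ _ _)))
      (levelVertices _ _ (adjList G) _ _))) (levelVertices _ _ (adjList G) _ _))) _)] = _
  congr 2
  · congr 1
    rw [levelVertices_eq (by omega), List.map_map]
    refine (ofFn_getElem_eq_map (nodeList v (2 * G.order) 0) _ _ fun q => ?_).symm
    simp only [Function.comp_apply]
    congr 1
    rw [List.getD_eq_getElem _ _ (by simp)]
    simp only [List.getElem_ofFn]
    rfl
  · congr 2
    refine List.map_congr_left fun i hi => ?_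
    have hi : i < 2 * G.order := List.mem_range.1 hi
    congr 1
    rw [levelVertices_eq (by omega), levelVertices_eq (by omega), List.map_map]
    refine (ofFn_getElem_eq_map (nodeList v (2 * G.order) (i + 1)) _ _ fun p => ?_).symm
    simp only [Function.comp_apply]
    congr 1
    rw [List.map_map]
    refine (ofFn_getElem_eq_map (nodeList v (2 * G.order) i) _ _ fun q => ?_)
    simp only [Function.comp_apply]
    congr 2
    exact sort_edgeLabels (t := 2 * G.order) _ _ _ _ rfl rfl

end Correct

end MsgPass

/-! ### Constructing graphs with prescribed degrees between classes -/

namespace MsgPass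

/-! ### Regular and biregular graphs -/

theorem length_filter_range_eq_card (n : ℕ) (f : ℕ → Bool) :
    ((List.range n).filter f).length = ((Finset.range n).filter fun y => f y = true).card := by
  rw [← List.toFinset_card_of_nodup (List.nodup_range.filter _)]
  congr 1
  ext y
  simp

/-- The adjacency of a bipartite graph with degrees `d` and `e`, where `N'` is the size of the
second part. -/
def between (d e N' a b : ℕ) : Bool :=
  (List.range e).any fun j => decide (a * d ≤ b + j * N') && decide (b + j * N' < a * d + d)

theorem between_iff {d e N' a b : ℕ} :
    between d e N' a b = true ↔ ∃ j < e, a * d ≤ b + j * N' ∧ b + j * N' < a * d + d := by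
  simp [between]

/-- The edges are slots `s < N * d = N' * e`, slot `s` joining `s / d` on the left to `s % N'` on
the right. The vertex `a` owns `d` consecutive slots, whose residues are distinct since `d ≤ N'`. -/
theorem card_between_left {N N' d e a : ℕ} (h : N * d = N' * e) (hd : d ≤ N') (ha : a < N) :
    ((List.range N').filter (between d e N' a)).length = d := by
  rw [length_filter_range_eq_card]
  have hlt : ∀ i < d, a * d + i < N' * e := by
    intro i hi
    have : (a + 1) * d ≤ N * d := Nat.mul_le_mul_right d ha
    rw [Nat.succ_mul] at this
    omega
  have hpos : ∀ i < d, 0 < N' := fun i hi => by omega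
  conv_rhs => rw [← Finset.card_range d]
  symm
  refine Finset.card_bij (fun i _ => (a * d + i) % N') ?_ ?_ ?_
  · intro i hi
    have hi := Finset.mem_range.1 hi
    simp only [Finset.mem_filter, Finset.mem_range, between_iff]
    refine ⟨Nat.mod_lt _ (hpos i hi), (a * d + i) / N', Nat.div_lt_of_lt_mul (hlt i hi), ?_⟩
    have := Nat.mod_add_div (a * d + i) N'
    rw [mul_comm N'] at this
    omega
  · intro i hi j hj hij
    have hi := Finset.mem_range.1 hi
    have hj := Finset.mem_range.1 hj
    have h1 : i ≡ j [MOD N'] := Nat.ModEq.add_left_cancel' (a * d) hij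
    exact h1.eq_of_lt_of_lt (by omega) (by omega)
  · intro b hb
    simp only [Finset.mem_filter, Finset.mem_range, between_iff] at hb
    obtain ⟨hb, j, _, h1, h2⟩ := hb
    refine ⟨b + j * N' - a * d, Finset.mem_range.2 (by omega), ?_⟩
    rw [Nat.add_sub_cancel' h1, Nat.add_mul_mod_self_right, Nat.mod_eq_of_lt hb]

/-- The slots of `b` are `b + j * N'` for `j < e`. Their spacing is at least `d`, so they fall into
different blocks of length `d`. -/
theorem card_between_right {N N' d e b : ℕ} (h : N * d = N' * e) (hd : d ≤ N') (hb : b < N') :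
    ((List.range N).filter fun a => between d e N' a b).length = e := by
  rw [length_filter_range_eq_card]
  have hlt : ∀ j < e, b + j * N' < N * d := by
    intro j hj
    have : (j + 1) * N' ≤ e * N' := Nat.mul_le_mul_right N' hj
    rw [Nat.succ_mul, mul_comm e, ← h] at this
    omega
  have hpos : ∀ j < e, 0 < d := fun j hj => Nat.pos_of_ne_zero fun h0 => by
    have := hlt j hj
    simp [h0] at this
  conv_rhs => rw [← Finset.card_range e]
  symm
  refine Finset.card_bij (fun j _ => (b + j * N') / d) ?_ ?_ ?_
  · intro j hj
    have hj := Finset.mem_range.1 hj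
    simp only [Finset.mem_filter, Finset.mem_range, between_iff]
    refine ⟨Nat.div_lt_of_lt_mul (by rw [mul_comm d]; exact hlt j hj), j, hj, ?_⟩
    have h1 := Nat.div_add_mod (b + j * N') d
    have h2 := Nat.mod_lt (b + j * N') (hpos j hj)
    rw [mul_comm d] at h1
    omega
  · have key : ∀ i j, i < j → j < e → (b + i * N') / d ≠ (b + j * N') / d := by
      intro i j hij hj
      have h1 : (i + 1) * N' ≤ j * N' := Nat.mul_le_mul_right N' hij
      rw [Nat.succ_mul] at h1
      have h2 : (b + i * N' + d) / d ≤ (b + j * N') / d := Nat.div_le_div_right (by omega)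
      rw [Nat.add_div_right _ (hpos j hj)] at h2
      omega
    intro i hi j hj hij
    have hi := Finset.mem_range.1 hi
    have hj := Finset.mem_range.1 hj
    rcases lt_trichotomy i j with hlt | heq | hlt
    · exact absurd hij (key i j hlt hj)
    · exact heq
    · exact absurd hij.symm (key j i hlt hi)
  · intro a ha
    simp only [Finset.mem_filter, Finset.mem_range, between_iff] at ha
    obtain ⟨_, j, hj, h1, h2⟩ := ha
    refine ⟨j, Finset.mem_range.2 hj, ?_⟩
    refine Nat.div_eq_of_lt_le h1 ?_
    rw [Nat.succ_mul]
    exact h2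

/-- The adjacency of a circulant graph with `N` vertices of degree `d`. -/
def within (N d a b : ℕ) : Bool :=
  decide (a - b + (b - a) ≠ 0) && (decide (2 * (a - b + (b - a)) ≤ d) ||
    (decide (2 * (N - (a - b + (b - a))) ≤ d) ||
      (decide (2 * (a - b + (b - a)) = N) && decide (d % 2 = 1))))

theorem within_iff {N d a b : ℕ} : within N d a b = true ↔ a - b + (b - a) ≠ 0 ∧
    (2 * (a - b + (b - a)) ≤ d ∨ 2 * (N - (a - b + (b - a))) ≤ d ∨
      (2 * (a - b + (b - a)) = N ∧ d % 2 = 1)) := by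
  simp only [within, Bool.and_eq_true, Bool.or_eq_true, decide_eq_true_eq]

theorem within_comm (N d a b : ℕ) : within N d a b = within N d b a := by
  simp only [within, Nat.add_comm (a - b)]

theorem card_within {N d a : ℕ} (hd : d < N) (hpar : (N * d) % 2 = 0) (ha : a < N) :
    ((List.range N).filter (within N d a)).length = d := by
  rw [length_filter_range_eq_card]
  have hodd : d % 2 = 1 → N % 2 = 0 := by
    intro h
    rw [Nat.mul_mod, h] at hpar
    omega
  have h1 : ((Finset.range N).filter fun b => within N d a b = true).card =
      ((Finset.range N).filter fun x => x ≠ 0 ∧ (2 * x ≤ d ∨ 2 * (N - x) ≤ d ∨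
        (2 * x = N ∧ d % 2 = 1))).card := by
    -- Rotation by `a` modulo `N` reduces the count to the neighbours of `0`.
    refine Finset.card_nbij' (fun b => if a ≤ b then b - a else b + N - a)
      (fun x => if a + x < N then a + x else a + x - N) ?_ ?_ ?_ ?_
    · intro b hb
      simp only [Finset.coe_filter, Finset.mem_range, Set.mem_ofPred_eq, within_iff] at hb ⊢
      split_ifs <;> omega
    · intro x hx
      simp only [Finset.coe_filter, Finset.mem_range, Set.mem_ofPred_eq, within_iff] at hx ⊢
      split_ifs <;> omega
    · intro b hb
      simp only [Finset.coe_filter, Finset.mem_range, Set.mem_ofPred_eq] at hb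
      simp only
      split_ifs <;> omega
    · intro x hx
      simp only [Finset.coe_filter, Finset.mem_range, Set.mem_ofPred_eq] at hx
      simp only
      split_ifs <;> omega
  -- There are `d / 2` neighbours on either side of `0`, and for odd `d` also the antipode `N / 2`,
  -- which exists because `N` is then even.
  have h2 : ((Finset.range N).filter fun x => x ≠ 0 ∧ (2 * x ≤ d ∨ 2 * (N - x) ≤ d ∨
      (2 * x = N ∧ d % 2 = 1))) =
      (Finset.Ico 1 (d / 2 + 1) ∪ Finset.Ico (N - d / 2) N) ∪
        (Finset.Ico (N / 2) (N / 2 + d % 2)) := by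
    ext x
    simp only [Finset.mem_filter, Finset.mem_range, Finset.mem_union, Finset.mem_Ico]
    omega
  rw [h1, h2, Finset.card_union_of_disjoint, Finset.card_union_of_disjoint]
  · simp only [Nat.card_Ico]; omega
  · rw [Finset.disjoint_left]; intro x; simp only [Finset.mem_Ico]; omega
  · rw [Finset.disjoint_left]; intro x; simp only [Finset.mem_union, Finset.mem_Ico]; omega

/-! ### Graphs with a prescribed degree matrix -/

/-- `f c` vertices in the class `c`, for `c < m`, allow a graph in which every vertex of the class
`c` has `d c c'` neighbours in the class `c'`. -/
structure Admissible (m : ℕ) (d : ℕ → ℕ → ℕ) (f : ℕ → ℕ) : Prop where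
  balance : ∀ c < m, ∀ c' < m, f c * d c c' = f c' * d c' c
  le : ∀ c < m, ∀ c' < m, d c' c ≤ f c
  lt : ∀ c < m, d c c < f c
  even : ∀ c < m, (f c * d c c) % 2 = 0

/-- The adjacency of the graph whose vertices are the pairs `(c, a)` with `c < m` and `a < f c`. -/
def cellAdj (m : ℕ) (d : ℕ → ℕ → ℕ) (f : ℕ → ℕ) (x y : ℕ × ℕ) : Bool :=
  decide (x.1 < m) && (decide (y.1 < m) &&
    (if x.1 = y.1 then within (f x.1) (d x.1 x.1) x.2 y.2
      else if x.1 < y.1 then between (d x.1 y.1) (d y.1 x.1) (f y.1) x.2 y.2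
      else between (d y.1 x.1) (d x.1 y.1) (f x.1) y.2 x.2))

theorem cellAdj_comm (m : ℕ) (d : ℕ → ℕ → ℕ) (f : ℕ → ℕ) (x y : ℕ × ℕ) :
    cellAdj m d f x y = cellAdj m d f y x := by
  unfold cellAdj
  rcases lt_trichotomy x.1 y.1 with h | h | h
  · simp [h, h.ne, h.ne', h.not_gt, Bool.and_left_comm]
  · simp [h, within_comm]
  · simp [h, h.ne, h.ne', h.not_gt, Bool.and_left_comm]

theorem cellAdj_self (m : ℕ) (d : ℕ → ℕ → ℕ) (f : ℕ → ℕ) (x : ℕ × ℕ) :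
    cellAdj m d f x x = false := by
  simp [cellAdj, within]

theorem Admissible.card_cellAdj {m : ℕ} {d : ℕ → ℕ → ℕ} {f : ℕ → ℕ} (h : Admissible m d f)
    {c a c' : ℕ} (hc : c < m) (ha : a < f c) (hc' : c' < m) :
    ((List.range (f c')).filter fun b => cellAdj m d f (c, a) (c', b)).length = d c c' := by
  rcases lt_trichotomy c c' with hlt | rfl | hlt
  · simp only [cellAdj, hc, hc', hlt, hlt.ne, decide_true, Bool.true_and, if_false, if_true]
    exact card_between_left (h.balance c hc c' hc') (h.le c' hc' c hc) ha
  · simp only [cellAdj, hc, decide_true, Bool.true_and, if_true]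
    exact card_within (h.lt c hc) (h.even c hc) ha
  · simp only [cellAdj, hc, hc', hlt.not_gt, hlt.ne', decide_true, Bool.true_and, if_false]
    exact card_between_right (h.balance c' hc' c hc) (h.le c hc c' hc') ha

/-! ### Finding the sizes of the classes -/

/-- The size `f c` of the class `c` is too small. -/
def tooSmall (m : ℕ) (d : ℕ → ℕ → ℕ) (f : ℕ → ℕ) (c : ℕ) : Bool :=
  ((List.range m).any fun c' =>
    decide (f c * d c c' < f c' * d c' c) || decide (f c < d c' c)) ||
  (decide (f c ≤ d c c) || decide ((f c * d c c) % 2 = 1))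

theorem tooSmall_iff {m : ℕ} {d : ℕ → ℕ → ℕ} {f : ℕ → ℕ} {c : ℕ} : tooSmall m d f c = true ↔
    (∃ c' < m, f c * d c c' < f c' * d c' c ∨ f c < d c' c) ∨
      f c ≤ d c c ∨ (f c * d c c) % 2 = 1 := by
  simp [tooSmall]

/-- `tooSmall` tests only one of the two inequalities behind each balance equation; the other one is
the test for the partner class. -/
theorem admissible_of_not_tooSmall {m : ℕ} {d : ℕ → ℕ → ℕ} {f : ℕ → ℕ}
    (h : ∀ c < m, tooSmall m d f c = false) : Admissible m d f := by
  have h' : ∀ c < m, (∀ c' < m, f c' * d c' c ≤ f c * d c c' ∧ d c' c ≤ f c) ∧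
      d c c < f c ∧ (f c * d c c) % 2 = 0 := by
    intro c hc
    have := h c hc
    rw [← Bool.not_eq_true, tooSmall_iff] at this
    push Not at this
    exact ⟨this.1, this.2.1, by omega⟩
  exact ⟨fun c hc c' hc' => le_antisymm ((h' c' hc').1 c hc).1 ((h' c hc).1 c' hc').1,
    fun c hc c' hc' => ((h' c hc).1 c' hc').2, fun c hc => (h' c hc).2.1,
    fun c hc => (h' c hc).2.2⟩

/-- If `f c` had already reached `g c`, any reason for being too small would persist when the other
sizes are raised to those of `g`, against the admissibility of `g`. -/
theorem Admissible.lt_of_tooSmall {m : ℕ} {d : ℕ → ℕ → ℕ} {f g : ℕ → ℕ} (hg : Admissible m d g)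
    (hfg : ∀ c < m, f c ≤ g c) {c : ℕ} (hc : c < m) (h : tooSmall m d f c = true) : f c < g c := by
  refine lt_of_le_of_ne (hfg c hc) fun e => ?_
  rw [tooSmall_iff, e] at h
  rcases h with ⟨c', hc', h | h⟩ | h | h
  · rw [hg.balance c hc c' hc'] at h
    exact absurd (Nat.mul_le_mul_right _ (hfg c' hc')) (not_le.2 h)
  · exact absurd (hg.le c hc c' hc') (not_le.2 h)
  · exact absurd (hg.lt c hc) (not_lt.2 h)
  · have := hg.even c hc
    omega

/-- Increase all sizes that are too small. -/
def growStep (m : ℕ) (d : ℕ → ℕ → ℕ) (N : List ℕ) : List ℕ :=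
  (List.range m).map fun c =>
    bif tooSmall m d (fun c => N.getD c 0) c then N.getD c 0 + 1 else N.getD c 0

/-- The sizes after `n` rounds of increasing, beginning with `1`. -/
def classSizes (m : ℕ) (d : ℕ → ℕ → ℕ) (n : ℕ) : List ℕ :=
  (List.range n).foldl (fun N _ => growStep m d N) ((List.range m).map fun _ => 1)

theorem classSizes_succ (m : ℕ) (d : ℕ → ℕ → ℕ) (n : ℕ) :
    classSizes m d (n + 1) = growStep m d (classSizes m d n) := by
  simp [classSizes, List.range_succ]

theorem getD_growStep {m : ℕ} {d : ℕ → ℕ → ℕ} {N : List ℕ} {c : ℕ} (hc : c < m) :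
    (growStep m d N).getD c 0 =
      bif tooSmall m d (fun c => N.getD c 0) c then N.getD c 0 + 1 else N.getD c 0 := by
  rw [growStep, List.getD_eq_getElem _ _ (by simpa using hc), List.getElem_map, List.getElem_range]

theorem Admissible.classSizes_le {m : ℕ} {d : ℕ → ℕ → ℕ} {g : ℕ → ℕ} (hg : Admissible m d g)
    (n : ℕ) {c : ℕ} (hc : c < m) : (classSizes m d n).getD c 0 ≤ g c := by
  induction n generalizing c with
  | zero =>
    have := hg.lt c hc
    rw [classSizes, List.range_zero, List.foldl_nil, List.getD_eq_getElem _ _ (by simpa using hc),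
      List.getElem_map]
    omega
  | succ n ih =>
    rw [classSizes_succ, getD_growStep hc]
    cases h : tooSmall m d (fun c => (classSizes m d n).getD c 0) c
    · exact ih hc
    · exact hg.lt_of_tooSmall (fun c hc => ih hc) hc h

theorem Admissible.classSizes {m : ℕ} {d : ℕ → ℕ → ℕ} {g : ℕ → ℕ} (hg : Admissible m d g) {n : ℕ}
    (hn : ∑ c ∈ Finset.range m, g c ≤ n) :
    Admissible m d fun c => (classSizes m d n).getD c 0 := by
  have hfix : ∀ i, (∀ c < m, tooSmall m d (fun c => (MsgPass.classSizes m d i).getD c 0) c = false) →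
      ∀ c < m, (MsgPass.classSizes m d (i + 1)).getD c 0 = (MsgPass.classSizes m d i).getD c 0 := by
    intro i h c hc
    rw [classSizes_succ, getD_growStep hc, h c hc, cond_false]
  have hcongr : ∀ f f' : ℕ → ℕ, (∀ c < m, f c = f' c) → ∀ c < m,
      tooSmall m d f c = tooSmall m d f' c := by
    intro f f' h c hc
    rw [Bool.eq_iff_iff, tooSmall_iff, tooSmall_iff, h c hc]
    have : ∀ c', (c' < m ∧ (f' c * d c c' < f c' * d c' c ∨ f' c < d c' c)) ↔
        (c' < m ∧ (f' c * d c c' < f' c' * d c' c ∨ f' c < d c' c)) := by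
      intro c'
      refine and_congr_right fun hc' => ?_
      rw [h c' hc']
    simp only [this]
  refine admissible_of_not_tooSmall (persistent_of_bounded (n := n + 1)
    (P := fun i => ∀ c < m, tooSmall m d (fun c => (MsgPass.classSizes m d i).getD c 0) c = false)
    -- The total size grows in every round with a class that is too small, and never exceeds that of
    -- the given solution. The `+ 1` makes the initial value positive even for `m = 0`.
    (g := fun i => ∑ c ∈ Finset.range m, (MsgPass.classSizes m d i).getD c 0 + 1)
    (by omega) ?_ ?_ ?_ (by omega))
  · intro i
    have := Finset.sum_le_sum fun c (hc : c ∈ Finset.range m) =>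
      hg.classSizes_le i (Finset.mem_range.1 hc)
    omega
  · intro i h
    push Not at h
    obtain ⟨c, hc, h⟩ := h
    refine Nat.add_lt_add_right (Finset.sum_lt_sum (fun c hc => ?_)
      ⟨c, Finset.mem_range.2 hc, ?_⟩) 1
    · rw [classSizes_succ, getD_growStep (Finset.mem_range.1 hc)]
      cases tooSmall m d (fun c => (MsgPass.classSizes m d i).getD c 0) c <;> simp
    · rw [classSizes_succ, getD_growStep hc, Bool.ne_false_iff.1 h]
      simp
  · intro i h c hc
    rw [hcongr _ _ (hfix i h) c hc]
    exact h c hc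

end MsgPass

namespace MsgPass

/-! ### Equitable partitions -/

/-- A partition of a set of vertices closed under adjacency into `m` classes such that every vertex
of class `c` has `d c c'` neighbours in class `c'`. -/
structure EquitablePartition (G : FeaturedGraph) where
  domain : Fin G.order → Prop
  index : Fin G.order → ℕ
  m : ℕ
  d : ℕ → ℕ → ℕ
  closed : ∀ y z, domain y → G.graph.Adj y z → domain z
  index_lt : ∀ y, domain y → index y < m
  exists_index_eq : ∀ c < m, ∃ y, domain y ∧ index y = c
  mpc_eq : ∀ y z, domain y → domain z → index y = index z → ∀ t, mpc G t y = mpc G t z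
  degree : ∀ y, domain y → ∀ c < m, Nat.card {z // G.graph.Adj y z ∧ index z = c} = d (index y) c

namespace EquitablePartition

variable {G : FeaturedGraph} (P : EquitablePartition G)

/-- The number of vertices in a class. -/
noncomputable def size (c : ℕ) : ℕ := Nat.card {y // P.domain y ∧ P.index y = c}

open Classical in
theorem size_eq (c : ℕ) :
    P.size c = (Finset.univ.filter fun y => P.domain y ∧ P.index y = c).card := by
  rw [size, Nat.card_eq_fintype_card, Fintype.card_subtype]

open Classical in
theorem degree_eq {y : Fin G.order} (hy : P.domain y) {c : ℕ} (hc : c < P.m) :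
    (Finset.univ.filter fun z => G.graph.Adj y z ∧ P.index z = c).card = P.d (P.index y) c := by
  rw [← P.degree y hy c hc, Nat.card_eq_fintype_card, Fintype.card_subtype]

theorem sum_size_le : ∑ c ∈ Finset.range P.m, P.size c ≤ G.order := by
  classical
  have h := Finset.card_eq_sum_card_fiberwise (f := P.index) (t := Finset.range P.m)
    (s := Finset.univ.filter P.domain) (fun y hy => by simpa using P.index_lt y (by simpa using hy))
  have h2 : (Finset.univ.filter P.domain).card ≤ G.order :=
    (Finset.card_le_univ _).trans (by simp)
  simp only [Finset.filter_filter, ← size_eq] at h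
  omega

theorem admissible : Admissible P.m P.d P.size := by
  classical
  refine ⟨fun c hc c' hc' => ?_, fun c hc c' hc' => ?_, fun c hc => ?_, fun c hc => ?_⟩
  -- Double counting of the adjacent pairs between class `c` and class `c'`.
  · have h := Finset.sum_card_bipartiteAbove_eq_sum_card_bipartiteBelow
      (s := Finset.univ.filter fun y => P.domain y ∧ P.index y = c)
      (t := Finset.univ.filter fun y => P.domain y ∧ P.index y = c') G.graph.Adj
    rw [Finset.sum_const_nat (m := P.d c c'), Finset.sum_const_nat (m := P.d c' c)] at h
    · rw [size_eq, size_eq, h]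
    · intro z hz
      simp only [Finset.mem_filter, Finset.mem_univ, true_and] at hz
      rw [← hz.2, ← P.degree_eq hz.1 hc, Finset.bipartiteBelow, Finset.filter_filter]
      congr 1
      ext y
      simp only [Finset.mem_filter, Finset.mem_univ, true_and]
      exact ⟨fun h => ⟨h.2.symm, h.1.2⟩, fun h => ⟨⟨P.closed z y hz.1 h.1, h.2⟩, h.1.symm⟩⟩
    · intro z hz
      simp only [Finset.mem_filter, Finset.mem_univ, true_and] at hz
      rw [← hz.2, ← P.degree_eq hz.1 hc', Finset.bipartiteAbove, Finset.filter_filter]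
      congr 1
      ext y
      simp only [Finset.mem_filter, Finset.mem_univ, true_and]
      exact ⟨fun h => ⟨h.2, h.1.2⟩, fun h => ⟨⟨P.closed z y hz.1 h.1, h.2⟩, h.1⟩⟩
  · obtain ⟨y, hy, rfl⟩ := P.exists_index_eq c' hc'
    rw [← P.degree_eq hy hc, size_eq]
    refine Finset.card_le_card fun z hz => ?_
    simp only [Finset.mem_filter, Finset.mem_univ, true_and] at hz ⊢
    exact ⟨P.closed y z hy hz.1, hz.2⟩
  · obtain ⟨y, hy, rfl⟩ := P.exists_index_eq c hc
    rw [← P.degree_eq hy hc, size_eq]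
    refine Finset.card_lt_card (Finset.ssubset_iff_of_subset (fun z hz => ?_) |>.2 ⟨y, ?_, ?_⟩)
    · simp only [Finset.mem_filter, Finset.mem_univ, true_and] at hz ⊢
      exact ⟨P.closed y z hy hz.1, hz.2⟩
    · simpa using hy
    · simp
  -- The edges inside class `c`: by the handshake lemma the degree sum, size times `d c c`, is even.
  · let G' : SimpleGraph (Fin G.order) :=
      { Adj := fun y z => G.graph.Adj y z ∧ (P.domain y ∧ P.index y = c) ∧
          (P.domain z ∧ P.index z = c)
        symm := ⟨fun y z h => ⟨h.1.symm, h.2.2, h.2.1⟩⟩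
        loopless := ⟨fun y h => G.graph.loopless.irrefl y h.1⟩ }
    have h := G'.sum_degrees_eq_twice_card_edges
    have h1 : ∑ y, G'.degree y = ∑ y ∈ Finset.univ.filter (fun y => P.domain y ∧ P.index y = c),
        P.d c c := by
      rw [Finset.sum_filter]
      refine Finset.sum_congr rfl fun y _ => ?_
      split_ifs with hy
      · have := P.degree_eq hy.1 hc
        rw [hy.2] at this
        rw [← this, ← SimpleGraph.card_neighborFinset_eq_degree]
        congr 1
        ext z
        simp only [SimpleGraph.mem_neighborFinset, Finset.mem_filter, Finset.mem_univ, true_and, G']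
        exact ⟨fun h => ⟨h.1, h.2.2.2⟩, fun h => ⟨h.1, hy, P.closed y z hy.1 h.1, h.2⟩⟩
      · rw [← SimpleGraph.card_neighborFinset_eq_degree, Finset.card_eq_zero]
        ext z
        simp only [SimpleGraph.mem_neighborFinset, Finset.notMem_empty, iff_false, G']
        exact fun h => hy h.2.1
    rw [Finset.sum_const, smul_eq_mul, ← size_eq] at h1
    omega

end EquitablePartition

/-! ### Realizing an equitable partition -/

theorem sum_map_range {M : Type*} [AddCommMonoid M] (m : ℕ) (g : ℕ → M) :
    ((List.range m).map g).sum = ∑ i ∈ Finset.range m, g i := by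
  induction m with
  | zero => rfl
  | succ m ih =>
    rw [List.range_succ, List.map_append, List.sum_append, ih, Finset.sum_range_succ]
    simp

/-- The vertices `(c, a)` with `c < m` and `a < f c`. -/
def blockCells (m : ℕ) (f : ℕ → ℕ) : List (ℕ × ℕ) :=
  (List.range m).flatMap fun c => (List.range (f c)).map fun a => (c, a)

/-- The vertices `(c, a)` with `c < m` and `a < f c`, and further vertices `(m, j)` to get `n`. -/
def cells (m : ℕ) (f : ℕ → ℕ) (n : ℕ) : List (ℕ × ℕ) :=
  blockCells m f ++ (List.range (n - (blockCells m f).length)).map fun j => (m, j)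

theorem length_blockCells (m : ℕ) (f : ℕ → ℕ) :
    (blockCells m f).length = ∑ c ∈ Finset.range m, f c := by
  simp [blockCells, List.length_flatMap, sum_map_range]

theorem length_cells {m : ℕ} {f : ℕ → ℕ} {n : ℕ} (h : ∑ c ∈ Finset.range m, f c ≤ n) :
    (cells m f n).length = n := by
  rw [cells, List.length_append, List.length_map, List.length_range, length_blockCells]
  omega

theorem mem_blockCells {m : ℕ} {f : ℕ → ℕ} {x : ℕ × ℕ} :
    x ∈ blockCells m f ↔ x.1 < m ∧ x.2 < f x.1 := by
  obtain ⟨c, a⟩ := x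
  simp only [blockCells, List.mem_flatMap, List.mem_range, List.mem_map, Prod.mk.injEq]
  constructor
  · rintro ⟨c, hc, a, ha, rfl, rfl⟩
    exact ⟨hc, ha⟩
  · rintro ⟨hc, ha⟩
    exact ⟨c, hc, a, ha, rfl, rfl⟩

theorem lt_of_mem_cells {m : ℕ} {f : ℕ → ℕ} {n : ℕ} {x : ℕ × ℕ} (h : x ∈ cells m f n)
    (hx : x.1 < m) : x.2 < f x.1 := by
  rcases List.mem_append.1 h with h | h
  · exact (mem_blockCells.1 h).2
  · obtain ⟨j, _, rfl⟩ := List.mem_map.1 h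
    exact absurd hx (lt_irrefl _)

theorem nodup_cells (m : ℕ) (f : ℕ → ℕ) (n : ℕ) : (cells m f n).Nodup := by
  refine List.nodup_append.2 ⟨?_, ?_, ?_⟩
  · refine List.nodup_flatMap.2 ⟨fun c _ => List.nodup_range.map fun a b h => by simpa using h, ?_⟩
    refine List.nodup_range.imp fun {c c'} hne => ?_
    simp only [Function.onFun, List.disjoint_left, List.mem_map]
    rintro x ⟨a, _, rfl⟩ ⟨b, _, h⟩
    exact hne (congrArg Prod.fst h).symm
  · exact List.nodup_range.map fun a b h => by simpa using h
  · rintro x hx y hy rfl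
    obtain ⟨j, _, rfl⟩ := List.mem_map.1 hy
    exact absurd (mem_blockCells.1 hx).1 (lt_irrefl _)

/-- The padding cells have first component `m`, so they belong to no class and do not affect the
count. -/
theorem length_filter_cells {m : ℕ} {f : ℕ → ℕ} {n : ℕ} {p : ℕ × ℕ → Bool} {c : ℕ} (hc : c < m) :
    ((cells m f n).filter fun y => p y && decide (y.1 = c)).length =
      ((List.range (f c)).filter fun b => p (c, b)).length := by
  rw [cells, blockCells, List.filter_append, List.length_append, List.filter_flatMap,
    List.length_flatMap, sum_map_range, Finset.sum_eq_single c]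
  · rw [List.filter_map, List.length_map, List.filter_map, List.length_map]
    have h1 : ((List.range (n - (List.flatMap (fun c => (List.range (f c)).map fun a => (c, a))
        (List.range m)).length)).filter ((fun y : ℕ × ℕ => p y && decide (y.1 = c)) ∘
          fun j => (m, j))) = [] := by
      rw [List.filter_eq_nil_iff]
      intro j _
      simp [hc.ne']
    rw [h1]
    simp [Function.comp_def]
  · intro c' _ hne
    rw [List.length_eq_zero_iff, List.filter_eq_nil_iff]
    rintro y hy
    obtain ⟨a, _, rfl⟩ := List.mem_map.1 hy
    simp [hne]
  · intro h
    exact absurd (Finset.mem_range.2 hc) h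

/-- The graph whose vertices are the pairs in the list `L`. -/
def cellGraph (m : ℕ) (d : ℕ → ℕ → ℕ) (f : ℕ → ℕ) (L : List (ℕ × ℕ)) (φ : ℕ → List Bool) :
    FeaturedGraph where
  order := L.length
  graph :=
    { Adj := fun i j => cellAdj m d f L[i] L[j] = true
      symm := ⟨fun i j h => by rwa [cellAdj_comm]⟩
      loopless := ⟨fun i h => by simp [cellAdj_self] at h⟩ }
  feature i := φ L[i].1

theorem map_val_eq_sum_fiberwise {ι X : Type*} (s : Finset ι) (κ : ι → ℕ) (m : ℕ)
    (h : ∀ z ∈ s, κ z < m) (col : ℕ → X) : s.val.map (fun z => col (κ z)) =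
      ∑ c ∈ Finset.range m, Multiset.replicate (s.filter fun z => κ z = c).card (col c) := by
  classical
  have h1 : s.val.map (fun z => col (κ z)) = ∑ z ∈ s, ({col (κ z)} : Multiset X) := by
    rw [Finset.sum, ← Multiset.sum_map_singleton (s.val.map fun z => col (κ z)), Multiset.map_map]
    rfl
  rw [h1, ← Finset.sum_fiberwise_of_maps_to (t := Finset.range m) (g := κ)
    (fun z hz => Finset.mem_range.2 (h z hz))]
  refine Finset.sum_congr rfl fun c _ => ?_
  rw [Finset.sum_congr rfl (g := fun _ => ({col c} : Multiset X)) fun z hz => by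
    rw [(Finset.mem_filter.1 hz).2], Finset.sum_const, Multiset.nsmul_singleton]

open Classical in
/-- A graph with the same degree matrix has the same message-passing colours. -/
theorem EquitablePartition.mpc_eq_mpc {G : FeaturedGraph} (P : EquitablePartition G)
    {H : FeaturedGraph} {κ : Fin H.order → ℕ} (hadj : ∀ i j, H.graph.Adj i j → κ j < P.m)
    (hdeg : ∀ i, κ i < P.m → ∀ c < P.m,
      (Finset.univ.filter fun j => H.graph.Adj i j ∧ κ j = c).card = P.d (κ i) c)
    (hfeat : ∀ i y, P.domain y → κ i = P.index y → H.feature i = G.feature y) (t : ℕ)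
    {y : Fin G.order} (hy : P.domain y) (i : Fin H.order) (hi : κ i = P.index y) :
    mpc H t i = mpc G t y := by
  induction t generalizing y i with
  | zero => exact hfeat i y hy hi
  | succ t ih =>
    rw [mpc_succ, mpc_succ, ih hy i hi]
    refine congrArg (Prod.mk _) ?_
    -- The colour is a function of the class. Both neighbour multisets are then determined by how
    -- many neighbours lie in each class. The value at unoccupied indices is irrelevant.
    obtain ⟨col, hcol⟩ : ∃ col : ℕ → Color t, ∀ z, P.domain z → mpc G t z = col (P.index z) := by
      refine ⟨fun c => if h : ∃ z, P.domain z ∧ P.index z = c then mpc G t h.choose else mpc G t y,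
        fun z hz => ?_⟩
      have h : ∃ w, P.domain w ∧ P.index w = P.index z := ⟨z, hz, rfl⟩
      simp only [h, dite_true]
      exact P.mpc_eq z _ hz h.choose_spec.1 h.choose_spec.2.symm t
    have h1 : (Finset.univ.filter (H.graph.Adj i)).val.map (mpc H t) =
        (Finset.univ.filter (H.graph.Adj i)).val.map fun j => col (κ j) := by
      refine Multiset.map_congr rfl fun j hj => ?_
      obtain ⟨z, hz, hzj⟩ := P.exists_index_eq _ (hadj i j (by simpa using hj))
      rw [ih hz j hzj.symm, hcol z hz, hzj]
    have h2 : (Finset.univ.filter (G.graph.Adj y)).val.map (mpc G t) =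
        (Finset.univ.filter (G.graph.Adj y)).val.map fun z => col (P.index z) := by
      refine Multiset.map_congr rfl fun z hz => hcol z (P.closed y z hy ?_)
      simpa using hz
    rw [h1, h2, map_val_eq_sum_fiberwise _ _ P.m fun z hz => P.index_lt z (P.closed y z hy
      (by simpa using hz)), map_val_eq_sum_fiberwise _ κ P.m
      fun j hj => hadj i j (by simpa using hj)]
    refine Finset.sum_congr rfl fun c hc => ?_
    have hc := Finset.mem_range.1 hc
    congr 1
    rw [Finset.filter_filter, Finset.filter_filter, P.degree_eq hy hc,
      hdeg i (hi ▸ P.index_lt y hy) c hc, hi]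

theorem card_filter_getElem {X : Type*} (L : List X) (p : X → Bool) :
    (Finset.univ.filter fun j : Fin L.length => p L[j] = true).card = (L.filter p).length := by
  rw [← List.countP_eq_length_filter]
  conv_rhs => rw [← List.map_getElem_finRange L, List.countP_map,
    List.countP_eq_length_filter, ← List.toFinset_card_of_nodup ((List.nodup_finRange _).filter _)]
  congr 1
  ext j
  simp

/-- A realization of the degree matrix has the same message-passing colours. -/
theorem EquitablePartition.mpc_cellGraph {G : FeaturedGraph} (P : EquitablePartition G)
    {f : ℕ → ℕ} (hf : Admissible P.m P.d f) {n : ℕ} {φ : ℕ → List Bool}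
    (hφ : ∀ y, P.domain y → φ (P.index y) = G.feature y) (t : ℕ) {y : Fin G.order}
    (hy : P.domain y) (i : Fin (cells P.m f n).length) (hi : (cells P.m f n)[i].1 = P.index y) :
    mpc (cellGraph P.m P.d f (cells P.m f n) φ) t i = mpc G t y := by
  classical
  refine P.mpc_eq_mpc (H := cellGraph P.m P.d f (cells P.m f n) φ)
    (κ := fun j : Fin (cells P.m f n).length => (cells P.m f n)[j].1) ?_ ?_ ?_ t hy i hi
  · intro i j h
    have h : cellAdj P.m P.d f (cells P.m f n)[i] (cells P.m f n)[j] = true := h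
    simp only [cellAdj, Bool.and_eq_true, decide_eq_true_eq] at h
    exact h.2.1
  · intro (i : Fin (cells P.m f n).length) him c hc
    have h := (length_filter_cells (n := n) (p := cellAdj P.m P.d f (cells P.m f n)[i]) hc).trans
      (hf.card_cellAdj him (lt_of_mem_cells (List.getElem_mem _) him) hc)
    refine Eq.trans ?_ h
    rw [← card_filter_getElem]
    refine congrArg Finset.card (Finset.ext fun j => Finset.mem_filter.trans
      (Iff.trans (and_congr Iff.rfl ?_) Finset.mem_filter.symm))
    rw [Bool.and_eq_true, decide_eq_true_eq]
    exact Iff.rfl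
  · intro i y hy hi
    exact (congrArg φ hi).trans (hφ y hy)

end MsgPass

namespace MsgPass

open TreeRep

/-! ### Computing a graph from the dag -/

/-- The list of labels (in unary) of the edges from `p` to `q`. -/
def labelsAt (M : List (List (List (List Bool)))) (p q : ℕ) : List (List Bool) :=
  (M.getD p []).getD q []

/-- The sum of the labels of the edges from `p` to `q`. -/
def multiplicity (M : List (List (List (List Bool)))) (p q : ℕ) : ℕ :=
  (labelsAt M p q).flatten.length

/-- The target of the edge from `p` with label `0`. -/
def prevIndex (M : List (List (List (List Bool)))) (p : ℕ) : ℕ :=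
  ((List.range (M.getD p []).length).filter fun q =>
    (labelsAt M p q).any fun b => decide (b.length = 0)).headD 0

/-- The node reached from the node `p` on level `j` by `k` edges with label `0`. -/
def descend (Ms : List (List (List (List (List Bool))))) (j k p : ℕ) : ℕ :=
  (List.range k).foldl (fun p s => prevIndex (Ms.getD (j - 1 - s) []) p) p

/-- The number of neighbours in the class `c'` of a vertex in the class `c`. -/
def degreeOf (M : List (List (List (List Bool)))) (c c' : ℕ) : ℕ :=
  multiplicity M c (prevIndex M c')

/-- Recovers the order `n` of the graph from the `2n` matrices of the dag. Written as a count, it is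
visibly polynomial-time. -/
def half (n : ℕ) : ℕ := ((List.range n).filter fun j => decide (2 * j + 1 < n)).length

/-- The string for a graph with given cells. -/
def cellString (L : List (ℕ × ℕ)) (r m : ℕ) (M : List (List (List (List Bool)))) (N : List ℕ)
    (φ : ℕ → List Bool) : List Sym :=
  encodeList
    [ encodeBits (L.map fun x => decide (x.1 = r) && decide (x.2 = 0)),
      encodeList (L.map fun x => encodeBits (φ x.1)),
      encodeList (L.map fun x =>
        encodeBits (L.map fun y => cellAdj m (degreeOf M) (fun c => N.getD c 0) x y)) ]

/-- The feature of the vertices of a class. -/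
def classFeature (B : List (List Bool)) (Ms : List (List (List (List (List Bool))))) (n c : ℕ) :
    List Bool :=
  B.getD (descend Ms (n + 1) (n + 1) c) []

/-- The sizes of the classes. -/
def sizeList (M : List (List (List (List Bool)))) (n : ℕ) : List ℕ :=
  classSizes M.length (degreeOf M) n

/-- The string for a rooted graph of order `n`, computed from the data of the dag of the final
colour of the root, where `M` belongs to the edges from level `n + 1` to level `n`. -/
def realizationString (B : List (List Bool)) (Ms : List (List (List (List (List Bool)))))
    (M : List (List (List (List Bool)))) (n : ℕ) : List Sym :=
  cellString (cells M.length (fun c => (sizeList M n).getD c 0) n)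
    (descend Ms (2 * n) (n - 1) 0) M.length M (sizeList M n) (classFeature B Ms n)

/-- The string for a rooted graph, computed from the data of the dag of the final colour. -/
def graphString (I : List (List Bool) × List (List (List (List (List Bool)))) × Unit) : List Sym :=
  realizationString I.1 I.2.1 (I.2.1.getD (half I.2.1.length) []) (half I.2.1.length)

section PolyTime

variable {α : Type} [TreeRep α]

@[fun_prop]
theorem polyTime_mod_two {f : α → ℕ} (hf : PolyTime f) : PolyTime (fun a => f a % 2) := by
  have : PolyTime (fun a =>
      bif (List.range (f a)).any fun j => decide (2 * j + 1 = f a) then 1 else 0) :=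
    .cond (by fun_prop) (by fun_prop) (by fun_prop)
  convert this using 2 with a
  rcases Nat.mod_two_eq_zero_or_one (f a) with h | h
  · have : ((List.range (f a)).any fun j => decide (2 * j + 1 = f a)) = false := by
      simp only [List.any_eq_false, decide_eq_true_eq]
      intro j _
      omega
    rw [h, this]; rfl
  · have : ((List.range (f a)).any fun j => decide (2 * j + 1 = f a)) = true := by
      simp only [List.any_eq_true, List.mem_range, decide_eq_true_eq]
      exact ⟨f a / 2, by omega, by omega⟩
    rw [h, this]; rfl

@[fun_prop]
theorem polyTime_decide_ne {f g : α → ℕ} (hf : PolyTime f) (hg : PolyTime g) :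
    PolyTime (fun a => decide (f a ≠ g a)) := by
  have : PolyTime (fun a => !decide (f a = g a)) := by fun_prop
  convert this using 2 with a
  simp

@[fun_prop]
theorem polyTime_labelsAt {M : α → List (List (List (List Bool)))} {p q : α → ℕ} (hM : PolyTime M)
    (hp : PolyTime p) (hq : PolyTime q) : PolyTime (fun a => labelsAt (M a) (p a) (q a)) := by
  unfold labelsAt; fun_prop

@[fun_prop]
theorem polyTime_prevIndex {M : α → List (List (List (List Bool)))} {p : α → ℕ} (hM : PolyTime M)
    (hp : PolyTime p) : PolyTime (fun a => prevIndex (M a) (p a)) := by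
  unfold prevIndex; fun_prop

@[fun_prop]
theorem polyTime_degreeOf {M : α → List (List (List (List Bool)))} {p q : α → ℕ} (hM : PolyTime M)
    (hp : PolyTime p) (hq : PolyTime q) : PolyTime (fun a => degreeOf (M a) (p a) (q a)) := by
  unfold degreeOf multiplicity; fun_prop

theorem rsize_getD_le {β : Type} [TreeRep β] (l : List β) (i : ℕ) (d : β) :
    rsize (l.getD i d) ≤ rsize l + rsize d := by
  by_cases h : i < l.length
  · rw [List.getD_eq_getElem _ _ h]
    exact le_add_right (rsize_le_of_mem (List.getElem_mem h))
  · rw [List.getD_eq_default _ _ (by omega)]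
    omega

theorem headD_filter_range_le (n : ℕ) (f : ℕ → Bool) : ((List.range n).filter f).headD 0 ≤ n := by
  cases h : (List.range n).filter f with
  | nil => simp
  | cons x l =>
    have : x ∈ (List.range n).filter f := by simp [h]
    exact (List.mem_range.1 (List.mem_filter.1 this).1).le

@[fun_prop]
theorem polyTime_descend {Ms : α → List (List (List (List (List Bool))))} {j k p : α → ℕ}
    (hMs : PolyTime Ms) (hj : PolyTime j) (hk : PolyTime k) (hp : PolyTime p) :
    PolyTime (fun a => descend (Ms a) (j a) (k a) (p a)) := by
  unfold descend
  obtain ⟨q, hq⟩ := hMs.exists_rsize_le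
  refine .foldl_of_add_le (by fun_prop) hp (by fun_prop) ⟨q + 2, fun a s _ t => ?_⟩
  have h1 := headD_filter_range_le (((Ms a).getD (j a - 1 - s) []).getD t []).length fun q =>
    (labelsAt ((Ms a).getD (j a - 1 - s) []) t q).any fun b => decide (b.length = 0)
  have h2 := length_le_rsize (((Ms a).getD (j a - 1 - s) []).getD t [])
  have h3 := rsize_getD_le ((Ms a).getD (j a - 1 - s) []) t []
  have h4 := rsize_getD_le (Ms a) (j a - 1 - s) []
  have h5 := hq a
  rw [rsize_nil] at h3 h4
  rw [rsize_nat, prevIndex]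
  simp only [Polynomial.eval_add, Polynomial.eval_ofNat]
  omega

@[fun_prop]
theorem polyTime_tooSmall {M : α → List (List (List (List Bool)))} {N : α → List ℕ} {c : α → ℕ}
    (hM : PolyTime M) (hN : PolyTime N) (hc : PolyTime c) :
    PolyTime (fun a => tooSmall (M a).length (degreeOf (M a)) (fun c => (N a).getD c 0) (c a)) := by
  have hf : PolyTime (fun x : α × ℕ => (N x.1).getD (c x.1) 0) := by fun_prop
  have hf' : PolyTime (fun x : α × ℕ => (N x.1).getD x.2 0) := by fun_prop
  have hd : PolyTime (fun x : α × ℕ => degreeOf (M x.1) (c x.1) x.2) := by fun_prop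
  have hd' : PolyTime (fun x : α × ℕ => degreeOf (M x.1) x.2 (c x.1)) := by fun_prop
  have hg : PolyTime (fun a => (N a).getD (c a) 0) := by fun_prop
  have hh : PolyTime (fun a => degreeOf (M a) (c a) (c a)) := by fun_prop
  unfold tooSmall
  exact .or (.any (by fun_prop) (.or (.decide_lt (.mul hf hd) (.mul hf' hd')) (.decide_lt hf hd')))
    (.or (.decide_le hg hh) (.decide_eq (polyTime_mod_two (.mul hg hh)) (.const 1)))

theorem length_classSizes (m : ℕ) (d : ℕ → ℕ → ℕ) (n : ℕ) : (classSizes m d n).length = m := by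
  cases n with
  | zero => simp [classSizes]
  | succ n => simp [classSizes_succ, growStep]

theorem classSizes_le (m : ℕ) (d : ℕ → ℕ → ℕ) (n : ℕ) : ∀ x ∈ classSizes m d n, x ≤ n + 1 := by
  induction n with
  | zero => simp [classSizes]
  | succ n ih =>
    rw [classSizes_succ]
    intro x hx
    obtain ⟨c, hc, rfl⟩ := List.mem_map.1 hx
    have h1 : (classSizes m d n).getD c 0 ≤ n + 1 := by
      rw [List.getD_eq_getElem _ _ (by rw [length_classSizes]; exact List.mem_range.1 hc)]
      exact ih _ (List.getElem_mem _)
    cases tooSmall m d (fun c => (classSizes m d n).getD c 0) c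
    · simp only [cond_false]; omega
    · simp only [cond_true]; omega

@[fun_prop]
theorem polyTime_sizeList {M : α → List (List (List (List Bool)))} {n : α → ℕ} (hM : PolyTime M)
    (hn : PolyTime n) : PolyTime (fun a => sizeList (M a) (n a)) := by
  unfold sizeList classSizes
  obtain ⟨p, hp⟩ := hM.exists_rsize_le
  obtain ⟨q, hq⟩ := hn.exists_rsize_le
  refine .foldl (by fun_prop) (by fun_prop) ?_ ⟨p * (2 * q + 4) + 1, fun a i hi => ?_⟩
  · unfold growStep
    exact .map (by fun_prop) (.cond (by fun_prop) (by fun_prop) (by fun_prop))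
  · rw [List.length_range] at hi
    rw [List.take_range, Nat.min_eq_left hi]
    have h1 := rsize_list_le (l := classSizes (M a).length (degreeOf (M a)) i) (B := 2 * i + 3)
      fun x hx => by
        have := classSizes_le _ _ _ x hx
        rw [rsize_nat]; omega
    have h2 := hp a
    have h3 := hq a
    have h4 := length_le_rsize (M a)
    rw [rsize_nat] at h3
    rw [length_classSizes] at h1
    have h5 : (M a).length * (2 * i + 3 + 1) ≤ p.eval (rsize a) * (2 * q.eval (rsize a) + 4) :=
      Nat.mul_le_mul (by omega) (by omega)
    simp only [Polynomial.eval_add, Polynomial.eval_mul, Polynomial.eval_ofNat, Polynomial.eval_one]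
    exact h1.trans (by omega)

@[fun_prop]
theorem polyTime_cells {m n : α → ℕ} {N : α → List ℕ} (hm : PolyTime m) (hn : PolyTime n)
    (hN : PolyTime N) : PolyTime (fun a => cells (m a) (fun c => (N a).getD c 0) (n a)) := by
  unfold cells blockCells
  fun_prop

theorem polyTime_within {N d x y : α → ℕ} (hN : PolyTime N) (hd : PolyTime d) (hx : PolyTime x)
    (hy : PolyTime y) : PolyTime (fun a => within (N a) (d a) (x a) (y a)) := by
  have h : PolyTime (fun a => x a - y a + (y a - x a)) := .add (.sub hx hy) (.sub hy hx)
  have h2 : PolyTime (fun a => 2 * (x a - y a + (y a - x a))) := .mul (.const 2) h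
  unfold within
  exact .and (polyTime_decide_ne h (.const 0)) (.or (.decide_le h2 hd)
    (.or (.decide_le (.mul (.const 2) (.sub hN h)) hd)
      (.and (.decide_eq h2 hN) (.decide_eq (polyTime_mod_two hd) (.const 1)))))

theorem polyTime_between {d e N x y : α → ℕ} (hd : PolyTime d) (he : PolyTime e) (hN : PolyTime N)
    (hx : PolyTime x) (hy : PolyTime y) :
    PolyTime (fun a => between (d a) (e a) (N a) (x a) (y a)) := by
  have h1 : PolyTime (fun z : α × ℕ => x z.1 * d z.1) := by fun_prop
  have h2 : PolyTime (fun z : α × ℕ => y z.1 + z.2 * N z.1) := by fun_prop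
  have h3 : PolyTime (fun z : α × ℕ => d z.1) := by fun_prop
  unfold between
  exact .any (by fun_prop) (.and (.decide_le h1 h2) (.decide_lt h2 (.add h1 h3)))

theorem polyTime_cellAdj {m : α → ℕ} {M : α → List (List (List (List Bool)))} {N : α → List ℕ}
    {x y : α → ℕ × ℕ} (hm : PolyTime m) (hM : PolyTime M) (hN : PolyTime N) (hx : PolyTime x)
    (hy : PolyTime y) : PolyTime (fun a =>
      cellAdj (m a) (degreeOf (M a)) (fun c => (N a).getD c 0) (x a) (y a)) := by
  have hx1 : PolyTime (fun a => (x a).1) := by fun_prop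
  have hx2 : PolyTime (fun a => (x a).2) := by fun_prop
  have hy1 : PolyTime (fun a => (y a).1) := by fun_prop
  have hy2 : PolyTime (fun a => (y a).2) := by fun_prop
  unfold cellAdj
  exact .and (.decide_lt hx1 hm) (.and (.decide_lt hy1 hm) (.ite (.decide_eq hx1 hy1)
    (polyTime_within (.getD hN hx1 (.const 0)) (polyTime_degreeOf hM hx1 hx1) hx2 hy2)
    (.ite (.decide_lt hx1 hy1)
      (polyTime_between (polyTime_degreeOf hM hx1 hy1) (polyTime_degreeOf hM hy1 hx1)
        (.getD hN hy1 (.const 0)) hx2 hy2)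
      (polyTime_between (polyTime_degreeOf hM hy1 hx1) (polyTime_degreeOf hM hx1 hy1)
        (.getD hN hx1 (.const 0)) hy2 hx2))))

theorem polyTime_realizationString {B : α → List (List Bool)}
    {Ms : α → List (List (List (List (List Bool))))} {M : α → List (List (List (List Bool)))}
    {n : α → ℕ} (hB : PolyTime B) (hMs : PolyTime Ms) (hM : PolyTime M) (hn : PolyTime n) :
    PolyTime (fun a => realizationString (B a) (Ms a) (M a) (n a)) := by
  unfold realizationString cellString classFeature
  refine .encodeList (.cons (.encodeBits (by fun_prop)) (.cons (.encodeList (.map (by fun_prop)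
    (.encodeBits (by fun_prop)))) (.cons (.encodeList (.map (by fun_prop) (.encodeBits
      (.map (by fun_prop) (polyTime_cellAdj ?_ ?_ ?_ ?_ ?_))))) (by fun_prop)))) <;> fun_prop

theorem polyTime_graphString : PolyTime graphString := by
  unfold graphString half
  apply polyTime_realizationString <;> fun_prop

end PolyTime

end MsgPass

namespace MsgPass

open TreeRep

/-! ### The data of the dag of a colour -/

section DagData

variable {G : FeaturedGraph} {v : Fin G.order} {t : ℕ} (N : Numbering (colorDag (mpc G t v)))

/-- The matrix of the edge labels (in unary) from level `i + 1` to level `i`. -/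
noncomputable def levelMatrix (i : ℕ) : List (List (List (List Bool))) :=
  List.ofFn fun p => List.ofFn fun q =>
    (((colorDag (mpc G t v)).edgeLabels i ((N.num (i + 1)).symm p) ((N.num i).symm q)).sort
      (· ≤ ·)).map fun l => List.replicate l true

/-- The leaf labels and the matrices of the edge labels. -/
noncomputable def dagData : List (List Bool) × List (List (List (List (List Bool)))) × Unit :=
  (List.ofFn fun q => (colorDag (mpc G t v)).leafLabel ((N.num 0).symm q),
    (List.range t).map (levelMatrix N), ())

theorem represents_encodeDag : Represents (encodeDag (colorDag (mpc G t v)) N) (dagData N) := by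
  refine represents_encodeList_pair ?_ (represents_encodeList fun i _ => ?_)
  · rw [List.ofFn_eq_map, List.ofFn_eq_map]
    exact represents_encodeList fun q _ => represents_encodeBits _
  · rw [levelMatrix, List.ofFn_eq_map, List.ofFn_eq_map]
    refine represents_encodeList fun p _ => ?_
    rw [List.ofFn_eq_map, List.ofFn_eq_map]
    refine represents_encodeList fun q _ => ?_
    exact represents_encodeList fun l _ => represents_encodeNat l

theorem length_levelMatrix (i : ℕ) : (levelMatrix N i).length = N.width (i + 1) := by
  simp [levelMatrix]

theorem getD_ofFn {X : Type*} {n : ℕ} (f : Fin n → X) (i : Fin n) (d : X) :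
    (List.ofFn f).getD i d = f i := by
  rw [List.getD_eq_getElem _ _ (by simp)]
  simp

theorem labelsAt_levelMatrix {i : ℕ} (x : (colorDag (mpc G t v)).Node (i + 1))
    (y : (colorDag (mpc G t v)).Node i) :
    labelsAt (levelMatrix N i) (N.num (i + 1) x) (N.num i y) =
      (((colorDag (mpc G t v)).edgeLabels i x y).sort (· ≤ ·)).map
        fun l => List.replicate l true := by
  rw [labelsAt, levelMatrix, getD_ofFn, getD_ofFn, Equiv.symm_apply_apply, Equiv.symm_apply_apply]

/-- The label `0` contributes nothing to the sum, so the multiplicity can be read off even when both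
kinds of edges join the same two nodes. -/
theorem sum_edgeLabels {t i : ℕ} [DecidableEq (Color i)] (c : Color t)
    (x : (colorDag c).Node (i + 1)) (y : (colorDag c).Node i) :
    ∑ l ∈ (colorDag c).edgeLabels i x y, l = x.1.nbrs.count y.1 := by
  classical
  rw [edgeLabels_colorDag]
  by_cases h : y.1 ∈ x.1.nbrs
  · rw [if_pos h]
    split_ifs
    · rw [← Finset.insert_eq]
      refine (Finset.sum_insert_zero (f := fun l : ℕ => l) rfl).trans ?_
      rw [Finset.sum_singleton]
      congr!
    · rw [Finset.empty_union, Finset.sum_singleton]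
      congr!
  · rw [if_neg h, Multiset.count_eq_zero_of_notMem h]
    split_ifs <;> simp

/-- Multiplicities of actual elements are positive, so `0` identifies the edge to the first
component. -/
theorem zero_mem_edgeLabels {t i : ℕ} {c : Color t} {x : (colorDag c).Node (i + 1)}
    {y : (colorDag c).Node i} : 0 ∈ (colorDag c).edgeLabels i x y ↔ y.1 = x.1.prev := by
  classical
  rw [edgeLabels_colorDag, Finset.mem_union]
  constructor
  · rintro (h | h)
    · by_contra hn
      simp [hn] at h
    · split_ifs at h with hm
      · have := Multiset.count_pos.2 hm
        rw [Finset.mem_singleton] at h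
        omega
      · simp at h
  · intro h
    simp [h]

theorem multiplicity_levelMatrix {i : ℕ} [DecidableEq (Color i)]
    (x : (colorDag (mpc G t v)).Node (i + 1)) (y : (colorDag (mpc G t v)).Node i) :
    multiplicity (levelMatrix N i) (N.num (i + 1) x) (N.num i y) = x.1.nbrs.count y.1 := by
  rw [multiplicity, labelsAt_levelMatrix, List.length_flatten, List.map_map, ← sum_edgeLabels]
  have : (List.length ∘ fun l => List.replicate l true) = id := by
    funext l; simp
  rw [this, ← Finset.sum_map_toList, ← Multiset.sum_coe, ← Multiset.sum_coe]
  congr 1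
  simp

theorem headD_filter_range {n q : ℕ} {f : ℕ → Bool} (hq : q < n)
    (h : ∀ q' < n, f q' = true ↔ q' = q) : ((List.range n).filter f).headD 0 = q := by
  have hmem : ∀ x, x ∈ (List.range n).filter f ↔ x = q := by
    intro x
    rw [List.mem_filter, List.mem_range]
    exact ⟨fun hx => (h x hx.1).1 hx.2, fun e => e ▸ ⟨hq, (h q hq).2 rfl⟩⟩
  cases hl : (List.range n).filter f with
  | nil => simp [hl] at hmem
  | cons x l => exact (hmem x).1 (by simp [hl])

/-- The target of the edge with label `0`. -/
def prevNode {t i : ℕ} {c : Color t} (x : (colorDag c).Node (i + 1)) : (colorDag c).Node i :=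
  ⟨x.1.prev, x.2.prev⟩

theorem prevIndex_levelMatrix {i : ℕ} (x : (colorDag (mpc G t v)).Node (i + 1)) :
    prevIndex (levelMatrix N i) (N.num (i + 1) x) =
      N.num i (prevNode x) := by
  have hlen : ((levelMatrix N i).getD (N.num (i + 1) x) []).length = N.width i := by
    rw [levelMatrix, getD_ofFn, List.length_ofFn]
  rw [prevIndex, hlen]
  refine headD_filter_range (Fin.is_lt _) fun q hq => ?_
  obtain ⟨y, hy⟩ := (N.num i).surjective ⟨q, hq⟩
  have hq' : q = N.num i y := by rw [hy]
  subst hq'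
  have h1 : y = prevNode x ↔ y.1 = x.1.prev := Subtype.ext_iff
  rw [labelsAt_levelMatrix, Fin.val_inj, (N.num i).apply_eq_iff_eq, h1, ← zero_mem_edgeLabels]
  simp [List.any_eq_true]

/-! ### The numbers of the vertices -/

/-- The node on level `i` for the colour of a vertex. -/
noncomputable def vertexNode {i : ℕ} (hi : i ≤ t) {y : Fin G.order} (hy : Near v (t - i) y) :
    (colorDag (mpc G t v)).Node i :=
  ⟨mpc G i y, occurs_of_near hy (by omega)⟩

open Classical in
/-- The number of the node on level `i` for the colour of a vertex. -/
noncomputable def vertexIndex (i : ℕ) (y : Fin G.order) : ℕ :=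
  if h : i ≤ t ∧ Near v (t - i) y then N.num i (vertexNode h.1 h.2) else 0

theorem vertexIndex_eq {i : ℕ} (hi : i ≤ t) {y : Fin G.order} (hy : Near v (t - i) y) :
    vertexIndex N i y = N.num i (vertexNode hi hy) :=
  dif_pos ⟨hi, hy⟩

theorem vertexIndex_inj {i : ℕ} (hi : i ≤ t) {y z : Fin G.order} (hy : Near v (t - i) y)
    (hz : Near v (t - i) z) : vertexIndex N i y = vertexIndex N i z ↔ mpc G i y = mpc G i z := by
  rw [vertexIndex_eq N hi hy, vertexIndex_eq N hi hz, Fin.val_inj, (N.num i).apply_eq_iff_eq]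
  exact Subtype.ext_iff

theorem exists_vertexIndex_eq {i : ℕ} (hi : i ≤ t) {q : ℕ} (hq : q < N.width i) :
    ∃ y, Near v (t - i) y ∧ vertexIndex N i y = q := by
  refine ⟨_, near_nodeVertex ((N.num i).symm ⟨q, hq⟩), ?_⟩
  rw [vertexIndex_eq N hi (near_nodeVertex _)]
  have : vertexNode hi (near_nodeVertex ((N.num i).symm ⟨q, hq⟩)) = (N.num i).symm ⟨q, hq⟩ :=
    Subtype.ext (mpc_nodeVertex _)
  rw [this]
  exact congrArg Fin.val ((N.num i).apply_symm_apply _)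

/-- The top level has a single node, so every numbering gives it the number `0`, and the search for
the root class can start there. -/
theorem vertexIndex_top : vertexIndex N t v = 0 := by
  rw [vertexIndex_eq N le_rfl (near_self _ _)]
  set x := vertexNode le_rfl (near_self v (t - t))
  have hpos : 0 < N.width t := (N.num t x).pos
  obtain ⟨y, hy⟩ := (N.num t).surjective ⟨0, hpos⟩
  obtain ⟨u, hu, hm⟩ := exists_near_of_occurs y.2
  rw [Nat.sub_self] at hu
  have : y = x := Subtype.ext (by rw [← hm, show u = v from hu]; rfl)
  rw [← this, hy]

theorem near_pred {i : ℕ} (hi : i + 1 ≤ t) {y : Fin G.order} (hy : Near v (t - (i + 1)) y) :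
    Near v (t - i) y := by
  rw [show t - i = t - (i + 1) + 1 by omega]
  exact Or.inl hy

theorem prevIndex_vertexIndex {i : ℕ} (hi : i + 1 ≤ t) {y : Fin G.order}
    (hy : Near v (t - (i + 1)) y) :
    prevIndex (levelMatrix N i) (vertexIndex N (i + 1) y) = vertexIndex N i y := by
  rw [vertexIndex_eq N hi hy, vertexIndex_eq N (by omega) (near_pred hi hy), prevIndex_levelMatrix]
  rfl

theorem getD_map_levelMatrix {i : ℕ} (hi : i < t) :
    ((List.range t).map (levelMatrix N)).getD i [] = levelMatrix N i := by
  rw [List.getD_eq_getElem _ _ (by simpa using hi)]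
  simp

/-- Edges labelled `0` stay at the vertex and forget one round. The distance bound is carried along
because each further step needs it. -/
theorem descend_vertexIndex {j k : ℕ} (hj : j ≤ t) (hk : k ≤ j) {y : Fin G.order}
    (hy : Near v (t - j) y) :
    descend ((List.range t).map (levelMatrix N)) j k (vertexIndex N j y) =
        vertexIndex N (j - k) y ∧ Near v (t - (j - k)) y := by
  induction k with
  | zero => exact ⟨rfl, hy⟩
  | succ k ih =>
    obtain ⟨h1, h2⟩ := ih (by omega)
    have e : j - k = j - 1 - k + 1 := by omega
    have e' : j - (k + 1) = j - 1 - k := by omega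
    rw [e] at h1 h2
    rw [descend, List.range_succ, List.foldl_append, ← descend, h1, e']
    simp only [List.foldl_cons, List.foldl_nil]
    rw [getD_map_levelMatrix N (by omega)]
    exact ⟨prevIndex_vertexIndex N (by omega) h2, near_pred (by omega) h2⟩

end DagData

/-! ### A graph for the dag of a final colour -/

section Realization

variable {G : FeaturedGraph} {v : Fin G.order} (N : Numbering (colorDag (mpc G (2 * G.order) v)))

/-- The partition by the colours that are represented on level `n + 1` of the dag. -/
noncomputable def dagPartition : EquitablePartition G where
  -- Level `n + 1` lies `n - 1` levels below the top, deep enough for the ball to be the whole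
  -- component. Its colours, and those one level lower, are already stable.
  domain := Near v (G.order - 1)
  index := vertexIndex N (G.order + 1)
  m := (levelMatrix N G.order).length
  d := degreeOf (levelMatrix N G.order)
  closed y z hy h := near_closed le_rfl y z hy h
  index_lt y hy := by
    have hn := v.pos
    rw [length_levelMatrix, vertexIndex_eq N (by omega)
      (by rwa [show 2 * G.order - (G.order + 1) = G.order - 1 by omega])]
    exact Fin.is_lt _
  exists_index_eq c hc := by
    have hn := v.pos
    rw [length_levelMatrix] at hc
    obtain ⟨y, hy, h⟩ := exists_vertexIndex_eq N (by omega) hc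
    exact ⟨y, near_of_near le_rfl hy, h⟩
  mpc_eq y z hy hz h t := by
    have hn := v.pos
    rw [vertexIndex_inj N (by omega) (near_of_near (by omega) hy) (near_of_near (by omega) hz)] at h
    exact mpc_eq_of_stable (by omega) h t
  degree y hy c hc := by
    classical
    have hn := v.pos
    rw [length_levelMatrix] at hc
    obtain ⟨z₀, hz₀, rfl⟩ := exists_vertexIndex_eq N (by omega) hc
    have hy' : Near v (2 * G.order - (G.order + 1)) y := near_of_near (by omega) hy
    -- Classes are numbered as on level `n + 1`, but the columns of the matrix are nodes of level
    -- `n`; `prevIndex` converts the number.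
    rw [degreeOf, prevIndex_vertexIndex N (by omega) hz₀, vertexIndex_eq N (by omega) hy',
      vertexIndex_eq N (by omega) (near_pred (by omega) hz₀), multiplicity_levelMatrix,
      Nat.card_eq_fintype_card, Fintype.card_subtype]
    refine Eq.trans ?_ (count_mpc_nbrs G.order y z₀).symm
    congr 1
    ext z
    simp only [Finset.mem_filter, Finset.mem_univ, true_and]
    refine and_congr_right fun hz => ?_
    rw [vertexIndex_inj N (by omega) (near_closed (by omega) y z hy' hz) hz₀]
    -- By stability, `n` and `n + 1` rounds induce the same partition.
    exact ⟨fun h => mpc_eq_of_le (by omega) h, fun h => mpc_eq_of_stable (by omega) h _⟩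

theorem half_two_mul (n : ℕ) : half (2 * n) = n := by
  rw [half, length_filter_range_eq_card]
  have : ((Finset.range (2 * n)).filter fun y => decide (2 * y + 1 < 2 * n) = true) =
      Finset.range n := by
    ext j
    simp only [Finset.mem_filter, Finset.mem_range, decide_eq_true_eq]
    omega
  rw [this, Finset.card_range]

theorem encodeRooted_cellGraph (m : ℕ) (M : List (List (List (List Bool)))) (S : List ℕ)
    (L : List (ℕ × ℕ)) (hL : L.Nodup) (φ : ℕ → List Bool) (r : ℕ) (w : Fin L.length)
    (hw : L[w] = (r, 0)) : cellString L r m M S φ =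
      encodeRooted (cellGraph m (degreeOf M) (fun c => S.getD c 0) L φ) w := by
  classical
  unfold cellString encodeRooted
  congr 2
  · congr 1
    refine (ofFn_getElem_eq_map L _ _ fun u => ?_).symm
    rw [Bool.eq_iff_iff]
    simp only [decide_eq_true_eq, Bool.and_eq_true]
    -- Cells are listed without repetition, so the cell `(r, 0)` singles out the root.
    have : L[u] = L[w] ↔ u = w := by
      rw [Fin.ext_iff]; exact hL.getElem_inj_iff
    rw [hw, Prod.ext_iff] at this
    exact this.symm
  · congr 1
    · congr 1
      exact (ofFn_getElem_eq_map L _ _ fun u => rfl).symm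
    · congr 2
      refine (ofFn_getElem_eq_map L _ _ fun u => ?_).symm
      congr 1
      refine ofFn_getElem_eq_map L _ _ fun w => ?_
      rw [Bool.eq_iff_iff, decide_eq_true_eq]
      rfl

/-- From the dag of a final colour, `graphString` computes a graph with a vertex of this colour. -/
theorem exists_graphString_eq : ∃ (H : FeaturedGraph) (w : Fin H.order), H.order = G.order ∧
    (∀ t, mpc H t w = mpc G t v) ∧ (∀ k, FeatureBound G k → FeatureBound H k) ∧
      graphString (dagData N) = encodeRooted H w := by
  have hn := v.pos
  set P := dagPartition N
  set M := levelMatrix N G.order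
  set Ms := (List.range (2 * G.order)).map (levelMatrix N)
  set B := (dagData N).1 with hB
  set f : ℕ → ℕ := fun c => (sizeList M G.order).getD c 0
  have hf : Admissible P.m P.d f := P.admissible.classSizes P.sum_size_le
  have hsum : ∑ c ∈ Finset.range P.m, f c ≤ G.order :=
    (Finset.sum_le_sum fun c hc => P.admissible.classSizes_le _ (Finset.mem_range.1 hc)).trans
      P.sum_size_le
  have hv : Near v (G.order - 1) v := near_self v _
  have hr : P.index v < P.m := P.index_lt v hv
  -- Any vertex in the class of `v` can serve as root; `d c c < f c` guarantees that there is one.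
  have hmem : (P.index v, 0) ∈ cells P.m f G.order :=
    List.mem_append_left _ (mem_blockCells.2 ⟨hr, Nat.zero_lt_of_lt (hf.lt _ hr)⟩)
  obtain ⟨i, hi, hw⟩ := List.getElem_of_mem hmem
  have hroot : descend Ms (2 * G.order) (G.order - 1) 0 = P.index v := by
    have h := (descend_vertexIndex N (j := 2 * G.order) (k := G.order - 1) le_rfl (by omega)
      (near_self v _)).1
    rw [vertexIndex_top, show 2 * G.order - (G.order - 1) = G.order + 1 by omega] at h
    exact h
  have hφ : ∀ y, P.domain y → classFeature B Ms G.order (P.index y) = G.feature y := by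
    intro y hy
    have h := descend_vertexIndex N (j := G.order + 1) (k := G.order + 1) (by omega) le_rfl (y := y)
      (near_of_near (by omega) hy)
    have h' : descend Ms (G.order + 1) (G.order + 1) (P.index y) = _ := h.1
    rw [classFeature, h', Nat.sub_self,
      vertexIndex_eq N (Nat.zero_le _) (near_of_near (by omega) hy)]
    exact (getD_ofFn _ _ _).trans (congrArg _ ((N.num 0).symm_apply_apply _))
  refine ⟨cellGraph P.m P.d f (cells P.m f G.order) (classFeature B Ms G.order), ⟨i, hi⟩,
    length_cells hsum, fun t => P.mpc_cellGraph hf hφ t hv ⟨i, hi⟩ (congrArg Prod.fst hw), ?_, ?_⟩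
  · intro k hk u
    change (B.getD _ []).length ≤ k
    -- Wherever the descent ends, also for padding vertices whose class is no node, the feature is a
    -- leaf label or the default `[]`.
    generalize descend _ _ _ _ = q
    by_cases hq : q < N.width 0
    · obtain ⟨y, hy, rfl⟩ := exists_vertexIndex_eq N (Nat.zero_le _) hq
      rw [vertexIndex_eq N (Nat.zero_le _) hy]
      refine le_trans (le_of_eq ?_) (hk y)
      exact congrArg _ ((getD_ofFn _ _ _).trans (congrArg _ ((N.num 0).symm_apply_apply _)))
    · rw [List.getD_eq_default _ _ (by simpa [hB, dagData] using hq)]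
      simp
  · have hlen : (dagData N).2.1.length = 2 * G.order := by simp [dagData]
    have hM : (dagData N).2.1.getD G.order [] = M := getD_map_levelMatrix N (by omega)
    rw [graphString, hlen, half_two_mul, hM, realizationString]
    have h := encodeRooted_cellGraph P.m M (sizeList M G.order) (cells P.m f G.order)
      (nodup_cells _ _ _) (classFeature B Ms G.order) (P.index v) ⟨i, hi⟩ hw
    rw [← hroot] at h
    exact h

end Realization

end MsgPass

/-! ### Transfer of algorithms between graphs and dags -/

namespace MsgPass

/-! ### Feature transformations and dags -/

theorem OutputsInTime.mono {M : Turing.TM2ComputableAux Sym Bool} {s : List Sym} {y : List Bool}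
    {m m' : ℕ} (h : OutputsInTime M s y m) (hm : m ≤ m') : OutputsInTime M s y m' :=
  h.map fun h => ⟨h.toEvalsTo, h.steps_le_m.trans hm⟩

/-- The type of a final colour depends on the order of the graph, so final colours in two graphs of
equal order can only be compared heterogeneously. -/
theorem exists_encodeDag_eq {s t : ℕ} (h : s = t) {c : Color s} {c' : Color t} (hc : HEq c c')
    (N : Numbering (colorDag c)) :
    ∃ N' : Numbering (colorDag c'), encodeDag (colorDag c) N = encodeDag (colorDag c') N' := by
  subst h
  obtain rfl := eq_of_heq hc
  exact ⟨N, rfl⟩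

/-- Equal final colours give the same dag and, with a transported numbering, the same input string;
a machine has only one output on it. -/
theorem ComputableFromDag.mpInvariant {F : FeatureTransformation} (hF : ComputableFromDag F) :
    MPInvariant F := by
  obtain ⟨M, hM⟩ := hF
  intro G H v w ho hc
  have hn := v.pos
  obtain ⟨N⟩ := nonempty_numbering (t := 2 * G.order) v
  have he : HEq (finalColor G v) (finalColor H w) := by
    have h1 : finalColor G v = mpc H (2 * G.order) w := hc _ (by omega)
    rw [h1, ho, finalColor]
  obtain ⟨N', hN'⟩ := exists_encodeDag_eq (by rw [ho]) he N
  have h1 := hM G v N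
  have h2 := hM H w N'
  rw [← hN'] at h2
  exact h1.unique h2

/-- A program that turns the dag of a final colour into a rooted graph with this colour. -/
theorem exists_fromDag : ∃ (c : Cmd (Fin 4)) (q : Polynomial ℕ), ∀ (G : FeaturedGraph)
    (v : Fin G.order) (N : Numbering (colorDag (finalColor G v))),
    ∃ (H : FeaturedGraph) (w : Fin H.order), H.order = G.order ∧
      (∀ t, mpc H t w = mpc G t v) ∧ (∀ k, FeatureBound G k → FeatureBound H k) ∧
      ∀ (M : Turing.TM2ComputableAux Sym Bool) (y : List Bool) (m : ℕ),
        OutputsInTime M (encodeRooted H w) y m →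
          OutputsInTime (preprocess c M) (encodeDag (colorDag (finalColor G v)) N) y
            (m + q.eval (encodeDag (colorDag (finalColor G v)) N).length) := by
  obtain ⟨c, q, hq⟩ := polyTime_graphString.exists_runs
  -- One `q` bounds the running time of the program, the other the length of its output, which has
  -- to be moved to the input stack.
  refine ⟨c, 2 * q + 1, fun G v N => ?_⟩
  obtain ⟨H, w, ho, hm, hb, hs⟩ := exists_graphString_eq N
  refine ⟨H, w, ho, hm, hb, fun M y m h => ?_⟩
  obtain ⟨h1, h2⟩ := hq _ _ (represents_encodeDag N)
  rw [← hs] at h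
  refine (outputsInTime_preprocess c M h1 h).mono ?_
  simp only [Polynomial.eval_add, Polynomial.eval_mul, Polynomial.eval_ofNat, Polynomial.eval_one]
  change _ ≤ m + (2 * q.eval (encodeDag (colorDag (mpc G (2 * G.order) v)) N).length + 1)
  omega

/-- A program that turns a rooted graph into the dag of its final colour. -/
theorem exists_toDag : ∃ (c : Cmd (Fin 4)) (q : Polynomial ℕ), ∀ (G : FeaturedGraph)
    (v : Fin G.order), ∃ N : Numbering (colorDag (finalColor G v)),
      ∀ (M : Turing.TM2ComputableAux Sym Bool) (y : List Bool) (m : ℕ),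
        OutputsInTime M (encodeDag (colorDag (finalColor G v)) N) y m →
          OutputsInTime (preprocess c M) (encodeRooted G v) y
            (m + q.eval (encodeRooted G v).length) := by
  obtain ⟨c, q, hq⟩ := polyTime_dagString.exists_runs
  refine ⟨c, 2 * q + 1, fun G v => ⟨nodeNumbering v (2 * G.order), fun M y m h => ?_⟩⟩
  obtain ⟨h1, h2⟩ := hq _ _ (represents_encodeRooted G v)
  rw [← dagString_eq] at h
  refine (outputsInTime_preprocess c M h1 h).mono ?_
  simp only [Polynomial.eval_add, Polynomial.eval_mul, Polynomial.eval_ofNat, Polynomial.eval_one]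
  omega

open Polynomial in
/-- A bound for the length of the string for the dag of a final colour. -/
noncomputable def dagBound : Polynomial ℕ :=
  2 * ((X * (X + 2) + 2) + (2 * X * (X * (X * (2 * (X + 2) + 2) + 2) + 2) + 2)) + 2

open Polynomial in
/-- A bound for the length of the string for a rooted graph. -/
noncomputable def rootedBound : Polynomial ℕ :=
  3 * ((X + 2) + (X * (X + 2) + 2) + (X * (X + 2) + 2)) + 2

theorem length_encodeDag_le_eval {G : FeaturedGraph} (v : Fin G.order)
    (N : Numbering (colorDag (finalColor G v))) {k : ℕ} (hk : FeatureBound G k) :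
    (encodeDag (colorDag (finalColor G v)) N).length ≤ dagBound.eval (G.order + k) := by
  refine (length_encodeDag_le v N hk).trans ?_
  simp only [dagBound, Polynomial.eval_add, Polynomial.eval_mul, Polynomial.eval_ofNat,
    Polynomial.eval_X]
  gcongr <;> omega

theorem length_encodeRooted_le_eval {G : FeaturedGraph} (v : Fin G.order) {k : ℕ}
    (hk : FeatureBound G k) : (encodeRooted G v).length ≤ rootedBound.eval (G.order + k) := by
  refine (length_encodeRooted_le v hk).trans ?_
  simp only [rootedBound, Polynomial.eval_add, Polynomial.eval_mul, Polynomial.eval_ofNat,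
    Polynomial.eval_X]
  gcongr <;> omega

end MsgPass

theorem mainTheorem2 :
    ∃ p : Polynomial ℕ,
      (∀ (G : MsgPass.FeaturedGraph) (v : Fin G.order)
        (N : MsgPass.Numbering (MsgPass.colorDag (MsgPass.finalColor G v))) (k : ℕ),
        MsgPass.FeatureBound G k →
          (MsgPass.encodeDag (MsgPass.colorDag (MsgPass.finalColor G v)) N).length
            ≤ p.eval (G.order + k)) ∧
      ∀ F : MsgPass.FeatureTransformation, MsgPass.IsComputable F →
        (MsgPass.MPInvariant F ↔ MsgPass.ComputableFromDag F) ∧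
        (MsgPass.MPInvariant F → ∀ T : ℕ → ℕ → ℕ, MsgPass.ComputableInTime F T →
          MsgPass.ComputableFromDagInTime F (fun n k => T n k + p.eval (n + k))) ∧
        (∀ T : ℕ → ℕ → ℕ, MsgPass.ComputableFromDagInTime F T →
          MsgPass.ComputableInTime F (fun n k => T n k + p.eval (n + k))) := by
  obtain ⟨c₁, q₁, h₁⟩ := MsgPass.exists_fromDag
  obtain ⟨c₂, q₂, h₂⟩ := MsgPass.exists_toDag
  refine ⟨MsgPass.dagBound + q₁.comp MsgPass.dagBound + q₂.comp MsgPass.rootedBound,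
    fun G v N k hk => ?_, fun F hF => ⟨⟨fun hinv => ?_, MsgPass.ComputableFromDag.mpInvariant⟩,
      fun hinv T hT => ?_, fun T hT => ?_⟩⟩
  · have := MsgPass.length_encodeDag_le_eval v N hk
    simp only [Polynomial.eval_add]
    omega
  · obtain ⟨M, hM⟩ := hF
    refine ⟨MsgPass.preprocess c₁ M, fun G v N => ?_⟩
    obtain ⟨H, w, ho, hm, -, h⟩ := h₁ G v N
    rw [← hinv H G w v ho fun t _ => hm t]
    obtain ⟨m, hm⟩ := (MsgPass.outputs_iff_exists_outputsInTime _ _ _).1 (hM H w)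
    exact (MsgPass.outputs_iff_exists_outputsInTime _ _ _).2 ⟨_, h M _ m hm⟩
  · obtain ⟨M, hM⟩ := hT
    refine ⟨MsgPass.preprocess c₁ M, fun G v N k hk => ?_⟩
    obtain ⟨H, w, ho, hm, hb, h⟩ := h₁ G v N
    -- The machine runs on `H` instead of `G`. The time bound `T n k` still applies because `H` has
    -- the same order and no longer features.
    rw [← hinv H G w v ho fun t _ => hm t]
    refine (h M _ _ (hM H w k (hb k hk))).mono ?_
    have := MsgPass.eval_mono q₁ (MsgPass.length_encodeDag_le_eval v N hk)
    simp only [Polynomial.eval_add, Polynomial.eval_comp, ho]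
    omega
  · obtain ⟨M, hM⟩ := hT
    refine ⟨MsgPass.preprocess c₂ M, fun G v k hk => ?_⟩
    obtain ⟨N, h⟩ := h₂ G v
    refine (h M _ _ (hM G v N k hk)).mono ?_
    have := MsgPass.eval_mono q₂ (MsgPass.length_encodeRooted_le_eval v hk)
    simp only [Polynomial.eval_add, Polynomial.eval_comp]
    omega
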